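/- **Definitions.** Manifolds are smooth, finite-dimensional, Hausdorff, second countable and without boundary; $\mathfrak g$ is a finite-dimensional real Lie algebra. A *singular foliation* $\mathcal F$ of a manifold $M$ is a partition of $M$ into connected immersed submanifolds (the leaves) such that every vector tangent to a leaf extends to a smooth vector field in $\mathfrak X(\mathcal F)$, the space of smooth vector fields on $M$ that are tangent to the leaves. Put $\mathfrak L(\mathcal F)=\{X\in\mathfrak X(M): [X,Y]\in\mathfrak X(\mathcal F)\text{ for all }Y\in\mathfrak X(\mathcal F)\}$ (foliate fields) and $\mathfrak l(\mathcal F)=\mathfrak L(\mathcal F)/\mathfrak X(\mathcal F)$ (transverse fields). A *transverse action* of $\mathfrak g$ on $\mathcal F$ is a Lie algebra homomorphism $\mu:\mathfrak g\to\mathfrak l(\mathcal F)$. A differential form $\omega$ on $M$ is *basic* if $\iota_X\omega=0$ and $\iota_Xd\omega=0$ for all $X\in\mathfrak X(\mathcal F)$; let $\Omega(\mathcal F)=\bigoplus_k\Omega^k(\mathcal F)$ be the algebra of basic forms. For $X\in\mathfrak g$ let $\iota_X$ be the contraction of basic forms with any foliate representative of $\mu(X)$, and $\mathcal L_X=d\iota_X+\iota_Xd$.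 The *basic Cartan complex* is the space $C_{\mathfrak g}(\mathcal F)=(\mathrm{Sym}(\mathfrak g^*)\otimes\Omega(\mathcal F))^{\mathfrak g}$ of elements killed by $f\otimes\omega\mapsto \mathrm{ad}^*_Xf\otimes\omega+f\otimes\mathcal L_X\omega$ for all $X\in\mathfrak g$, where $(\mathrm{ad}^*_X\phi)(Y)=\phi(-[X,Y])$ for $\phi\in\mathfrak g^*$, extended to $\mathrm{Sym}(\mathfrak g^*)$ as a derivation. Its differential is $(d_{\mathfrak g}\omega)(X)=d(\omega(X))-\iota_X(\omega(X))$, and its cohomology is the *equivariant basic cohomology* $H_{\mathfrak g}(\mathcal F)$, an algebra over $\mathrm{Sym}(\mathfrak g^*)^{\mathfrak g}$ with product induced by $(\omega\eta)(X)=\omega(X)\wedge\eta(X)$. Let $(M,\mathcal F)$ and $(N,\mathcal G)$ be singular foliations with transverse actions $\mu$, $\nu$ of $\mathfrak g$. A smooth map $f:M\to N$ is *foliate* if it maps each leaf of $\mathcal F$ into a leaf of $\mathcal G$. A foliate map is *$\mathfrak g$-equivariant* if, for each $X\in\mathfrak g$, $\mu(X)$ and $\nu(X)$ have foliate representatives $\tilde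 X$, $\tilde Y$ with $df\circ\tilde X=\tilde Y\circ f$. Such an $f$ induces, by pulling back cocycles under $\mathrm{id}\otimes f^*$, a map $f^*:H_{\mathfrak g}(\mathcal G)\to H_{\mathfrak g}(\mathcal F)$, linear over $\mathrm{Sym}(\mathfrak g^*)^{\mathfrak g}$. A *foliate $\mathfrak g$-equivariant homotopy* is a smooth map $f:M\times[0,1]\to N$ such that $f_t=f(\cdot,t)$ is foliate and $\mathfrak g$-equivariant for every $t\in[0,1]$. **Proposition.** Let $(M,\mathcal F)$ and $(N,\mathcal G)$ be singular foliations with transverse actions $\mu$, $\nu$ of $\mathfrak g$. 1. If $f:M\times[0,1]\to N$ is a foliate $\mathfrak g$-equivariant homotopy, then $$f_0^*=f_1^*:H_{\mathfrak g}(\mathcal G)\longrightarrow H_{\mathfrak g}(\mathcal F).$$ 2. If $f:M\to N$ and $g:N\to M$ are foliate $\mathfrak g$-equivariant maps such that $g\circ f$ and $f\circ g$ are homotopic to $\mathrm{id}_M$ and $\mathrm{id}_N$, respectively, through foliate $\mathfrak g$-equivariant homotopies, then $f^*:H_{\mathfrak g}(\mathcal G)\to H_{\mathfrak g}(\mathcal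 F)$ is an isomorphism of $\mathrm{Sym}(\mathfrak g^*)^{\mathfrak g}$-algebras. In particular $H_{\mathfrak g}(\mathcal F)\cong H_{\mathfrak g}(\mathcal G)$. -/

import Mathlib

open scoped Manifold ContDiff TensorProduct DirectSum Topology

set_option linter.unusedSectionVars false

noncomputable section
namespace EquivariantBasic

section LinearAlgebra

variable {E : Type*} [NormedAddCommGroup E] [NormedSpace ℝ E]

lemma curryLeft_alternatize_zero (f : E →L[ℝ] E [⋀^Fin 0]→L[ℝ] ℝ) (v : E) :
    (ContinuousAlternatingMap.alternatizeUncurryFin f).curryLeft v = f v := by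
  ext w
  simp [ContinuousAlternatingMap.alternatizeUncurryFin_apply]

lemma curryLeft_alternatize {k : ℕ} (f : E →L[ℝ] E [⋀^Fin (k + 1)]→L[ℝ] ℝ)
    (g : E →L[ℝ] E [⋀^Fin k]→L[ℝ] ℝ) (v : E) (hg : ∀ u, g u = (f u).curryLeft v) :
    (ContinuousAlternatingMap.alternatizeUncurryFin f).curryLeft v =
      f v - ContinuousAlternatingMap.alternatizeUncurryFin g := by
  ext w
  have h (i : Fin (k + 1)) : i.succ.removeNth (Matrix.vecCons v w) =
      Matrix.vecCons v (i.removeNth w) := by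
    funext j
    refine Fin.cases ?_ (fun j => ?_) j <;> simp [Fin.removeNth]
  simp only [ContinuousAlternatingMap.curryLeft_apply_apply,
    ContinuousAlternatingMap.alternatizeUncurryFin_apply, Fin.sum_univ_succ (n := k + 1),
    ContinuousAlternatingMap.sub_apply, hg, h]
  simp [pow_succ, sub_eq_add_neg]

lemma curryLeft_curryLeft_comm {k : ℕ} (f : E [⋀^Fin (k + 2)]→L[ℝ] ℝ) (v w : E) :
    (f.curryLeft v).curryLeft w = - (f.curryLeft w).curryLeft v := by
  have h := f.curryLeft_same (v + w)
  have h1 := f.curryLeft_same v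
  have h2 := f.curryLeft_same w
  simp only [map_add, ContinuousAlternatingMap.curryLeft_add,
    _root_.add_apply, h1, h2] at h
  rw [eq_neg_iff_add_eq_zero, add_comm]
  simpa using h

lemma contDiffAt_bilin {D V W U : Type*} [NormedAddCommGroup D] [NormedSpace ℝ D]
    [NormedAddCommGroup V] [NormedSpace ℝ V]
    [NormedAddCommGroup W] [NormedSpace ℝ W] [NormedAddCommGroup U] [NormedSpace ℝ U]
    (L : V →L[ℝ] W →L[ℝ] U) {β : D → V} {X : D → W} {p : D} {n : WithTop ℕ∞}
    (hβ : ContDiffAt ℝ n β p) (hX : ContDiffAt ℝ n X p) :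
    ContDiffAt ℝ n (fun y => L (β y) (X y)) p :=
  (L.contDiff.contDiffAt.comp p hβ).clm_apply hX

/-- Contraction with a fixed vector, as a continuous linear map. -/
def contractCLM (k : ℕ) (v : E) :
    E [⋀^Fin (k + 1)]→L[ℝ] ℝ →L[ℝ] E [⋀^Fin k]→L[ℝ] ℝ :=
  (ContinuousLinearMap.apply ℝ (E [⋀^Fin k]→L[ℝ] ℝ) v).comp
    (ContinuousAlternatingMap.curryLeftLI (𝕜 := ℝ) (E := E) (F := ℝ)
      (n := k)).toContinuousLinearMap

@[simp] lemma contractCLM_apply {k : ℕ} (v : E) (f : E [⋀^Fin (k + 1)]→L[ℝ] ℝ) :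
    contractCLM k v f = f.curryLeft v := rfl

lemma fderiv_bilin {V W U : Type*} [NormedAddCommGroup V] [NormedSpace ℝ V]
    [NormedAddCommGroup W] [NormedSpace ℝ W] [NormedAddCommGroup U] [NormedSpace ℝ U]
    (L : V →L[ℝ] W →L[ℝ] U) {β : E → V} {X : E → W} {p : E}
    (hβ : DifferentiableAt ℝ β p) (hX : DifferentiableAt ℝ X p) (u : E) :
    fderiv ℝ (fun y => L (β y) (X y)) p u =
      L (fderiv ℝ β p u) (X p) + L (β p) (fderiv ℝ X p u) := by
  have := (L.hasFDerivAt_of_bilinear hβ.hasFDerivAt hX.hasFDerivAt).fderiv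
  rw [this]
  simp [add_comm]

lemma fderiv_contract {k : ℕ} {β : E → E [⋀^Fin (k + 1)]→L[ℝ] ℝ} {X : E → E} {p : E}
    (hβ : DifferentiableAt ℝ β p) (hX : DifferentiableAt ℝ X p) (u : E) :
    fderiv ℝ (fun y => (β y).curryLeft (X y)) p u =
      (fderiv ℝ β p u).curryLeft (X p) + (β p).curryLeft (fderiv ℝ X p u) :=
  fderiv_bilin (ContinuousAlternatingMap.curryLeftLI (𝕜 := ℝ) (E := E) (F := ℝ)
      (n := k)).toContinuousLinearMap hβ hX u

/-- The contraction by a vector field `Y` that annihilates both `β` and `dβ` also annihilates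
`d (ι_X β)`, if moreover `[Y, X]` annihilates `β`. -/
lemma extDeriv_contract {k : ℕ} {β : E → E [⋀^Fin (k + 1)]→L[ℝ] ℝ} {X Y : E → E} {p : E}
    (hβ : DifferentiableAt ℝ β p) (hX : DifferentiableAt ℝ X p) (hY : DifferentiableAt ℝ Y p)
    (h0 : ∀ᶠ y in 𝓝 p, (β y).curryLeft (Y y) = 0)
    (h1 : (extDeriv β p).curryLeft (Y p) = 0)
    (h2 : (β p).curryLeft (VectorField.lieBracket ℝ X Y p) = 0) :
    (extDeriv (fun y => (β y).curryLeft (X y)) p).curryLeft (Y p) = 0 := by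
  have hd0 (u : E) : (fderiv ℝ β p u).curryLeft (Y p) = - (β p).curryLeft (fderiv ℝ Y p u) := by
    have e : (fun y => (β y).curryLeft (Y y)) =ᶠ[𝓝 p] fun _ => 0 := h0
    have := fderiv_contract hβ hY u
    rw [e.fderiv_eq] at this
    rw [eq_neg_iff_add_eq_zero]
    simpa using this.symm
  have hb : (β p).curryLeft (fderiv ℝ X p (Y p)) = (β p).curryLeft (fderiv ℝ Y p (X p)) := by
    rw [VectorField.lieBracket, map_sub, sub_eq_zero] at h2
    exact h2.symm
  set f := fderiv ℝ β p with hf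
  let gY : E →L[ℝ] E [⋀^Fin k]→L[ℝ] ℝ := (contractCLM k (Y p)).comp f
  have hgY (u : E) : gY u = (f u).curryLeft (Y p) := rfl
  have h1' := h1
  rw [extDeriv, curryLeft_alternatize f gY _ hgY, sub_eq_zero] at h1'
  set γ := fderiv ℝ (fun y => (β y).curryLeft (X y)) p with hγ
  have hγu (u : E) : γ u = (f u).curryLeft (X p) + (β p).curryLeft (fderiv ℝ X p u) :=
    fderiv_contract hβ hX u
  rw [extDeriv, ← hγ]
  have h3 : (f (Y p)).curryLeft (X p) =
      (ContinuousAlternatingMap.alternatizeUncurryFin gY).curryLeft (X p) := by rw [h1']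
  cases k with
  | zero =>
    rw [curryLeft_alternatize_zero] at h3 ⊢
    rw [hγu, h3, hgY, hd0, hb, neg_add_cancel]
  | succ m =>
    rw [curryLeft_alternatize gY ((contractCLM m (X p)).comp gY) _ fun u => rfl] at h3
    have hs (u : E) : (-(contractCLM m (X p)).comp gY) u = (γ u).curryLeft (Y p) := by
      have hY0 : (β p).curryLeft (Y p) = 0 := h0.self_of_nhds
      rw [hγu, ContinuousAlternatingMap.curryLeft_add, _root_.add_apply,
        curryLeft_curryLeft_comm (β p), hY0, curryLeft_curryLeft_comm (f u)]
      simp [hgY]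
    rw [curryLeft_alternatize γ _ _ hs, hγu, h3, hgY, hd0, hb]
    rw [← ContinuousAlternatingMap.alternatizeUncurryFinCLM_apply,
      ← ContinuousAlternatingMap.alternatizeUncurryFinCLM_apply, map_neg]
    abel

end LinearAlgebra

section Forms

variable {E : Type*} [NormedAddCommGroup E] [NormedSpace ℝ E]
  {M : Type*} [TopologicalSpace M] [ChartedSpace E M]

variable (E M) in
/-- Not necessarily smooth differential `k`-forms. In Mathlib the tangent space
`TangentSpace 𝓘(ℝ, E) x` of a manifold modelled on `E` is by definition the vector space `E`. -/
abbrev RawForm (k : ℕ) : Type _ := M → E [⋀^Fin k]→L[ℝ] ℝ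

variable (E) in
/-- The derivative `E → T_z M` at `y` of the inverse of the preferred chart at `x₀`. -/
def chartSymmDeriv (x₀ : M) (y : E) : E →L[ℝ] E :=
  mfderiv 𝓘(ℝ, E) 𝓘(ℝ, E) (extChartAt 𝓘(ℝ, E) x₀).symm y

variable (E) in
/-- The derivative `T_x M → E` at `x` of the preferred chart at `x₀`. -/
def chartDeriv (x₀ x : M) : E →L[ℝ] E :=
  mfderiv 𝓘(ℝ, E) 𝓘(ℝ, E) (extChartAt 𝓘(ℝ, E) x₀) x

/-- The coordinate expression, in the preferred chart at `x₀`, of a differential form: its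
pullback under the inverse of the chart. -/
def localRep {k : ℕ} (α : RawForm E M k) (x₀ : M) : E → E [⋀^Fin k]→L[ℝ] ℝ := fun y =>
  (α ((extChartAt 𝓘(ℝ, E) x₀).symm y)).compContinuousLinearMap (chartSymmDeriv E x₀ y)

/-- A differential form is smooth if all its coordinate expressions are. -/
def IsSmoothForm {k : ℕ} (α : RawForm E M k) : Prop :=
  ∀ x₀ : M, ContDiffOn ℝ ∞ (localRep α x₀) (extChartAt 𝓘(ℝ, E) x₀).target

/-- The exterior derivative on a manifold, computed at `x` in the preferred chart at `x`. -/
def extD {k : ℕ} (α : RawForm E M k) : RawForm E M (k + 1) := fun x =>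
  (extDeriv (localRep α x) (extChartAt 𝓘(ℝ, E) x x)).compContinuousLinearMap (chartDeriv E x x)

/-- The contraction (interior product) of a form with a vector field; it is zero on functions. -/
def contract (X : ∀ x : M, TangentSpace 𝓘(ℝ, E) x) :
    (k : ℕ) → RawForm E M k → RawForm E M (k - 1)
  | 0, _ => 0
  | _ + 1, α => fun x => (α x).curryLeft (X x)

lemma localRep_add {k : ℕ} (α β : RawForm E M k) (x₀ : M) :
    localRep (α + β) x₀ = localRep α x₀ + localRep β x₀ := rfl

lemma localRep_smul {k : ℕ} (c : ℝ) (α : RawForm E M k) (x₀ : M) :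
    localRep (c • α) x₀ = c • localRep α x₀ := rfl

lemma localRep_zero {k : ℕ} (x₀ : M) : localRep (0 : RawForm E M k) x₀ = 0 := rfl

lemma isSmoothForm_zero {k : ℕ} : IsSmoothForm (0 : RawForm E M k) := fun x₀ => by
  rw [localRep_zero]; exact contDiffOn_const

lemma IsSmoothForm.add {k : ℕ} {α β : RawForm E M k} (hα : IsSmoothForm α)
    (hβ : IsSmoothForm β) : IsSmoothForm (α + β) := fun x₀ => by
  rw [localRep_add]; exact (hα x₀).add (hβ x₀)

lemma IsSmoothForm.smul {k : ℕ} (c : ℝ) {α : RawForm E M k} (hα : IsSmoothForm α) :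
    IsSmoothForm (c • α) := fun x₀ => by
  rw [localRep_smul]; exact (hα x₀).const_smul c

lemma target_mem {x₀ : M} {y : E} (hy : y ∈ (extChartAt 𝓘(ℝ, E) x₀).target) :
    (extChartAt 𝓘(ℝ, E) x₀).target ∈ 𝓝 y :=
  (isOpen_extChartAt_target x₀).mem_nhds hy

lemma IsSmoothForm.contDiffAt {k : ℕ} {α : RawForm E M k} (hα : IsSmoothForm α) {x₀ : M} {y : E}
    (hy : y ∈ (extChartAt 𝓘(ℝ, E) x₀).target) : ContDiffAt ℝ ∞ (localRep α x₀) y :=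
  (hα x₀).contDiffAt (target_mem hy)

lemma IsSmoothForm.differentiableAt {k : ℕ} {α : RawForm E M k} (hα : IsSmoothForm α) (x : M) :
    DifferentiableAt ℝ (localRep α x) (extChartAt 𝓘(ℝ, E) x x) :=
  (hα.contDiffAt (mem_extChartAt_target x)).differentiableAt (by simp)

lemma extD_add {k : ℕ} {α β : RawForm E M k} (hα : IsSmoothForm α) (hβ : IsSmoothForm β) :
    extD (α + β) = extD α + extD β := by
  funext x
  simp only [extD, localRep_add, Pi.add_apply]
  rw [extDeriv_add (hα.differentiableAt x) (hβ.differentiableAt x)]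
  rfl

lemma extD_smul {k : ℕ} (c : ℝ) (α : RawForm E M k) : extD (c • α) = c • extD α := by
  funext x
  simp only [extD, localRep_smul, Pi.smul_apply]
  rw [extDeriv_smul]
  rfl

lemma extD_zero {k : ℕ} : extD (0 : RawForm E M k) = 0 := by
  simpa using extD_smul (0 : ℝ) (0 : RawForm E M k)

lemma isManifold_one [h : IsManifold 𝓘(ℝ, E) ∞ M] : IsManifold 𝓘(ℝ, E) 1 M :=
  IsManifold.of_le (n := ∞) (by simp)

variable [IsManifold 𝓘(ℝ, E) ∞ M]

lemma mdiffAt_symm {x₀ : M} {y : E} (hy : y ∈ (extChartAt 𝓘(ℝ, E) x₀).target) :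
    MDifferentiableAt 𝓘(ℝ, E) 𝓘(ℝ, E) (extChartAt 𝓘(ℝ, E) x₀).symm y := by
  have := isManifold_one (E := E) (M := M)
  have h := mdifferentiableWithinAt_extChartAt_symm (I := 𝓘(ℝ, E)) hy
  rwa [modelWithCornersSelf_coe, Set.range_id, mdifferentiableWithinAt_univ] at h

lemma mdiffAt_chart {x₀ x : M} (hx : x ∈ (extChartAt 𝓘(ℝ, E) x₀).source) :
    MDifferentiableAt 𝓘(ℝ, E) 𝓘(ℝ, E) (extChartAt 𝓘(ℝ, E) x₀) x := by
  have := isManifold_one (E := E) (M := M)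
  exact mdifferentiableAt_extChartAt (by simpa using hx)

/-- The transition map between two preferred charts. -/
def trans (x₀ z : M) : E → E := extChartAt 𝓘(ℝ, E) z ∘ (extChartAt 𝓘(ℝ, E) x₀).symm

lemma trans_contDiffAt {x₀ z : M} {y : E} (hy : y ∈ (extChartAt 𝓘(ℝ, E) x₀).target)
    (hz : (extChartAt 𝓘(ℝ, E) x₀).symm y ∈ (extChartAt 𝓘(ℝ, E) z).source) :
    ContDiffAt ℝ ∞ (trans x₀ z) y := by
  have h := contDiffWithinAt_ext_coord_change (I := 𝓘(ℝ, E)) (n := ∞) z x₀ (y := y)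
    (by rw [PartialEquiv.trans_source]; exact ⟨hy, hz⟩)
  rwa [modelWithCornersSelf_coe, Set.range_id, contDiffWithinAt_univ] at h

lemma symm_eventually {x₀ z : M} {y : E} (hy : y ∈ (extChartAt 𝓘(ℝ, E) x₀).target)
    (hz : (extChartAt 𝓘(ℝ, E) x₀).symm y ∈ (extChartAt 𝓘(ℝ, E) z).source) :
    ∀ᶠ y' in 𝓝 y, y' ∈ (extChartAt 𝓘(ℝ, E) x₀).target ∧
      (extChartAt 𝓘(ℝ, E) x₀).symm y' ∈ (extChartAt 𝓘(ℝ, E) z).source :=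
  (Filter.eventually_of_mem (target_mem hy) fun _ h => h).and
    ((mdiffAt_symm hy).continuousAt.eventually_mem ((isOpen_extChartAt_source z).mem_nhds hz))

lemma mfderiv_symm_trans {x₀ z : M} {y : E} (hy : y ∈ (extChartAt 𝓘(ℝ, E) x₀).target)
    (hz : (extChartAt 𝓘(ℝ, E) x₀).symm y ∈ (extChartAt 𝓘(ℝ, E) z).source) :
    chartSymmDeriv E x₀ y = (chartSymmDeriv E z (trans x₀ z y)).comp
      (fderiv ℝ (trans x₀ z) y) := by
  have e : (extChartAt 𝓘(ℝ, E) x₀).symm =ᶠ[𝓝 y] (extChartAt 𝓘(ℝ, E) z).symm ∘ trans x₀ z := by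
    filter_upwards [symm_eventually hy hz] with y' hy'
    exact ((extChartAt 𝓘(ℝ, E) z).left_inv hy'.2).symm
  have ht : trans x₀ z y ∈ (extChartAt 𝓘(ℝ, E) z).target := (extChartAt 𝓘(ℝ, E) z).map_source hz
  have hd : MDifferentiableAt 𝓘(ℝ, E) 𝓘(ℝ, E) (trans x₀ z) y :=
    ((trans_contDiffAt hy hz).differentiableAt (by simp)).mdifferentiableAt
  rw [chartSymmDeriv, e.mfderiv_eq, ← mfderiv_eq_fderiv]
  exact mfderiv_comp (I' := 𝓘(ℝ, E)) y (mdiffAt_symm ht) hd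

lemma localRep_trans {k : ℕ} (α : RawForm E M k) {x₀ z : M} {y : E}
    (hy : y ∈ (extChartAt 𝓘(ℝ, E) x₀).target)
    (hz : (extChartAt 𝓘(ℝ, E) x₀).symm y ∈ (extChartAt 𝓘(ℝ, E) z).source) :
    localRep α x₀ y =
      (localRep α z (trans x₀ z y)).compContinuousLinearMap (fderiv ℝ (trans x₀ z) y) := by
  unfold localRep
  rw [mfderiv_symm_trans hy hz]
  have : (extChartAt 𝓘(ℝ, E) z).symm (trans x₀ z y) = (extChartAt 𝓘(ℝ, E) x₀).symm y :=
    (extChartAt 𝓘(ℝ, E) z).left_inv hz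
  rw [this]
  rfl

lemma two_le_infty : minSmoothness ℝ 2 ≤ (∞ : WithTop ℕ∞) := by
  rw [minSmoothness_of_isRCLikeNormedField]
  exact WithTop.coe_le_coe.2 (le_top : (2 : ℕ∞) ≤ ⊤)

/-- In any preferred chart, the exterior derivative is the usual one. -/
lemma localRep_extD {k : ℕ} {α : RawForm E M k} (hα : IsSmoothForm α) {x₀ : M} {y : E}
    (hy : y ∈ (extChartAt 𝓘(ℝ, E) x₀).target) :
    localRep (extD α) x₀ y = extDeriv (localRep α x₀) y := by
  set z := (extChartAt 𝓘(ℝ, E) x₀).symm y with hzdef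
  have hz : (extChartAt 𝓘(ℝ, E) x₀).symm y ∈ (extChartAt 𝓘(ℝ, E) z).source :=
    mem_extChartAt_source z
  have ht : trans x₀ z y ∈ (extChartAt 𝓘(ℝ, E) z).target := (extChartAt 𝓘(ℝ, E) z).map_source hz
  have e : localRep α x₀ =ᶠ[𝓝 y] fun y' =>
      (localRep α z (trans x₀ z y')).compContinuousLinearMap (fderiv ℝ (trans x₀ z) y') := by
    filter_upwards [symm_eventually hy hz] with y' hy'
    exact localRep_trans α hy'.1 hy'.2
  rw [e.extDeriv_eq, extDeriv_pullback (r := ∞)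
    ((hα.contDiffAt ht).differentiableAt (by simp)) (trans_contDiffAt hy hz) two_le_infty]
  have c : (fderiv ℝ (trans x₀ z) y) =
      (chartDeriv E z z).comp (chartSymmDeriv E x₀ y) := by
    rw [← mfderiv_eq_fderiv]
    exact mfderiv_comp y (mdiffAt_chart hz) (mdiffAt_symm hy)
  rw [c]
  rfl

lemma IsSmoothForm.extD {k : ℕ} {α : RawForm E M k} (hα : IsSmoothForm α) :
    IsSmoothForm (extD α) := fun x₀ => by
  refine ContDiffOn.congr (f := extDeriv (localRep α x₀)) ?_ fun y hy => localRep_extD hα hy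
  intro y hy
  apply ContDiffAt.contDiffWithinAt
  exact (ContinuousAlternatingMap.alternatizeUncurryFinCLM ℝ E ℝ).contDiff.contDiffAt.comp y
    ((hα.contDiffAt hy).fderiv_right (m := ∞) (by simp))

lemma extD_extD {k : ℕ} {α : RawForm E M k} (hα : IsSmoothForm α) :
    EquivariantBasic.extD (EquivariantBasic.extD α) = 0 := by
  funext x
  have hx := mem_extChartAt_target (I := 𝓘(ℝ, E)) x
  have e : localRep (EquivariantBasic.extD α) x =ᶠ[𝓝 (extChartAt 𝓘(ℝ, E) x x)]
      extDeriv (localRep α x) :=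
    Filter.eventually_of_mem (target_mem hx) fun y hy => localRep_extD hα hy
  rw [EquivariantBasic.extD, e.extDeriv_eq, extDeriv_extDeriv_apply (hα.contDiffAt hx) two_le_infty]
  rfl

/-! ### Vector fields -/

/-- The expression of a vector field in the preferred chart at `x₀`. -/
def localField (X : ∀ x : M, TangentSpace 𝓘(ℝ, E) x) (x₀ : M) (y : E) : E :=
  VectorField.mpullback 𝓘(ℝ, E) 𝓘(ℝ, E) (extChartAt 𝓘(ℝ, E) x₀).symm X y

lemma chartDeriv_comp (x : M) :
    (chartDeriv E x x).comp (chartSymmDeriv E x (extChartAt 𝓘(ℝ, E) x x)) = .id ℝ E := by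
  have := isManifold_one (E := E) (M := M)
  have h := mfderiv_extChartAt_comp_mfderivWithin_extChartAt_symm' (I := 𝓘(ℝ, E))
    (mem_extChartAt_source (I := 𝓘(ℝ, E)) x)
  rwa [modelWithCornersSelf_coe, Set.range_id, mfderivWithin_univ] at h

lemma chartSymmDeriv_comp (x : M) :
    (chartSymmDeriv E x (extChartAt 𝓘(ℝ, E) x x)).comp (chartDeriv E x x) = .id ℝ E := by
  have := isManifold_one (E := E) (M := M)
  have h := mfderivWithin_extChartAt_symm_comp_mfderiv_extChartAt' (I := 𝓘(ℝ, E))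
    (mem_extChartAt_source (I := 𝓘(ℝ, E)) x)
  rwa [modelWithCornersSelf_coe, Set.range_id, mfderivWithin_univ] at h

lemma chartSymmDeriv_isInvertible {x₀ : M} {y : E} (hy : y ∈ (extChartAt 𝓘(ℝ, E) x₀).target) :
    (mfderiv 𝓘(ℝ, E) 𝓘(ℝ, E) (extChartAt 𝓘(ℝ, E) x₀).symm y).IsInvertible := by
  have := isManifold_one (E := E) (M := M)
  have h := isInvertible_mfderivWithin_extChartAt_symm (I := 𝓘(ℝ, E)) hy
  rwa [modelWithCornersSelf_coe, Set.range_id, mfderivWithin_univ] at h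

lemma chartSymmDeriv_localField (X : ∀ x : M, TangentSpace 𝓘(ℝ, E) x) {x₀ : M} {y : E}
    (hy : y ∈ (extChartAt 𝓘(ℝ, E) x₀).target) :
    chartSymmDeriv E x₀ y (localField X x₀ y) = X ((extChartAt 𝓘(ℝ, E) x₀).symm y) :=
  (chartSymmDeriv_isInvertible hy).self_apply_inverse _

lemma localRep_contract (X : ∀ x : M, TangentSpace 𝓘(ℝ, E) x) {k : ℕ} (α : RawForm E M (k + 1))
    {x₀ : M} {y : E} (hy : y ∈ (extChartAt 𝓘(ℝ, E) x₀).target) :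
    localRep (contract X (k + 1) α) x₀ y = (localRep α x₀ y).curryLeft (localField X x₀ y) := by
  unfold localRep
  rw [ContinuousAlternatingMap.curryLeft_compContinuousLinearMap, chartSymmDeriv_localField X hy]
  rfl

variable (E M) in
/-- Smooth vector fields on `M`. -/
abbrev VField : Type _ := Cₛ^∞⟮𝓘(ℝ, E); E, (TangentSpace 𝓘(ℝ, E) : M → Type _)⟯

variable [FiniteDimensional ℝ E]

lemma localField_contDiffAt (X : VField E M) {x₀ : M} {y : E}
    (hy : y ∈ (extChartAt 𝓘(ℝ, E) x₀).target) : ContDiffAt ℝ ∞ (localField X x₀) y := by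
  have := FiniteDimensional.complete ℝ E
  have hs : ContMDiffAt 𝓘(ℝ, E) 𝓘(ℝ, E) ∞ (extChartAt 𝓘(ℝ, E) x₀).symm y :=
    (contMDiffOn_extChartAt_symm x₀).contMDiffAt (target_mem hy)
  have : IsManifold 𝓘(ℝ, E) (∞ + 1) M := by simpa
  have h := ContMDiffAt.mpullback_vectorField_preimage (m := ∞) (n := ∞)
    (X.contMDiff ((extChartAt 𝓘(ℝ, E) x₀).symm y)) hs (chartSymmDeriv_isInvertible hy) (by simp)
  exact contMDiffAt_vectorSpace_iff_contDiffAt.1 h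

lemma IsSmoothForm.contract (X : VField E M) {k : ℕ} {α : RawForm E M k} (hα : IsSmoothForm α) :
    IsSmoothForm (contract X k α) := by
  cases k with
  | zero => exact isSmoothForm_zero
  | succ k =>
    intro x₀
    refine ContDiffOn.congr
      (f := fun y => (localRep α x₀ y).curryLeft (localField X x₀ y)) ?_
      fun y hy => localRep_contract X α hy
    intro y hy
    apply ContDiffAt.contDiffWithinAt
    exact contDiffAt_bilin (ContinuousAlternatingMap.curryLeftLI (𝕜 := ℝ) (E := E) (F := ℝ)
      (n := k)).toContinuousLinearMap (hα.contDiffAt hy) (localField_contDiffAt X hy)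

/-- The Lie bracket of smooth vector fields. -/
instance : Bracket (VField E M) (VField E M) where
  bracket X Y := ⟨VectorField.mlieBracket 𝓘(ℝ, E) X Y, by
    have := FiniteDimensional.complete ℝ E
    have : IsManifold 𝓘(ℝ, E) (minSmoothness ℝ 2) M := IsManifold.of_le (n := ∞) two_le_infty
    have : IsManifold 𝓘(ℝ, E) (((⊤ : ℕ∞) : WithTop ℕ∞) + 1) M := by simpa
    intro x
    exact ContMDiffAt.mlieBracket_vectorField (m := ⊤) (n := ⊤) (X.contMDiff x) (Y.contMDiff x)
      (by simp)⟩

lemma bracket_apply (X Y : VField E M) (x : M) :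
    (⁅X, Y⁆ : VField E M) x = VectorField.mlieBracket 𝓘(ℝ, E) X Y x := rfl

instance : LieRing (VField E M) where
  add_lie X Y Z := by
    have := isManifold_one (E := E) (M := M)
    ext x
    exact VectorField.mlieBracket_add_left X.mdifferentiableAt Y.mdifferentiableAt
  lie_add X Y Z := by
    have := isManifold_one (E := E) (M := M)
    ext x
    exact VectorField.mlieBracket_add_right Y.mdifferentiableAt Z.mdifferentiableAt
  lie_self X := by
    ext x
    simp [bracket_apply]
  leibniz_lie X Y Z := by
    have := FiniteDimensional.complete ℝ E
    have : IsManifold 𝓘(ℝ, E) (minSmoothness ℝ 3) M := by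
      rw [minSmoothness_of_isRCLikeNormedField]
      exact IsManifold.of_le (n := ∞) (WithTop.coe_le_coe.2 (le_top : (3 : ℕ∞) ≤ ⊤))
    have h (W : VField E M) (x : M) := (W.contMDiff x).of_le two_le_infty
    ext x
    exact VectorField.leibniz_identity_mlieBracket_apply (h X x) (h Y x) (h Z x)

instance : LieAlgebra ℝ (VField E M) where
  lie_smul c X Y := by
    have := isManifold_one (E := E) (M := M)
    ext x
    exact VectorField.mlieBracket_const_smul_right Y.mdifferentiableAt

/-- The Lie bracket in the chart at `x`. -/
lemma chartSymmDeriv_lieBracket (X Y : VField E M) (x : M) :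
    chartSymmDeriv E x (extChartAt 𝓘(ℝ, E) x x)
      (VectorField.lieBracket ℝ (localField X x) (localField Y x) (extChartAt 𝓘(ℝ, E) x x)) =
      (⁅X, Y⁆ : VField E M) x := by
  have := isManifold_one (E := E) (M := M)
  have e : (chartDeriv E x x).inverse = chartSymmDeriv E x (extChartAt 𝓘(ℝ, E) x x) :=
    ContinuousLinearMap.inverse_eq (chartDeriv_comp x) (chartSymmDeriv_comp x)
  rw [bracket_apply, VectorField.mlieBracket, VectorField.mlieBracketWithin_apply,
    modelWithCornersSelf_coe, Set.range_id, VectorField.mpullbackWithin_univ,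
    VectorField.mpullbackWithin_univ, Set.preimage_univ, Set.univ_inter, ← e]
  exact congrArg (chartDeriv E x x).inverse (congrFun VectorField.lieBracketWithin_univ.symm _)

lemma contract_zero_iff (Y : ∀ x : M, TangentSpace 𝓘(ℝ, E) x) {k : ℕ}
    (α : RawForm E M (k + 1)) : contract Y (k + 1) α = 0 ↔ ∀ x, (α x).curryLeft (Y x) = 0 :=
  funext_iff

lemma localRep_curryLeft_eq_zero {k : ℕ} {α : RawForm E M (k + 1)} {x₀ : M} {y v : E}
    (h : (α ((extChartAt 𝓘(ℝ, E) x₀).symm y)).curryLeft (chartSymmDeriv E x₀ y v) = 0) :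
    (localRep α x₀ y).curryLeft v = 0 := by
  rw [localRep, ContinuousAlternatingMap.curryLeft_compContinuousLinearMap, h]
  rfl

/-- If `ι_Y α = 0`, `ι_Y dα = 0` and `ι_[X,Y] α = 0`, then `ι_Y d ι_X α = 0`. -/
lemma contract_extD_contract {k : ℕ} {α : RawForm E M k} (hα : IsSmoothForm α) (X Y : VField E M)
    (h0 : contract Y k α = 0) (h1 : contract Y (k + 1) (extD α) = 0)
    (h2 : contract (⁅X, Y⁆ : VField E M) k α = 0) :
    contract Y (k - 1 + 1) (extD (contract X k α)) = 0 := by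
  cases k with
  | zero =>
    rw [show contract X 0 α = 0 from rfl, extD_zero]
    rfl
  | succ k =>
    rw [contract_zero_iff] at h0 h1 h2 ⊢
    intro x
    have hx := mem_extChartAt_target (I := 𝓘(ℝ, E)) x
    have hx' : (extChartAt 𝓘(ℝ, E) x).symm (extChartAt 𝓘(ℝ, E) x x) = x :=
      extChartAt_to_inv x
    set p := extChartAt 𝓘(ℝ, E) x x with hp
    have hY : chartDeriv E x x (Y x) = localField Y x p := by
      have h := chartSymmDeriv_localField Y hx
      rw [hx'] at h
      have h' := congrArg (fun L => L (localField Y x p)) (chartDeriv_comp (E := E) x)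
      exact (congrArg (chartDeriv E x x) h).symm.trans h'
    have e : localRep (contract X (k + 1) α) x =ᶠ[𝓝 p]
        fun y => (localRep α x y).curryLeft (localField X x y) :=
      Filter.eventually_of_mem (target_mem hx) fun y hy => localRep_contract X α hy
    have key := extDeriv_contract (β := localRep α x) (X := localField X x)
      (Y := localField Y x) (p := p) (hα.differentiableAt x)
      ((localField_contDiffAt X hx).differentiableAt (by simp))
      ((localField_contDiffAt Y hx).differentiableAt (by simp))
      (Filter.eventually_of_mem (target_mem hx) fun y hy => localRep_curryLeft_eq_zero (by
        rw [chartSymmDeriv_localField _ hy]; exact h0 _))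
      (by
        rw [← localRep_extD hα hx]
        apply localRep_curryLeft_eq_zero
        rw [chartSymmDeriv_localField _ hx]; exact h1 _)
      (by
        apply localRep_curryLeft_eq_zero
        rw [chartSymmDeriv_lieBracket, hx']; exact h2 x)
    rw [← e.extDeriv_eq] at key
    refine (ContinuousAlternatingMap.curryLeft_compContinuousLinearMap _ (chartDeriv E x x)
      _).trans ?_
    refine Eq.trans (congrArg (fun v => ContinuousAlternatingMap.compContinuousLinearMap
      (ContinuousAlternatingMap.curryLeft (extDeriv (localRep (contract X (k + 1) α) x) p) v)
      (chartDeriv E x x)) hY) ?_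
    rw [key]
    rfl

lemma contract_add_right (X : ∀ x : M, TangentSpace 𝓘(ℝ, E) x) {k : ℕ} (α β : RawForm E M k) :
    contract X k (α + β) = contract X k α + contract X k β := by
  cases k with
  | zero => exact (add_zero _).symm
  | succ k => rfl

lemma contract_smul_right (X : ∀ x : M, TangentSpace 𝓘(ℝ, E) x) {k : ℕ} (c : ℝ)
    (α : RawForm E M k) : contract X k (c • α) = c • contract X k α := by
  cases k with
  | zero => exact (smul_zero _).symm
  | succ k => rfl

lemma contract_zero_right (X : ∀ x : M, TangentSpace 𝓘(ℝ, E) x) {k : ℕ} :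
    contract X k (0 : RawForm E M k) = 0 := by
  simpa using contract_smul_right X (0 : ℝ) (0 : RawForm E M k)

lemma contract_add_left (X Y : VField E M) {k : ℕ} (α : RawForm E M k) :
    contract (X + Y : VField E M) k α = contract X k α + contract Y k α := by
  cases k with
  | zero => exact (add_zero _).symm
  | succ k => funext x; exact map_add (α x).curryLeft (X x) (Y x)

lemma contract_smul_left (c : ℝ) (X : VField E M) {k : ℕ} (α : RawForm E M k) :
    contract (c • X : VField E M) k α = c • contract X k α := by
  cases k with
  | zero => exact (smul_zero _).symm
  | succ k => funext x; exact map_smul (α x).curryLeft c (X x)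

lemma contract_contract (X Y : ∀ x : M, TangentSpace 𝓘(ℝ, E) x) {k : ℕ} (α : RawForm E M k)
    (h : contract Y k α = 0) : contract Y (k - 1) (contract X k α) = 0 := by
  match k, α, h with
  | 0, _, _ => rfl
  | 1, _, _ => rfl
  | k + 2, α, h =>
    funext x
    have hx : (α x).curryLeft (Y x) = 0 := congrFun h x
    refine (curryLeft_curryLeft_comm (α x) (X x) (Y x)).trans ?_
    refine (congrArg (fun f : E [⋀^Fin (k + 1)]→L[ℝ] ℝ => -(ContinuousAlternatingMap.curryLeft f (X x))) hx).trans ?_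
    exact neg_zero

end Forms

/-! ### Singular foliations -/

section Foliation

variable (E : Type*) [NormedAddCommGroup E] [NormedSpace ℝ E]
  (M : Type*) [TopologicalSpace M] [ChartedSpace E M]

/-- A partition of the manifold `M` into connected immersed submanifolds, the leaves. Each leaf
carries its own topology and smooth structure (it is Hausdorff as soon as `M` is, because the
inclusion is continuous). -/
structure LeafPartition where
  /-- the equivalence relation of lying in the same leaf -/
  rel : Setoid M
  /-- the dimension of a leaf -/
  dim : Quotient rel → ℕ
  /-- the topology of a leaf -/
  top (L : Quotient rel) : TopologicalSpace {x : M // Quotient.mk rel x = L}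
  /-- the atlas of a leaf -/
  charted (L : Quotient rel) :
    ChartedSpace (EuclideanSpace ℝ (Fin (dim L))) {x : M // Quotient.mk rel x = L}
  isManifold (L : Quotient rel) :
    IsManifold 𝓘(ℝ, EuclideanSpace ℝ (Fin (dim L))) ∞ {x : M // Quotient.mk rel x = L}
  secondCountable (L : Quotient rel) :
    SecondCountableTopology {x : M // Quotient.mk rel x = L}
  connected (L : Quotient rel) : ConnectedSpace {x : M // Quotient.mk rel x = L}
  immersed (L : Quotient rel) :
    Manifold.IsImmersion 𝓘(ℝ, EuclideanSpace ℝ (Fin (dim L))) 𝓘(ℝ, E) ∞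
      (Subtype.val : {x : M // Quotient.mk rel x = L} → M)

namespace LeafPartition

variable {E M}

/-- The tangent space at `x` of the leaf through `x`, as a subspace of `T_x M`. -/
def tangent (P : LeafPartition E M) (x : M) : Submodule ℝ (TangentSpace 𝓘(ℝ, E) x) :=
  let L : Quotient P.rel := Quotient.mk P.rel x
  letI := P.top L
  letI := P.charted L
  (mfderiv 𝓘(ℝ, EuclideanSpace ℝ (Fin (P.dim L))) 𝓘(ℝ, E)
    (Subtype.val : {y : M // Quotient.mk P.rel y = L} → M) ⟨x, rfl⟩).range

variable [IsManifold 𝓘(ℝ, E) ∞ M]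

/-- The smooth vector fields that are tangent to the leaves. -/
def tangentFields (P : LeafPartition E M) : Submodule ℝ (VField E M) where
  carrier := {X | ∀ x, X x ∈ P.tangent x}
  add_mem' hX hY x := (P.tangent x).add_mem (hX x) (hY x)
  zero_mem' x := (P.tangent x).zero_mem
  smul_mem' c _ hX x := (P.tangent x).smul_mem c (hX x)

end LeafPartition

/-- A singular foliation: a partition into connected immersed submanifolds such that every vector
tangent to a leaf extends to a smooth vector field on `M` which is tangent to the leaves. -/
structure SingularFoliation [IsManifold 𝓘(ℝ, E) ∞ M] extends LeafPartition E M where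
  transitive : ∀ (x : M), ∀ v ∈ toLeafPartition.tangent x,
    ∃ X ∈ toLeafPartition.tangentFields, X x = v

namespace SingularFoliation

variable {E M}
variable [IsManifold 𝓘(ℝ, E) ∞ M] [FiniteDimensional ℝ E]

/-- The Lie algebra of foliate vector fields. -/
def foliateFields (F : SingularFoliation E M) : LieSubalgebra ℝ (VField E M) where
  carrier := {X | ∀ Y ∈ F.tangentFields, ⁅X, Y⁆ ∈ F.tangentFields}
  add_mem' {X X'} hX hX' Y hY := by
    rw [add_lie]; exact F.tangentFields.add_mem (hX Y hY) (hX' Y hY)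
  zero_mem' Y _ := by rw [zero_lie]; exact F.tangentFields.zero_mem
  smul_mem' c X hX Y hY := by rw [smul_lie]; exact F.tangentFields.smul_mem c (hX Y hY)
  lie_mem' {X X'} hX hX' Y hY := by
    rw [lie_lie]
    exact F.tangentFields.sub_mem (hX _ (hX' Y hY)) (hX' _ (hX Y hY))

/-- The ideal of the foliate fields that are tangent to the leaves. -/
def tangentIdeal (F : SingularFoliation E M) : LieIdeal ℝ F.foliateFields where
  toSubmodule := F.tangentFields.comap F.foliateFields.toSubmodule.subtype
  lie_mem {X _} hY := X.2 _ hY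

/-- The Lie algebra of transverse vector fields: foliate fields modulo tangent fields. -/
abbrev TransverseField (F : SingularFoliation E M) : Type _ := F.foliateFields ⧸ F.tangentIdeal

/-- The class of a foliate vector field. -/
def toTransverse (F : SingularFoliation E M) : F.foliateFields →ₗ[ℝ] F.TransverseField :=
  F.tangentIdeal.toSubmodule.mkQ

/-- The basic `k`-forms: smooth forms `α` with `ι_X α = 0` and `ι_X dα = 0` for every vector field
`X` tangent to the leaves. -/
def basicForms (F : SingularFoliation E M) (k : ℕ) : Submodule ℝ (RawForm E M k) where
  carrier := {α | IsSmoothForm α ∧ ∀ X ∈ F.tangentFields,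
    contract X k α = 0 ∧ contract X (k + 1) (extD α) = 0}
  add_mem' {α β} hα hβ := ⟨hα.1.add hβ.1, fun X hX => by
    rw [extD_add hα.1 hβ.1, contract_add_right, contract_add_right, (hα.2 X hX).1, (hα.2 X hX).2,
      (hβ.2 X hX).1, (hβ.2 X hX).2]
    simp⟩
  zero_mem' := ⟨isSmoothForm_zero, fun X _ => by
    rw [extD_zero]; exact ⟨contract_zero_right _, contract_zero_right _⟩⟩
  smul_mem' c α hα := ⟨hα.1.smul c, fun X hX => by
    rw [extD_smul, contract_smul_right, contract_smul_right, (hα.2 X hX).1, (hα.2 X hX).2]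
    simp⟩

/-- The space `Ω^k(F)` of basic `k`-forms. -/
def BasicForm (F : SingularFoliation E M) (k : ℕ) : Type _ := F.basicForms k

instance (F : SingularFoliation E M) (k : ℕ) : AddCommGroup (F.BasicForm k) :=
  inferInstanceAs (AddCommGroup (F.basicForms k))

instance (F : SingularFoliation E M) (k : ℕ) : Module ℝ (F.BasicForm k) :=
  inferInstanceAs (Module ℝ (F.basicForms k))

/-- The exterior derivative of basic forms. -/
def basicD (F : SingularFoliation E M) (k : ℕ) : F.BasicForm k →ₗ[ℝ] F.BasicForm (k + 1) where
  toFun α := ⟨extD α.1, α.2.1.extD, fun X hX => ⟨(α.2.2 X hX).2, by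
    rw [extD_extD α.2.1]; exact contract_zero_right _⟩⟩
  map_add' α β := Subtype.ext (extD_add α.2.1 β.2.1)
  map_smul' c α := Subtype.ext (extD_smul c α.1)

/-- The contraction of basic forms with a foliate vector field. -/
def basicContract (F : SingularFoliation E M) (k : ℕ) (X : F.foliateFields) :
    F.BasicForm k →ₗ[ℝ] F.BasicForm (k - 1) where
  toFun α := ⟨contract X.1 k α.1, α.2.1.contract X.1, fun Y hY =>
      ⟨contract_contract _ _ _ (α.2.2 Y hY).1,
        contract_extD_contract α.2.1 X.1 Y (α.2.2 Y hY).1 (α.2.2 Y hY).2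
          (α.2.2 _ (X.2 Y hY)).1⟩⟩
  map_add' α β := Subtype.ext (contract_add_right _ α.1 β.1)
  map_smul' c α := Subtype.ext (contract_smul_right _ c α.1)

lemma basicContract_add (F : SingularFoliation E M) (k : ℕ) (X Y : F.foliateFields)
    (α : F.BasicForm k) :
    F.basicContract k (X + Y) α = F.basicContract k X α + F.basicContract k Y α :=
  Subtype.ext (contract_add_left X.1 Y.1 α.1)

lemma basicContract_smul (F : SingularFoliation E M) (k : ℕ) (c : ℝ) (X : F.foliateFields)
    (α : F.BasicForm k) : F.basicContract k (c • X) α = c • F.basicContract k X α :=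
  Subtype.ext (contract_smul_left c X.1 α.1)

/-- The space `Ω(F)` of basic forms of all degrees. -/
abbrev BasicForms (F : SingularFoliation E M) : Type _ := ⨁ k : ℕ, F.BasicForm k

/-- The exterior derivative of `Ω(F)`. -/
def d (F : SingularFoliation E M) : F.BasicForms →ₗ[ℝ] F.BasicForms :=
  DirectSum.toModule ℝ ℕ _ fun k => DirectSum.lof ℝ ℕ F.BasicForm (k + 1) ∘ₗ F.basicD k

/-- The contraction of `Ω(F)` with foliate vector fields. -/
def contractFoliate (F : SingularFoliation E M) :
    F.foliateFields →ₗ[ℝ] F.BasicForms →ₗ[ℝ] F.BasicForms where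
  toFun X := DirectSum.toModule ℝ ℕ _ fun k =>
    DirectSum.lof ℝ ℕ F.BasicForm (k - 1) ∘ₗ F.basicContract k X
  map_add' X Y := by ext k α : 2; simp [basicContract_add]
  map_smul' c X := by ext k α : 2; simp [basicContract_smul]

/-- The contraction `ι_ξ` of `Ω(F)` with a transverse vector field `ξ`, computed with any foliate
representative of `ξ`. -/
def ι (F : SingularFoliation E M) :
    F.TransverseField →ₗ[ℝ] F.BasicForms →ₗ[ℝ] F.BasicForms :=
  F.tangentIdeal.toSubmodule.liftQ F.contractFoliate (by
    intro X hX
    rw [LinearMap.mem_ker]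
    ext k α : 2
    have : F.basicContract k X α = 0 := Subtype.ext (α.2.2 X.1 hX).1
    simp [contractFoliate, this])

/-- The Lie derivative `L_ξ = d ι_ξ + ι_ξ d` of `Ω(F)` along a transverse vector field `ξ`. -/
def lieDeriv (F : SingularFoliation E M) (ξ : F.TransverseField) :
    F.BasicForms →ₗ[ℝ] F.BasicForms :=
  F.d ∘ₗ F.ι ξ + F.ι ξ ∘ₗ F.d

end SingularFoliation
end Foliation

/-! ### The Cartan model -/

section Sym

section

variable {V : Type*} [AddCommGroup V] [Module ℝ V] (T : V →ₗ[ℝ] V)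

/-- The algebra homomorphism `f ↦ f + ε D f` into the dual numbers, where `D` is the derivation of
the symmetric algebra of `V` extending the endomorphism `T` of `V`. -/
def symDerivHom :
    SymmetricAlgebra ℝ V →ₐ[ℝ] TrivSqZeroExt (SymmetricAlgebra ℝ V) (SymmetricAlgebra ℝ V) :=
  SymmetricAlgebra.lift
    ((TrivSqZeroExt.inlAlgHom ℝ (SymmetricAlgebra ℝ V) (SymmetricAlgebra ℝ V)).toLinearMap ∘ₗ
        SymmetricAlgebra.ι ℝ V +
      (TrivSqZeroExt.inrHom (SymmetricAlgebra ℝ V) (SymmetricAlgebra ℝ V)).restrictScalars ℝ ∘ₗ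
        SymmetricAlgebra.ι ℝ V ∘ₗ T)

lemma fst_symDerivHom (f : SymmetricAlgebra ℝ V) : (symDerivHom T f).fst = f := by
  have : (TrivSqZeroExt.fstHom ℝ (SymmetricAlgebra ℝ V) (SymmetricAlgebra ℝ V)).comp
      (symDerivHom T) = AlgHom.id ℝ _ := by
    apply SymmetricAlgebra.algHom_ext
    ext v
    simp [symDerivHom]
  exact DFunLike.congr_fun this f

/-- The derivation of the symmetric algebra of `V` extending the endomorphism `T` of `V`. -/
def symDeriv : Derivation ℝ (SymmetricAlgebra ℝ V) (SymmetricAlgebra ℝ V) :=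
  Derivation.mk' ((TrivSqZeroExt.sndHom (SymmetricAlgebra ℝ V)
    (SymmetricAlgebra ℝ V)).restrictScalars ℝ ∘ₗ (symDerivHom T).toLinearMap) fun a b => by
      simp [fst_symDerivHom, mul_comm]

lemma symDeriv_ι (v : V) : symDeriv T (SymmetricAlgebra.ι ℝ V v) = SymmetricAlgebra.ι ℝ V (T v) := by
  simp [symDeriv, symDerivHom]

end

variable (𝔤 : Type*) [LieRing 𝔤] [LieAlgebra ℝ 𝔤]

/-- The symmetric algebra `Sym(𝔤*)`. -/
abbrev SymDual : Type _ := SymmetricAlgebra ℝ (Module.Dual ℝ 𝔤)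

variable {𝔤} in
/-- The coadjoint representation, `(ad*_X φ)(Y) = φ (-[X, Y])`. -/
def coad (X : 𝔤) : Module.Dual ℝ 𝔤 →ₗ[ℝ] Module.Dual ℝ 𝔤 :=
  (-(LieAlgebra.ad ℝ 𝔤 X : 𝔤 →ₗ[ℝ] 𝔤)).dualMap

/-- The algebra `Sym(𝔤*)^𝔤` of invariants of the coadjoint representation, extended to `Sym(𝔤*)`
by derivations. -/
def symInvariants : Subalgebra ℝ (SymDual 𝔤) where
  carrier := {f | ∀ X : 𝔤, symDeriv (coad X) f = 0}
  mul_mem' {f g} hf hg X := by simp [hf X, hg X]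
  add_mem' {f g} hf hg X := by simp [hf X, hg X]
  algebraMap_mem' r X := by simp

end Sym

section Cartan

variable {E : Type*} [NormedAddCommGroup E] [NormedSpace ℝ E] [FiniteDimensional ℝ E]
  {M : Type*} [TopologicalSpace M] [ChartedSpace E M] [IsManifold 𝓘(ℝ, E) ∞ M]
  {F : SingularFoliation E M}
  {𝔤 : Type*} [LieRing 𝔤] [LieAlgebra ℝ 𝔤]

/-- The action of `X ∈ 𝔤` on `Sym(𝔤*) ⊗ Ω(F)`, `f ⊗ α ↦ ad*_X f ⊗ α + f ⊗ L_X α`. -/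
def cartanAction (μ : 𝔤 →ₗ⁅ℝ⁆ F.TransverseField) (X : 𝔤) :
    SymDual 𝔤 ⊗[ℝ] F.BasicForms →ₗ[ℝ] SymDual 𝔤 ⊗[ℝ] F.BasicForms :=
  LinearMap.rTensor F.BasicForms (symDeriv (coad X) : SymDual 𝔤 →ₗ[ℝ] SymDual 𝔤) +
    LinearMap.lTensor (SymDual 𝔤) (F.lieDeriv (μ X))

lemma cartanAction_smul (μ : 𝔤 →ₗ⁅ℝ⁆ F.TransverseField) (X : 𝔤) (f : symInvariants 𝔤)
    (a : SymDual 𝔤 ⊗[ℝ] F.BasicForms) :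
    cartanAction μ X (f • a) = f • cartanAction μ X a := by
  induction a with
  | zero => simp
  | add a b ha hb => rw [smul_add, map_add, map_add, ha, hb, smul_add]
  | tmul s w =>
    have hf : symDeriv (coad X) f.1 = 0 := f.2 X
    have hm : f • (s ⊗ₜ[ℝ] w) = (f.1 * s) ⊗ₜ[ℝ] w := rfl
    have hm' (s' : SymDual 𝔤) (w' : F.BasicForms) :
        f • (s' ⊗ₜ[ℝ] w') = (f.1 * s') ⊗ₜ[ℝ] w' := rfl
    rw [hm]
    simp [cartanAction, hf, hm']

/-- The basic Cartan complex `C_𝔤(F)`: the `𝔤`-invariant elements of `Sym(𝔤*) ⊗ Ω(F)`. -/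
def cartanComplex (μ : 𝔤 →ₗ⁅ℝ⁆ F.TransverseField) :
    Submodule (symInvariants 𝔤) (SymDual 𝔤 ⊗[ℝ] F.BasicForms) where
  carrier := {a | ∀ X : 𝔤, cartanAction μ X a = 0}
  add_mem' {a b} ha hb X := by rw [map_add, ha X, hb X, add_zero]
  zero_mem' X := map_zero _
  smul_mem' f a ha X := by rw [cartanAction_smul, ha X, smul_zero]

variable [FiniteDimensional ℝ 𝔤]

/-- The equivariant derivative. Regarding elements of `Sym(𝔤*) ⊗ Ω(F)` as polynomial maps
`𝔤 → Ω(F)`, it is given by `(d_𝔤 a)(X) = d (a X) - ι_X (a X)`, see `evalAt_cartanD`. -/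
def cartanD (μ : 𝔤 →ₗ⁅ℝ⁆ F.TransverseField) :
    SymDual 𝔤 ⊗[ℝ] F.BasicForms →ₗ[SymDual 𝔤] SymDual 𝔤 ⊗[ℝ] F.BasicForms :=
  LinearMap.baseChange (SymDual 𝔤) F.d -
    ∑ i, SymmetricAlgebra.ι ℝ (Module.Dual ℝ 𝔤) ((Module.finBasis ℝ 𝔤).coord i) •
      LinearMap.baseChange (SymDual 𝔤) (F.ι (μ (Module.finBasis ℝ 𝔤 i)))

variable (F) in
/-- The value at `X ∈ 𝔤` of an element of `Sym(𝔤*) ⊗ Ω(F)`, seen as a polynomial map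
`𝔤 → Ω(F)`. -/
def evalAt (X : 𝔤) : SymDual 𝔤 ⊗[ℝ] F.BasicForms →ₗ[ℝ] F.BasicForms :=
  TensorProduct.lift ((LinearMap.lsmul ℝ F.BasicForms) ∘ₗ
    (SymmetricAlgebra.lift (Module.Dual.eval ℝ 𝔤 X)).toLinearMap)

lemma evalAt_cartanD (μ : 𝔤 →ₗ⁅ℝ⁆ F.TransverseField) (X : 𝔤)
    (a : SymDual 𝔤 ⊗[ℝ] F.BasicForms) :
    evalAt F X (cartanD μ a) = F.d (evalAt F X a) - F.ι (μ X) (evalAt F X a) := by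
  induction a with
  | zero => simp
  | add a b ha hb => simp only [map_add, ha, hb]; abel
  | tmul s w =>
    have hX : F.ι (μ X) w = ∑ i, (Module.finBasis ℝ 𝔤).repr X i • F.ι (μ (Module.finBasis ℝ 𝔤 i)) w := by
      let l : 𝔤 →ₗ[ℝ] F.BasicForms :=
        (LinearMap.applyₗ w) ∘ₗ F.ι ∘ₗ (μ : 𝔤 →ₗ[ℝ] F.TransverseField)
      change l X = ∑ i, (Module.finBasis ℝ 𝔤).repr X i • l (Module.finBasis ℝ 𝔤 i)
      conv_lhs => rw [← (Module.finBasis ℝ 𝔤).sum_repr X]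
      rw [map_sum]
      exact Finset.sum_congr rfl fun i _ => map_smul l _ _
    simp [cartanD, evalAt, hX, TensorProduct.smul_tmul', Finset.smul_sum, smul_smul, mul_comm]

/-- The cocycles of the basic Cartan complex. -/
def cocycles (μ : 𝔤 →ₗ⁅ℝ⁆ F.TransverseField) :
    Submodule (symInvariants 𝔤) (SymDual 𝔤 ⊗[ℝ] F.BasicForms) :=
  cartanComplex μ ⊓ LinearMap.ker ((cartanD μ).restrictScalars (symInvariants 𝔤))

/-- The coboundaries of the basic Cartan complex. -/
def coboundaries (μ : 𝔤 →ₗ⁅ℝ⁆ F.TransverseField) :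
    Submodule (symInvariants 𝔤) (SymDual 𝔤 ⊗[ℝ] F.BasicForms) :=
  (cartanComplex μ).map ((cartanD μ).restrictScalars (symInvariants 𝔤))

/-- The type of cocycles of the basic Cartan complex. -/
def Cocycle (μ : 𝔤 →ₗ⁅ℝ⁆ F.TransverseField) : Type _ := cocycles μ

instance (μ : 𝔤 →ₗ⁅ℝ⁆ F.TransverseField) : AddCommGroup (Cocycle μ) :=
  inferInstanceAs (AddCommGroup (cocycles μ))

instance (μ : 𝔤 →ₗ⁅ℝ⁆ F.TransverseField) : Module (symInvariants 𝔤) (Cocycle μ) :=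
  inferInstanceAs (Module (symInvariants 𝔤) (cocycles μ))

/-- The inclusion of the cocycles into `Sym(𝔤*) ⊗ Ω(F)`. -/
def Cocycle.val (μ : 𝔤 →ₗ⁅ℝ⁆ F.TransverseField) :
    Cocycle μ →ₗ[symInvariants 𝔤] SymDual 𝔤 ⊗[ℝ] F.BasicForms :=
  (cocycles μ).subtype

/-- The `𝔤`-equivariant basic cohomology `H_𝔤(F)` (the sum over all degrees), as a module over
`Sym(𝔤*)^𝔤`. -/
abbrev EquivariantCohomology (μ : 𝔤 →ₗ⁅ℝ⁆ F.TransverseField) : Type _ :=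
  Cocycle μ ⧸ (coboundaries μ).comap (Cocycle.val μ)

/-- The cohomology class of a cocycle. -/
def toClass (μ : 𝔤 →ₗ⁅ℝ⁆ F.TransverseField) :
    Cocycle μ →ₗ[symInvariants 𝔤] EquivariantCohomology μ :=
  Submodule.mkQ _

end Cartan

/-! ### Products and pullbacks -/

section Raw

variable {E : Type*} [NormedAddCommGroup E] [NormedSpace ℝ E]
  {M : Type*} [TopologicalSpace M] [ChartedSpace E M]
  {E' : Type*} [NormedAddCommGroup E'] [NormedSpace ℝ E']
  {N : Type*} [TopologicalSpace N] [ChartedSpace E' N]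

lemma continuous_wedge {k l : ℕ} (α : E [⋀^Fin k]→L[ℝ] ℝ) (β : E [⋀^Fin l]→L[ℝ] ℝ)
    (σ : Equiv.Perm (Fin k ⊕ Fin l)) : Continuous fun v : Fin (k + l) → E =>
      α (fun i => v (finSumFinEquiv (σ (Sum.inl i)))) *
        β (fun i => v (finSumFinEquiv (σ (Sum.inr i)))) :=
  (α.cont.comp (by fun_prop)).mul (β.cont.comp (by fun_prop))

/-- The exterior product of two alternating forms: the sum over all shuffles `σ` of
`sign σ * α (v ∘ σ ∘ inl) * β (v ∘ σ ∘ inr)`. -/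
def wedgeAlt {k l : ℕ} (α : E [⋀^Fin k]→L[ℝ] ℝ) (β : E [⋀^Fin l]→L[ℝ] ℝ) :
    E [⋀^Fin (k + l)]→L[ℝ] ℝ :=
  { ((LinearMap.mul' ℝ ℝ).compAlternatingMap
      (α.toAlternatingMap.domCoprod β.toAlternatingMap)).domDomCongr finSumFinEquiv with
    cont := by
      change Continuous fun v : Fin (k + l) → E => LinearMap.mul' ℝ ℝ
        (α.toAlternatingMap.domCoprod β.toAlternatingMap fun i => v (finSumFinEquiv i))
      simp only [AlternatingMap.domCoprod_apply, _root_.sum_apply, map_sum]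
      refine continuous_finsetSum _ fun σ _ => ?_
      induction σ using Quotient.inductionOn' with
      | h σ =>
        have h := (continuous_wedge α β σ).const_smul (Equiv.Perm.sign σ : ℤ)
        refine h.congr fun v => ?_
        rw [AlternatingMap.domCoprod.summand_mk'']
        exact (map_zsmul (LinearMap.mul' ℝ ℝ) (Equiv.Perm.sign σ : ℤ)
          ((α fun i => v (finSumFinEquiv (σ (Sum.inl i)))) ⊗ₜ[ℝ]
            (β fun i => v (finSumFinEquiv (σ (Sum.inr i)))))).symm }

lemma wedgeAlt_apply {k l : ℕ} (α : E [⋀^Fin k]→L[ℝ] ℝ) (β : E [⋀^Fin l]→L[ℝ] ℝ)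
    (v : Fin (k + l) → E) : wedgeAlt α β v = LinearMap.mul' ℝ ℝ (AlternatingMap.domCoprod'
      (α.toAlternatingMap ⊗ₜ[ℝ] β.toAlternatingMap) fun i => v (finSumFinEquiv i)) := rfl

/-- The pointwise exterior product of differential forms. -/
def wedge (k l : ℕ) : RawForm E M k →ₗ[ℝ] RawForm E M l →ₗ[ℝ] RawForm E M (k + l) :=
  LinearMap.mk₂ ℝ (fun α β x => wedgeAlt (α x) (β x))
    (fun α α' β => by
      funext x; ext v
      simp [wedgeAlt_apply, TensorProduct.add_tmul])
    (fun c α β => by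
      funext x; ext v
      simp only [wedgeAlt_apply, Pi.smul_apply, ContinuousAlternatingMap.toAlternatingMap_smul,
        ← TensorProduct.smul_tmul', map_smul, AlternatingMap.smul_apply,
        ContinuousAlternatingMap.smul_apply])
    (fun α β β' => by
      funext x; ext v
      simp [wedgeAlt_apply, TensorProduct.tmul_add])
    (fun c α β => by
      funext x; ext v
      simp only [wedgeAlt_apply, Pi.smul_apply, ContinuousAlternatingMap.toAlternatingMap_smul,
        TensorProduct.tmul_smul, map_smul, AlternatingMap.smul_apply,
        ContinuousAlternatingMap.smul_apply])

variable (E M) in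
/-- The sum of the spaces of (not necessarily smooth) forms of all degrees. -/
abbrev RawForms : Type _ := ⨁ k : ℕ, RawForm E M k

/-- The exterior product of forms of all degrees. -/
def wedgeTotal : RawForms E M →ₗ[ℝ] RawForms E M →ₗ[ℝ] RawForms E M :=
  DirectSum.toModule ℝ ℕ _ fun k => LinearMap.flip <|
    DirectSum.toModule ℝ ℕ _ fun l => LinearMap.flip <|
      (wedge k l).compr₂ (DirectSum.lof ℝ ℕ (RawForm E M) (k + l))

/-- The product `(f ⊗ α) (g ⊗ β) = f g ⊗ α ∧ β`. -/
def mulTotal (S : Type*) [CommRing S] [Algebra ℝ S] :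
    S ⊗[ℝ] RawForms E M →ₗ[ℝ] S ⊗[ℝ] RawForms E M →ₗ[ℝ] S ⊗[ℝ] RawForms E M :=
  TensorProduct.map₂ (LinearMap.mul ℝ S) wedgeTotal

/-- The pullback of forms, `(f^*α)_x (v₁, …, v_k) = α_{f x} (df_x v₁, …, df_x v_k)`. -/
def pullback (f : M → N) (k : ℕ) : RawForm E' N k →ₗ[ℝ] RawForm E M k where
  toFun α x := (α (f x)).compContinuousLinearMap (mfderiv 𝓘(ℝ, E) 𝓘(ℝ, E') f x)
  map_add' _ _ := rfl
  map_smul' _ _ := rfl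

/-- The pullback `id ⊗ f^*` on polynomials with values in the forms. -/
def pullbackTotal (S : Type*) [CommRing S] [Algebra ℝ S] (f : M → N) :
    S ⊗[ℝ] RawForms E' N →ₗ[ℝ] S ⊗[ℝ] RawForms E M :=
  LinearMap.lTensor S (DirectSum.lmap (pullback f))

end Raw

section Maps

variable {E : Type*} [NormedAddCommGroup E] [NormedSpace ℝ E] [FiniteDimensional ℝ E]
  {M : Type*} [TopologicalSpace M] [ChartedSpace E M] [IsManifold 𝓘(ℝ, E) ∞ M]
  {E' : Type*} [NormedAddCommGroup E'] [NormedSpace ℝ E'] [FiniteDimensional ℝ E']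
  {N : Type*} [TopologicalSpace N] [ChartedSpace E' N] [IsManifold 𝓘(ℝ, E') ∞ N]
  {F : SingularFoliation E M} {G : SingularFoliation E' N}
  {𝔤 : Type*} [LieRing 𝔤] [LieAlgebra ℝ 𝔤]

/-- The inclusion of `Sym(𝔤*) ⊗ Ω(F)` into the polynomials on `𝔤` with values in all forms. -/
def toRaw (F : SingularFoliation E M) (𝔤 : Type*) [LieRing 𝔤] [LieAlgebra ℝ 𝔤] :
    SymDual 𝔤 ⊗[ℝ] F.BasicForms →ₗ[ℝ] SymDual 𝔤 ⊗[ℝ] RawForms E M :=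
  LinearMap.lTensor (SymDual 𝔤) (DirectSum.lmap fun k => (F.basicForms k).subtype)

variable (F G) in
/-- A foliate map: a smooth map that maps leaves into leaves. -/
def IsFoliate (f : M → N) : Prop :=
  ContMDiff 𝓘(ℝ, E) 𝓘(ℝ, E') ∞ f ∧ ∀ x y, F.rel x y → G.rel (f x) (f y)

/-- Two transverse fields are `f`-related if they admit `f`-related foliate representatives. -/
def TransverseRelated (f : M → N) (ξ : F.TransverseField) (η : G.TransverseField) : Prop :=
  ∃ (X : F.foliateFields) (Y : G.foliateFields), F.toTransverse X = ξ ∧ G.toTransverse Y = η ∧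
    ∀ x, mfderiv 𝓘(ℝ, E) 𝓘(ℝ, E') f x (X.1 x) = Y.1 (f x)

/-- A `𝔤`-equivariant foliate map. -/
def IsEquivariantMap (μ : 𝔤 →ₗ⁅ℝ⁆ F.TransverseField) (ν : 𝔤 →ₗ⁅ℝ⁆ G.TransverseField)
    (f : M → N) : Prop :=
  IsFoliate F G f ∧ ∀ X : 𝔤, TransverseRelated f (μ X) (ν X)

/-- A `𝔤`-equivariant foliate homotopy: a smooth map on the manifold with boundary `M × [0, 1]`
such that all `f_t` are foliate and `𝔤`-equivariant. -/
def IsEquivariantHomotopy (μ : 𝔤 →ₗ⁅ℝ⁆ F.TransverseField) (ν : 𝔤 →ₗ⁅ℝ⁆ G.TransverseField)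
    (f : M × Set.Icc (0 : ℝ) 1 → N) : Prop :=
  ContMDiff (𝓘(ℝ, E).prod (𝓡∂ 1)) 𝓘(ℝ, E') ∞ f ∧ ∀ t, IsEquivariantMap μ ν fun x => f (x, t)

/-- `f₀` and `f₁` are homotopic through a `𝔤`-equivariant foliate homotopy. -/
def EquivariantlyHomotopic (μ : 𝔤 →ₗ⁅ℝ⁆ F.TransverseField) (ν : 𝔤 →ₗ⁅ℝ⁆ G.TransverseField)
    (f₀ f₁ : M → N) : Prop :=
  ∃ f : M × Set.Icc (0 : ℝ) 1 → N, IsEquivariantHomotopy μ ν f ∧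
    (∀ x, f (x, 0) = f₀ x) ∧ ∀ x, f (x, 1) = f₁ x

variable [FiniteDimensional ℝ 𝔤]

/-- `Φ` is the map `f^* : H_𝔤(G) → H_𝔤(F)`: for every cocycle `a`, the pullback `f^* a` is a
cocycle of the basic Cartan complex of `F`, and `Φ` sends the class of `a` to the class of `f^* a`.
There is at most one such `Φ`. -/
def IsPullback (μ : 𝔤 →ₗ⁅ℝ⁆ F.TransverseField) (ν : 𝔤 →ₗ⁅ℝ⁆ G.TransverseField) (f : M → N)
    (Φ : EquivariantCohomology ν →ₗ[symInvariants 𝔤] EquivariantCohomology μ) : Prop :=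
  ∀ a : Cocycle ν, ∃ b : Cocycle μ,
    toRaw F 𝔤 (Cocycle.val μ b) = pullbackTotal (SymDual 𝔤) f (toRaw G 𝔤 (Cocycle.val ν a)) ∧
      Φ (toClass ν a) = toClass μ b

/-- The class `c` is the product of the classes `a` and `b` in the algebra `H_𝔤(F)`, whose product
is induced by the product `(a b)(X) = a(X) ∧ b(X)` of cocycles. -/
def IsProduct (μ : 𝔤 →ₗ⁅ℝ⁆ F.TransverseField) (a b c : EquivariantCohomology μ) : Prop :=
  ∃ α β γ : Cocycle μ, toClass μ α = a ∧ toClass μ β = b ∧ toClass μ γ = c ∧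
    toRaw F 𝔤 (Cocycle.val μ γ) =
      mulTotal (SymDual 𝔤) (toRaw F 𝔤 (Cocycle.val μ α)) (toRaw F 𝔤 (Cocycle.val μ β))

end Maps

end EquivariantBasic
end

noncomputable section
namespace EquivariantBasic

/-! ### Immersed leaves -/

section Immersion

variable {E₁ : Type*} [NormedAddCommGroup E₁] [NormedSpace ℝ E₁]
  {L : Type*} [TopologicalSpace L] [ChartedSpace E₁ L] [IsManifold 𝓘(ℝ, E₁) ∞ L]
  {E' : Type*} [NormedAddCommGroup E'] [NormedSpace ℝ E']
  {N : Type*} [TopologicalSpace N] [ChartedSpace E' N] [IsManifold 𝓘(ℝ, E') ∞ N]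

/-! The theorem rests on the classical homotopy operator `h α = ∫₀¹ f_t^*(ι_{∂f/∂t} α) dt`. It
satisfies `d h + h d = f₁^* - f₀^*` (`extD_homotopyOpSucc`, `homotopyOpSucc_extD_zero`): on a chart
times the real line this is Cartan's formula for the vertical field, integrated over the parameter
(`extDeriv_integral_vertical`).

Two further properties make `h` fit the basic Cartan model. It maps basic forms to basic forms
(`homotopyOp_mem`), and it anticommutes with the contractions by `𝔤` (`ι_formsHomotopy`). For the
second, the `f_t`-related representatives of `μ(X)` and `ν(X)` may change with `t`, but they change
only by tangent fields, which basic forms annihilate. Hence `h` commutes with Lie derivatives, `id ⊗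
h` preserves invariants, and the contraction terms cancel in `d_𝔤 h + h d_𝔤 = f₁^* - f₀^*`
(`IsChainMap.cohomologyMap_eq`). The second part of the theorem follows by functoriality, since
`f^*` and `g^*` are mutually inverse and multiplicative.

The geometric input is that the derivative of a foliate map preserves tangency to the leaves
(`IsFoliate.mfderiv_mem_tangent`). This is not immediate, because a smooth curve with values in an
immersed leaf is not assumed to be continuous for the leaf topology. A Baire argument shows that its
velocity is tangent at a dense set of times (`dense_velocity_mem`). If the velocity failed to be
tangent at some time, it would be independent of local tangent fields that span the tangent space of
the leaf there; independence persists nearby, where at a tangent time it would give too many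
independent vectors in a tangent space of the same dimension
(`SingularFoliation.velocity_mem_tangent`). -/

lemma mdifferentiable_of_mem_maximalAtlas {e : OpenPartialHomeomorph N E'}
    (he : e ∈ IsManifold.maximalAtlas 𝓘(ℝ, E') ∞ N) :
    e.MDifferentiable 𝓘(ℝ, E') 𝓘(ℝ, E') :=
  ⟨(contMDiffOn_of_mem_maximalAtlas he).mdifferentiableOn (by simp),
    (contMDiffOn_symm_of_mem_maximalAtlas he).mdifferentiableOn (by simp)⟩

variable {i : L → N} {x : L}

lemma codChart_comp_eq (h : Manifold.IsImmersionAt 𝓘(ℝ, E₁) 𝓘(ℝ, E') ∞ i x) {u : L}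
    (hu : u ∈ h.domChart.source) : h.codChart (i u) = h.equiv (h.domChart u, 0) := by
  have ht : h.domChart u ∈ (h.domChart.extend 𝓘(ℝ, E₁)).target := by
    simpa using h.domChart.map_source hu
  have := h.writtenInCharts ht
  simpa [hu] using this

/-- Valid at every point of the chart domain, not only at `x`: along the whole sheet the tangent
space is, in the codomain chart, the first factor of the splitting. -/
lemma mfderiv_codChart_comp (h : Manifold.IsImmersionAt 𝓘(ℝ, E₁) 𝓘(ℝ, E') ∞ i x) {u : L}
    (hu : u ∈ h.domChart.source) (w : E₁) :
    (mfderiv 𝓘(ℝ, E') 𝓘(ℝ, E') h.codChart (i u) (mfderiv 𝓘(ℝ, E₁) 𝓘(ℝ, E') i u w) : E') =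
      h.equiv ((mfderiv 𝓘(ℝ, E₁) 𝓘(ℝ, E₁) h.domChart u w : E₁), 0) := by
  have hd := mdifferentiable_of_mem_maximalAtlas h.domChart_mem_maximalAtlas
  have hc := mdifferentiable_of_mem_maximalAtlas h.codChart_mem_maximalAtlas
  have hi : MDifferentiableAt 𝓘(ℝ, E₁) 𝓘(ℝ, E') i u :=
    (h.contMDiffOn.contMDiffAt (h.domChart.open_source.mem_nhds hu)).mdifferentiableAt (by simp)
  have e : h.codChart ∘ i =ᶠ[𝓝 u]
      (h.equiv.toContinuousLinearMap ∘L ContinuousLinearMap.inl ℝ E₁ h.complement) ∘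
        h.domChart := by
    filter_upwards [h.domChart.open_source.mem_nhds hu] with u' hu'
    exact codChart_comp_eq h hu'
  have h1 := mfderiv_comp u (hc.mdifferentiableAt (h.source_subset_preimage_source hu)) hi
  have h2 := mfderiv_comp u ((h.equiv.toContinuousLinearMap ∘L
    ContinuousLinearMap.inl ℝ E₁ h.complement).differentiableAt.mdifferentiableAt)
    (hd.mdifferentiableAt hu)
  rw [e.mfderiv_eq, h2] at h1
  have := congrArg (fun A : E₁ →L[ℝ] E' => A w) h1
  rw [mfderiv_eq_fderiv, ContinuousLinearMap.fderiv] at this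
  exact this.symm

lemma injective_mfderiv_of_isImmersionAt (h : Manifold.IsImmersionAt 𝓘(ℝ, E₁) 𝓘(ℝ, E') ∞ i x) :
    Function.Injective (mfderiv 𝓘(ℝ, E₁) 𝓘(ℝ, E') i x) := by
  intro v w hvw
  have hd := mdifferentiable_of_mem_maximalAtlas h.domChart_mem_maximalAtlas
  have h1 := mfderiv_codChart_comp h h.mem_domChart_source v
  rw [hvw, mfderiv_codChart_comp h h.mem_domChart_source w] at h1
  exact (hd.mfderiv_injective h.mem_domChart_source (Prod.mk.inj (h.equiv.injective h1)).1).symm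

/-- A curve that stays in a single sheet of an immersed submanifold has its velocity tangent to
that sheet. -/
lemma velocity_mem_of_eventually (h : Manifold.IsImmersionAt 𝓘(ℝ, E₁) 𝓘(ℝ, E') ∞ i x)
    {c : ℝ → N} {s : ℝ} (hc : MDifferentiableAt 𝓘(ℝ, ℝ) 𝓘(ℝ, E') c s)
    (hs : ∀ᶠ s' in 𝓝 s, ∃ u ∈ h.domChart.source, i u = c s') :
    ∃ u, i u = c s ∧ ∃ w : E₁, (mfderiv 𝓘(ℝ, E₁) 𝓘(ℝ, E') i u w : E') =
      (mfderiv 𝓘(ℝ, ℝ) 𝓘(ℝ, E') c s (1 : ℝ) : E') := by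
  have hd := mdifferentiable_of_mem_maximalAtlas h.domChart_mem_maximalAtlas
  have hcod := mdifferentiable_of_mem_maximalAtlas h.codChart_mem_maximalAtlas
  obtain ⟨u, hu, huc⟩ := hs.self_of_nhds
  have hm : c s ∈ h.codChart.source := huc ▸ h.source_subset_preimage_source hu
  -- `P` projects onto the directions transverse to the sheet. It vanishes along the curve near `s`,
  -- so the velocity has no transverse component.
  let P : E' →L[ℝ] h.complement :=
    ContinuousLinearMap.snd ℝ E₁ h.complement ∘L h.equiv.symm.toContinuousLinearMap
  have e : P ∘ (h.codChart ∘ c) =ᶠ[𝓝 s] fun _ => 0 := by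
    filter_upwards [hs] with s' ⟨u', hu', hc'⟩
    simp [P, ← hc', codChart_comp_eq h hu']
  have hcc := hcod.mdifferentiableAt hm
  have h1 := mfderiv_comp s (P.differentiableAt.mdifferentiableAt) (hcc.comp s hc)
  rw [e.mfderiv_eq, mfderiv_comp s hcc hc, mfderiv_const, mfderiv_eq_fderiv,
    ContinuousLinearMap.fderiv] at h1
  set v : E' := mfderiv 𝓘(ℝ, ℝ) 𝓘(ℝ, E') c s (1 : ℝ) with hv
  have h2 : P (mfderiv 𝓘(ℝ, E') 𝓘(ℝ, E') h.codChart (c s) v : E') = 0 :=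
    (congrArg (fun A : ℝ →L[ℝ] h.complement => A 1) h1).symm
  -- `w` realizes the component of the velocity along the sheet; injectivity of the derivative of
  -- the codomain chart then identifies the two vectors.
  obtain ⟨w, hw⟩ := hd.mfderiv_surjective hu
    (h.equiv.symm (mfderiv 𝓘(ℝ, E') 𝓘(ℝ, E') h.codChart (c s) v : E')).1
  refine ⟨u, huc, w, ?_⟩
  have h3 := mfderiv_codChart_comp h hu w
  have h4 : h.equiv ((mfderiv 𝓘(ℝ, E₁) 𝓘(ℝ, E₁) h.domChart u w : E₁), 0) =
      (mfderiv 𝓘(ℝ, E') 𝓘(ℝ, E') h.codChart (c s) v : E') :=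
    h.equiv.eq_symm_apply.1 (Prod.ext hw h2.symm)
  rw [h4, ← huc] at h3
  exact hcod.mfderiv_injective (h.source_subset_preimage_source hu) h3

/-- The velocity of a curve in an immersed second countable submanifold is tangent to the
submanifold at a dense set of times. -/
lemma dense_velocity_mem [FiniteDimensional ℝ E₁] [SecondCountableTopology L] [T2Space N]
    (h : Manifold.IsImmersion 𝓘(ℝ, E₁) 𝓘(ℝ, E') ∞ i)
    {c : ℝ → N} (hc : ContMDiff 𝓘(ℝ, ℝ) 𝓘(ℝ, E') ∞ c) (hci : ∀ s, ∃ u, i u = c s) :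
    Dense {s | ∃ u, i u = c s ∧ ∃ w : E₁, (mfderiv 𝓘(ℝ, E₁) 𝓘(ℝ, E') i u w : E') =
      (mfderiv 𝓘(ℝ, ℝ) 𝓘(ℝ, E') c s (1 : ℝ) : E')} := by
  have : LocallyCompactSpace L := Manifold.locallyCompact_of_finiteDimensional 𝓘(ℝ, E₁)
  -- Compact pieces of sheets have compact, hence closed, images in the Hausdorff space `N`. Second
  -- countability leaves countably many of them, so the Baire theorem applies to their preimages
  -- under `c`.
  have hK (x : L) : ∃ K, IsCompact K ∧ K ∈ 𝓝 x ∧ K ⊆ (h.isImmersionAt x).domChart.source := by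
    obtain ⟨K, hK, hKs, hKc⟩ := local_compact_nhds
      ((h.isImmersionAt x).domChart.open_source.mem_nhds (h.isImmersionAt x).mem_domChart_source)
    exact ⟨K, hKc, hK, hKs⟩
  choose K hKc hKn hKs using hK
  obtain ⟨S, hS, hSU⟩ := TopologicalSpace.countable_cover_nhds hKn
  have hcl : ∀ x ∈ S, IsClosed (c ⁻¹' (i '' K x)) := fun x _ =>
    ((hKc x).image h.contMDiff.continuous).isClosed.preimage hc.continuous
  have hU : ⋃ x ∈ S, c ⁻¹' (i '' K x) = Set.univ := by
    refine Set.eq_univ_of_forall fun s => ?_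
    obtain ⟨u, hu⟩ := hci s
    have : u ∈ ⋃ x ∈ S, K x := hSU ▸ Set.mem_univ u
    simp only [Set.mem_iUnion] at this ⊢
    obtain ⟨x, hx, hux⟩ := this
    exact ⟨x, hx, u, hux, hu⟩
  -- By Baire the interiors of the closed sets have dense union, and around a time in such an
  -- interior the curve stays in one sheet.
  refine (dense_biUnion_interior_of_closed hcl hS hU).mono ?_
  intro s hs
  simp only [Set.mem_iUnion] at hs
  obtain ⟨x, -, hsx⟩ := hs
  refine velocity_mem_of_eventually (h.isImmersionAt x)
    ((hc s).mdifferentiableAt (by simp)) ?_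
  filter_upwards [mem_interior_iff_mem_nhds.1 hsx] with s' ⟨u, hu, hus⟩
  exact ⟨u, hKs x hu, hus⟩

/-- Every tangent direction of a manifold is the velocity, up to scaling, of a curve. -/
lemma exists_curve (x : L) (v : TangentSpace 𝓘(ℝ, E₁) x) :
    ∃ (c : ℝ → L) (r : ℝ), r ≠ 0 ∧ ContMDiff 𝓘(ℝ, ℝ) 𝓘(ℝ, E₁) ∞ c ∧ c 0 = x ∧
      (mfderiv 𝓘(ℝ, ℝ) 𝓘(ℝ, E₁) c 0 (1 : ℝ) : E₁) = r • (v : E₁) := by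
  set e := extChartAt 𝓘(ℝ, E₁) x
  set w : E₁ := chartDeriv E₁ x x v with hw
  obtain ⟨ε, hε, hb⟩ := Metric.isOpen_iff.1 (isOpen_extChartAt_target (I := 𝓘(ℝ, E₁)) x) (e x)
    (mem_extChartAt_target x)
  -- With this `r` the curve `e x + (r sin s) w` stays within `ε / 2` of `e x`. The bounded sine
  -- lets it be defined for all real times without leaving the chart, and the `+ 1` covers `w = 0`.
  set r : ℝ := ε / (2 * (‖w‖ + 1)) with hr
  have hw0 : 0 ≤ ‖w‖ := norm_nonneg w
  have hr0 : 0 < r := by positivity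
  let b : ℝ → E₁ := fun s => e x + (r * Real.sin s) • w
  have hbs : ContDiff ℝ ∞ b := by fun_prop
  have hbt (s : ℝ) : b s ∈ (extChartAt 𝓘(ℝ, E₁) x).target := by
    apply hb
    rw [mem_ball_iff_norm]
    have h1 : b s - e x = (r * Real.sin s) • w := by simp [b]
    rw [h1, norm_smul, Real.norm_eq_abs, abs_mul, abs_of_pos hr0]
    have h2 := Real.abs_sin_le_one s
    have h3 : r * (‖w‖ + 1) = ε / 2 := by rw [hr]; field_simp
    nlinarith [mul_nonneg hr0.le hw0, mul_le_mul_of_nonneg_left h2 (mul_nonneg hr0.le hw0)]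
  have hb0 : b 0 = e x := by simp [b]
  refine ⟨(extChartAt 𝓘(ℝ, E₁) x).symm ∘ b, r, hr0.ne', ?_, ?_, ?_⟩
  · intro s
    exact ((contMDiffOn_extChartAt_symm x).contMDiffAt (target_mem (hbt s))).comp s
      hbs.contMDiff.contMDiffAt
  · simp only [Function.comp_apply, hb0]
    exact extChartAt_to_inv x
  · have h1 := mfderiv_comp (0 : ℝ) (mdiffAt_symm (hbt 0))
      ((hbs.differentiable (by simp)).differentiableAt.mdifferentiableAt)
    rw [h1]
    have h2 : fderiv ℝ b 0 1 = r • w := by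
      have : HasDerivAt b ((r * Real.cos 0) • w) 0 :=
        (((Real.hasDerivAt_sin 0).const_mul r).smul_const w).const_add (e x)
      rw [fderiv_apply_one_eq_deriv, this.deriv]
      simp
    have h3 : chartSymmDeriv E₁ x (b 0) (fderiv ℝ b 0 1) = r • (v : E₁) := by
      rw [h2, map_smul, hw, hb0]
      congr 1
      exact congrArg (fun A : E₁ →L[ℝ] E₁ => A v) (chartSymmDeriv_comp (E := E₁) x)
    rw [← mfderiv_eq_fderiv] at h3
    exact h3

end Immersion

/-! ### Foliate maps preserve tangency -/

section Tangency

variable {E : Type*} [NormedAddCommGroup E] [NormedSpace ℝ E]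
  {M : Type*} [TopologicalSpace M] [ChartedSpace E M]

namespace LeafPartition

/-- A leaf, as a type that carries the leaf topology. -/
def Leaf (P : LeafPartition E M) (L : Quotient P.rel) : Type _ :=
  {x : M // Quotient.mk P.rel x = L}

/-- The inclusion of a leaf. -/
def Leaf.incl (P : LeafPartition E M) (L : Quotient P.rel) : P.Leaf L → M := Subtype.val

variable (P : LeafPartition E M) (L : Quotient P.rel)

/-- Behind the synonym `Leaf`, instance search does not find the subspace topology, which may be
coarser than the leaf topology. -/
instance : TopologicalSpace (P.Leaf L) := P.top L

instance : ChartedSpace (EuclideanSpace ℝ (Fin (P.dim L))) (P.Leaf L) := P.charted L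

instance : IsManifold 𝓘(ℝ, EuclideanSpace ℝ (Fin (P.dim L))) ∞ (P.Leaf L) := P.isManifold L

instance : SecondCountableTopology (P.Leaf L) := P.secondCountable L

lemma isImmersion_incl : Manifold.IsImmersion 𝓘(ℝ, EuclideanSpace ℝ (Fin (P.dim L))) 𝓘(ℝ, E) ∞
    (Leaf.incl P L) := P.immersed L

variable {P L}

lemma tangent_eq_range (u : P.Leaf L) : P.tangent (Leaf.incl P L u) =
    (mfderiv 𝓘(ℝ, EuclideanSpace ℝ (Fin (P.dim L))) 𝓘(ℝ, E) (Leaf.incl P L) u).range := by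
  obtain ⟨x, rfl⟩ := u
  rfl

/-- An immersion has injective derivative. The use of this is that the dimension of the tangent
space is constant along a leaf. -/
lemma finrank_tangent [IsManifold 𝓘(ℝ, E) ∞ M] (x : M) :
    Module.finrank ℝ (P.tangent x) = P.dim (Quotient.mk P.rel x) := by
  let A : EuclideanSpace ℝ (Fin (P.dim (Quotient.mk P.rel x))) →L[ℝ] E :=
    mfderiv 𝓘(ℝ, EuclideanSpace ℝ (Fin (P.dim _))) 𝓘(ℝ, E)
      (Leaf.incl P (Quotient.mk P.rel x)) ⟨x, rfl⟩
  have hA : Function.Injective A :=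
    injective_mfderiv_of_isImmersionAt ((P.isImmersion_incl _).isImmersionAt ⟨x, rfl⟩)
  exact (LinearMap.finrank_range_of_inj (f := A.toLinearMap) hA).trans finrank_euclideanSpace_fin

lemma dense_velocity_mem_tangent [IsManifold 𝓘(ℝ, E) ∞ M] [T2Space M] {c : ℝ → M}
    (hc : ContMDiff 𝓘(ℝ, ℝ) 𝓘(ℝ, E) ∞ c) (hcL : ∀ s, Quotient.mk P.rel (c s) = L) :
    Dense {s | (mfderiv 𝓘(ℝ, ℝ) 𝓘(ℝ, E) c s (1 : ℝ)) ∈ P.tangent (c s)} := by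
  refine (dense_velocity_mem (P.isImmersion_incl L) hc fun s => ⟨⟨c s, hcL s⟩, rfl⟩).mono ?_
  rintro s ⟨u, hu, w, hw⟩
  have h : (mfderiv 𝓘(ℝ, EuclideanSpace ℝ (Fin (P.dim L))) 𝓘(ℝ, E) (Leaf.incl P L) u w) ∈
      P.tangent (Leaf.incl P L u) := by
    rw [tangent_eq_range]
    exact ⟨w, rfl⟩
  -- The base point is generalized so that the equality with `c s` can be substituted although
  -- tangent spaces depend on it.
  have key : ∀ z, Leaf.incl P L u = z → (mfderiv 𝓘(ℝ, EuclideanSpace ℝ (Fin (P.dim L))) 𝓘(ℝ, E)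
      (Leaf.incl P L) u w : E) ∈ (P.tangent z : Submodule ℝ E) := by
    rintro _ rfl
    exact h
  have h' := key _ hu
  rw [hw] at h'
  exact h'

end LeafPartition

variable [IsManifold 𝓘(ℝ, E) ∞ M] [FiniteDimensional ℝ E]

/-- The velocity of a curve inside a leaf of a singular foliation is tangent to the leaf. -/
lemma SingularFoliation.velocity_mem_tangent [T2Space M] (F : SingularFoliation E M) {c : ℝ → M}
    (hc : ContMDiff 𝓘(ℝ, ℝ) 𝓘(ℝ, E) ∞ c) (hcL : ∀ s, F.rel (c s) (c 0)) :
    (mfderiv 𝓘(ℝ, ℝ) 𝓘(ℝ, E) c 0 (1 : ℝ)) ∈ F.tangent (c 0) := by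
  -- Let `p` be the dimension of the leaf. A velocity that is not tangent, together with `p` tangent
  -- fields forming a basis at `c 0`, gives `p + 1` independent vectors near time `0`. At a nearby
  -- time with tangent velocity they all lie in a space of dimension `p`.
  by_contra hcon
  have hL (s : ℝ) : Quotient.mk F.rel (c s) = Quotient.mk F.rel (c 0) := Quotient.sound (hcL s)
  have hdim (s : ℝ) : Module.finrank ℝ (F.tangent (c s)) = Module.finrank ℝ (F.tangent (c 0)) := by
    rw [LeafPartition.finrank_tangent, LeafPartition.finrank_tangent, hL]
  have : FiniteDimensional ℝ (TangentSpace 𝓘(ℝ, E) (c 0)) := inferInstanceAs (FiniteDimensional ℝ E)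
  set p := Module.finrank ℝ (F.tangent (c 0)) with hp
  let b := Module.finBasis ℝ (F.tangent (c 0))
  have hY (j : Fin p) : ∃ X ∈ F.tangentFields, X (c 0) = b j := F.transitive _ _ (b j).2
  choose Y hYt hYb using hY
  let ψ := extChartAt 𝓘(ℝ, E) (c 0)
  let σ : ℝ → E := ψ ∘ c
  have hsrc : ∀ᶠ s in 𝓝 (0 : ℝ), c s ∈ ψ.source :=
    hc.continuous.continuousAt.eventually_mem (extChartAt_source_mem_nhds (I := 𝓘(ℝ, E)) (c 0))
  have hσ : ContDiffAt ℝ ∞ σ 0 :=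
    ((contMDiffAt_extChartAt (I := 𝓘(ℝ, E)) (n := ∞) (x := c 0)).comp (0 : ℝ) (hc 0)).contDiffAt
  -- The vectors are read in the chart at `c 0`, so that they vary continuously in the fixed space
  -- `E` and independence is an open condition.
  let W : ℝ → Fin (p + 1) → E := fun s =>
    Fin.cons (fderiv ℝ σ s 1) fun j => localField (Y j) (c 0) (σ s)
  have hW : ContinuousAt W 0 := by
    refine continuousAt_pi.2 fun j => ?_
    refine Fin.cases ?_ (fun j => ?_) j
    · exact ((hσ.fderiv_right (m := 0) (by simp)).clm_apply contDiffAt_const).continuousAt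
    · exact ContinuousAt.comp (f := σ)
        (localField_contDiffAt (Y j) (mem_extChartAt_target (I := 𝓘(ℝ, E)) (c 0))).continuousAt
        hσ.continuousAt
  have hvel {s : ℝ} (hs : c s ∈ ψ.source) (hev : ∀ᶠ s' in 𝓝 s, c s' ∈ ψ.source) :
      chartSymmDeriv E (c 0) (σ s) (fderiv ℝ σ s 1) =
        (mfderiv 𝓘(ℝ, ℝ) 𝓘(ℝ, E) c s (1 : ℝ) : E) := by
    have e : ψ.symm ∘ σ =ᶠ[𝓝 s] c := by
      filter_upwards [hev] with s' hs'
      exact ψ.left_inv hs'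
    have hσs : MDifferentiableAt 𝓘(ℝ, ℝ) 𝓘(ℝ, E) σ s :=
      (mdiffAt_chart hs).comp s ((hc s).mdifferentiableAt (by simp))
    have h1 := mfderiv_comp s (mdiffAt_symm (ψ.map_source hs)) hσs
    have h2 := e.mfderiv_eq (I := 𝓘(ℝ, ℝ)) (I' := 𝓘(ℝ, E))
    rw [← mfderiv_eq_fderiv]
    exact (congrArg (fun A : ℝ →L[ℝ] E => A 1) (h2.symm.trans h1)).symm
  have hfield {s : ℝ} (hs : c s ∈ ψ.source) (j : Fin p) :
      chartSymmDeriv E (c 0) (σ s) (localField (Y j) (c 0) (σ s)) = (Y j (c s) : E) := by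
    exact (chartSymmDeriv_localField _ (ψ.map_source hs)).trans
      (congrArg (fun z => (Y j z : E)) (ψ.left_inv hs))
  have hli0 : LinearIndependent ℝ (W 0) := by
    refine LinearIndependent.of_comp (chartSymmDeriv E (c 0) (σ 0)).toLinearMap ?_
    have h1 : ⇑(chartSymmDeriv E (c 0) (σ 0)).toLinearMap ∘ W 0 =
        Fin.cons (mfderiv 𝓘(ℝ, ℝ) 𝓘(ℝ, E) c 0 (1 : ℝ) : E) fun j => (((b j : F.tangent (c 0)) : TangentSpace 𝓘(ℝ, E) (c 0)) : E) := by
      funext j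
      refine Fin.cases ?_ (fun j => ?_) j
      · exact hvel hsrc.self_of_nhds hsrc
      · exact (hfield hsrc.self_of_nhds j).trans (hYb j)
    rw [h1]
    have hb : LinearIndependent ℝ fun j => (((b j : F.tangent (c 0)) : TangentSpace 𝓘(ℝ, E) (c 0)) : E) :=
      b.linearIndependent.map' (F.tangent (c 0)).subtype (Submodule.ker_subtype _)
    refine linearIndependent_finCons.2 ⟨hb, fun h => hcon ?_⟩
    have : Submodule.span ℝ (Set.range fun j => (((b j : F.tangent (c 0)) : TangentSpace 𝓘(ℝ, E) (c 0)) : E)) ≤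
        (F.tangent (c 0) : Submodule ℝ E) :=
      Submodule.span_le.2 (by rintro _ ⟨j, rfl⟩; exact (b j).2)
    exact this h
  have hli : ∀ᶠ s in 𝓝 (0 : ℝ), LinearIndependent ℝ (W s) :=
    hW.eventually (isOpen_setOfPred_linearIndependent.mem_nhds hli0)
  have hd := LeafPartition.dense_velocity_mem_tangent (P := F.toLeafPartition) hc hL
  -- Density supplies a time at which the vectors are still independent, the curve is still in the
  -- chart, and its velocity is tangent.
  obtain ⟨s, ⟨hs1, hs2⟩, hs3⟩ := mem_closure_iff_nhds.1 (hd 0) _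
    (hli.and (eventually_eventually_nhds.2 hsrc))
  have hss : c s ∈ ψ.source := hs2.self_of_nhds
  let T : Submodule ℝ E := F.tangent (c s)
  have hmem (j : Fin (p + 1)) : chartSymmDeriv E (c 0) (σ s) (W s j) ∈ T := by
    refine Fin.cases ?_ (fun j => ?_) j
    · change chartSymmDeriv E (c 0) (σ s) (fderiv ℝ σ s 1) ∈ _
      rw [hvel hss hs2]
      exact hs3
    · change chartSymmDeriv E (c 0) (σ s) (localField (Y j) (c 0) (σ s)) ∈ _
      rw [hfield hss]
      exact hYt j _
  have hinj : LinearMap.ker (chartSymmDeriv E (c 0) (σ s)).toLinearMap = ⊥ :=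
    LinearMap.ker_eq_bot.2 (chartSymmDeriv_isInvertible (ψ.map_source hss)).injective
  have hli2 := hs1.map' _ hinj
  have hli3 : LinearIndependent ℝ fun j => (⟨_, hmem j⟩ : T) :=
    LinearIndependent.of_comp T.subtype hli2
  have h1 := hli3.fintype_card_le_finrank
  have h2 : Module.finrank ℝ T = p := hdim s
  rw [h2, Fintype.card_fin] at h1
  omega

variable {E' : Type*} [NormedAddCommGroup E'] [NormedSpace ℝ E'] [FiniteDimensional ℝ E']
  {N : Type*} [TopologicalSpace N] [ChartedSpace E' N] [IsManifold 𝓘(ℝ, E') ∞ N]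

/-- The derivative of a foliate map sends vectors tangent to the leaves to such vectors. -/
lemma IsFoliate.mfderiv_mem_tangent [T2Space N] {F : SingularFoliation E M}
    {G : SingularFoliation E' N} {f : M → N} (hf : IsFoliate F G f) {x : M}
    {v : TangentSpace 𝓘(ℝ, E) x} (hv : v ∈ F.tangent x) :
    mfderiv 𝓘(ℝ, E) 𝓘(ℝ, E') f x v ∈ G.tangent (f x) := by
  set L : Quotient F.rel := Quotient.mk F.rel x
  let u : F.Leaf L := ⟨x, rfl⟩
  let E₁ : Type := EuclideanSpace ℝ (Fin (F.dim L))
  let A (z : F.Leaf L) : E₁ →L[ℝ] E := mfderiv 𝓘(ℝ, E₁) 𝓘(ℝ, E) (LeafPartition.Leaf.incl _ L) z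
  let B (z : M) : E →L[ℝ] E' := mfderiv 𝓘(ℝ, E) 𝓘(ℝ, E') f z
  obtain ⟨w, hw⟩ : ∃ w : E₁, A u w = v := hv
  -- The curve is smooth inside the source leaf, so its image under `f` lies in a single leaf of `G`
  -- and has tangent velocity. The factor `r` is divided out at the end.
  obtain ⟨c, r, hr, hc, hc0, hcv⟩ := exists_curve u w
  have hi := F.isImmersion_incl L
  have hfc := hf.1.comp (hi.contMDiff.comp hc)
  have h := G.velocity_mem_tangent hfc fun s => hf.2 _ _
    (Quotient.exact ((c s).2.trans (c 0).2.symm))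
  have h1 := mfderiv_comp (0 : ℝ) ((hf.1 _).mdifferentiableAt (by simp))
    (((hi.contMDiff.comp hc) 0).mdifferentiableAt (by simp))
  have h2 := mfderiv_comp (0 : ℝ) ((hi.contMDiff _).mdifferentiableAt (by simp))
    ((hc 0).mdifferentiableAt (by simp))
  rw [h1, h2] at h
  have key : ∀ (z : F.Leaf L) (w' : E₁), c 0 = z →
      (mfderiv 𝓘(ℝ, ℝ) 𝓘(ℝ, E₁) c 0 (1 : ℝ) : E₁) = w' →
      B (LeafPartition.Leaf.incl _ L z) (A z w') ∈
        (G.tangent (f (LeafPartition.Leaf.incl _ L z)) : Submodule ℝ E') := by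
    rintro _ _ rfl rfl
    exact h
  have h3 := key u (r • w) hc0 hcv
  rw [map_smul, map_smul, hw] at h3
  exact ((G.tangent (f x) : Submodule ℝ E').smul_mem_iff hr).1 h3

end Tangency

/-! ### Smoothness of pullbacks -/

section CompContinuousLinearMap

variable {D V W : Type*} [NormedAddCommGroup D] [NormedSpace ℝ D] [NormedAddCommGroup V]
  [NormedSpace ℝ V] [NormedAddCommGroup W] [NormedSpace ℝ W]

variable (V) in
/-- The antisymmetrization of multilinear forms, a left inverse to the inclusion of the
alternating forms. -/
def antisymm (k : ℕ) : ContinuousMultilinearMap ℝ (fun _ : Fin k => V) ℝ →L[ℝ] V [⋀^Fin k]→L[ℝ] ℝ :=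
  LinearMap.mkContinuous
    { toFun := fun f => (k.factorial : ℝ)⁻¹ • ContinuousMultilinearMap.alternatization f
      map_add' := fun f g => by rw [map_add, smul_add]
      map_smul' := fun c f => by
        ext v
        simp only [ContinuousAlternatingMap.smul_apply,
          ContinuousMultilinearMap.alternatization_apply_apply, _root_.smul_apply,
          RingHom.id_apply, Finset.smul_sum]
        exact Finset.sum_congr rfl fun σ _ => by
          rw [smul_comm c, smul_comm (Equiv.Perm.sign σ)] } 1 fun f => by
    refine ContinuousAlternatingMap.opNorm_le_bound _ (by positivity) fun v => ?_
    have hk : (0 : ℝ) < k.factorial := by positivity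
    -- Each of the `k!` summands is bounded by `‖f‖ ∏ ‖v i‖`; the normalization `1 / k!` absorbs
    -- their number, whence the operator bound `1`.
    have h (σ : Equiv.Perm (Fin k)) : ‖Equiv.Perm.sign σ • f (v ∘ σ)‖ ≤ ‖f‖ * ∏ i, ‖v i‖ := by
      have h1 : ‖Equiv.Perm.sign σ • f (v ∘ σ)‖ = ‖f (v ∘ σ)‖ := by
        rcases Int.units_eq_one_or (Equiv.Perm.sign σ) with hs | hs <;> simp [hs]
      rw [h1]
      refine (f.le_opNorm _).trans_eq ?_
      congr 1
      exact Equiv.prod_comp σ fun i => ‖v i‖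
    have h2 : ‖∑ σ : Equiv.Perm (Fin k), Equiv.Perm.sign σ • f (v ∘ σ)‖ ≤
        k.factorial * (‖f‖ * ∏ i, ‖v i‖) := by
      refine (norm_sum_le_of_le _ fun σ _ => h σ).trans_eq ?_
      simp [Finset.card_univ, Fintype.card_perm]
    simp only [LinearMap.coe_mk, AddHom.coe_mk, ContinuousAlternatingMap.smul_apply,
      ContinuousMultilinearMap.alternatization_apply_apply, norm_smul, norm_inv, one_mul,
      RCLike.norm_natCast]
    rw [inv_mul_le_iff₀ hk]
    exact h2

lemma antisymm_toContinuousMultilinearMap {k : ℕ} (f : V [⋀^Fin k]→L[ℝ] ℝ) :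
    antisymm V k f.toContinuousMultilinearMap = f := by
  ext v
  have hk : (k.factorial : ℝ) ≠ 0 := by positivity
  have h (σ : Equiv.Perm (Fin k)) :
      Equiv.Perm.sign σ • f.toContinuousMultilinearMap (v ∘ σ) = f v := by
    have := f.toAlternatingMap.map_perm v σ
    change Equiv.Perm.sign σ • f (v ∘ σ) = f v
    change f (v ∘ σ) = Equiv.Perm.sign σ • f v at this
    rw [this, smul_smul, Int.units_mul_self, one_smul]
  change (k.factorial : ℝ)⁻¹ *
    ContinuousMultilinearMap.alternatization f.toContinuousMultilinearMap v = f v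
  rw [ContinuousMultilinearMap.alternatization_apply_apply, Finset.sum_congr rfl fun σ _ => h σ]
  simp [Finset.card_univ, Fintype.card_perm, hk]

/-- For multilinear forms, composition is continuous and multilinear in the linear maps and linear
in the form, hence smooth. Alternating forms are reduced to this case by forgetting that they
alternate and returning through the continuous linear map `antisymm`. -/
lemma contDiffAt_compContinuousLinearMap {k : ℕ} {β : D → W [⋀^Fin k]→L[ℝ] ℝ}
    {A : D → V →L[ℝ] W} {p : D} {n : WithTop ℕ∞} (hβ : ContDiffAt ℝ n β p)
    (hA : ContDiffAt ℝ n A p) :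
    ContDiffAt ℝ n (fun y => (β y).compContinuousLinearMap (A y)) p := by
  have e : (fun y => (β y).compContinuousLinearMap (A y)) = fun y => antisymm V k
      (ContinuousMultilinearMap.compContinuousLinearMapContinuousMultilinear ℝ
        (fun _ : Fin k => V) (fun _ : Fin k => W) ℝ (fun _ => A y)
        (ContinuousAlternatingMap.toContinuousMultilinearMapCLM ℝ (β y))) := by
    funext y
    rw [← antisymm_toContinuousMultilinearMap ((β y).compContinuousLinearMap (A y))]
    rfl
  rw [e]
  refine (antisymm V k).contDiff.contDiffAt.comp p (ContDiffAt.clm_apply ?_ ?_)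
  · exact (ContinuousMultilinearMap.contDiff _).contDiffAt.comp p (contDiffAt_pi.2 fun _ => hA)
  · exact (ContinuousAlternatingMap.toContinuousMultilinearMapCLM ℝ).contDiff.contDiffAt.comp p hβ

end CompContinuousLinearMap

/-! ### Pullback of forms in coordinates, and its compatibility with the exterior derivative. -/

section Pullback

variable {V : Type*} [NormedAddCommGroup V] [NormedSpace ℝ V]
  {E' : Type*} [NormedAddCommGroup E'] [NormedSpace ℝ E']
  {N : Type*} [TopologicalSpace N] [ChartedSpace E' N] [IsManifold 𝓘(ℝ, E') ∞ N]

/-- A map in the preferred chart at the image of `p`. -/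
def codRep (Φ : V → N) (p : V) : V → E' := extChartAt 𝓘(ℝ, E') (Φ p) ∘ Φ

variable {Φ : V → N} {U : Set V} {p : V}

lemma codRep_contDiffAt (hU : IsOpen U) (hΦ : ContMDiffOn 𝓘(ℝ, V) 𝓘(ℝ, E') ∞ Φ U) (hp : p ∈ U) :
    ContDiffAt ℝ ∞ (codRep (E' := E') Φ p) p :=
  ((contMDiffAt_extChartAt (I := 𝓘(ℝ, E')) (n := ∞) (x := Φ p)).comp p
    (hΦ.contMDiffAt (hU.mem_nhds hp))).contDiffAt

/-- By the chain rule in the single chart at `Φ p`, the pullback near `p` is one between vector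
spaces. Smoothness and the naturality of `d` are thereby reduced to that case. -/
lemma pullback_eventuallyEq (hU : IsOpen U) (hΦ : ContMDiffOn 𝓘(ℝ, V) 𝓘(ℝ, E') ∞ Φ U)
    (hp : p ∈ U) {k : ℕ} (α : RawForm E' N k) :
    pullback (E := V) Φ k α =ᶠ[𝓝 p] fun y =>
      (localRep α (Φ p) (codRep (E' := E') Φ p y)).compContinuousLinearMap
        (fderiv ℝ (codRep (E' := E') Φ p) y) := by
  have hc : ContMDiffAt 𝓘(ℝ, V) 𝓘(ℝ, E') ∞ Φ p := hΦ.contMDiffAt (hU.mem_nhds hp)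
  filter_upwards [hU.mem_nhds hp, eventually_eventually_nhds.2 (hc.continuousAt.eventually_mem
    (extChartAt_source_mem_nhds (I := 𝓘(ℝ, E')) (Φ p)))] with y hyU hy'
  have hy := hy'.self_of_nhds
  have hd : MDifferentiableAt 𝓘(ℝ, V) 𝓘(ℝ, E') Φ y :=
    (hΦ.contMDiffAt (hU.mem_nhds hyU)).mdifferentiableAt (by simp)
  have e : Φ =ᶠ[𝓝 y] (extChartAt 𝓘(ℝ, E') (Φ p)).symm ∘ codRep (E' := E') Φ p := by
    filter_upwards [hy'] with y' hy'
    exact ((extChartAt 𝓘(ℝ, E') (Φ p)).left_inv hy').symm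
  have h1 := e.mfderiv_eq (I := 𝓘(ℝ, V)) (I' := 𝓘(ℝ, E'))
  have hcr : MDifferentiableAt 𝓘(ℝ, V) 𝓘(ℝ, E') (codRep (E' := E') Φ p) y :=
    (mdiffAt_chart hy).comp y hd
  rw [mfderiv_comp y (mdiffAt_symm ((extChartAt 𝓘(ℝ, E') (Φ p)).map_source hy)) hcr] at h1
  have h2 : (extChartAt 𝓘(ℝ, E') (Φ p)).symm (codRep (E' := E') Φ p y) = Φ y :=
    (extChartAt 𝓘(ℝ, E') (Φ p)).left_inv hy
  have h3 : (mfderiv 𝓘(ℝ, V) 𝓘(ℝ, E') Φ y : V →L[ℝ] E') =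
      (chartSymmDeriv E' (Φ p) (codRep (E' := E') Φ p y)).comp
        (fderiv ℝ (codRep (E' := E') Φ p) y) := by
    rw [← mfderiv_eq_fderiv]
    exact h1
  change (α (Φ y)).compContinuousLinearMap (mfderiv 𝓘(ℝ, V) 𝓘(ℝ, E') Φ y : V →L[ℝ] E') = _
  rw [h3, localRep, h2]
  rfl

/-- The pullback of a smooth form to an open subset of a vector space is smooth. -/
lemma contDiffAt_pullback {k : ℕ} {α : RawForm E' N k} (hα : IsSmoothForm α)
    (hU : IsOpen U) (hΦ : ContMDiffOn 𝓘(ℝ, V) 𝓘(ℝ, E') ∞ Φ U) (hp : p ∈ U) :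
    ContDiffAt ℝ ∞ (pullback (E := V) Φ k α) p := by
  refine ContDiffAt.congr_of_eventuallyEq ?_ (pullback_eventuallyEq hU hΦ hp α)
  have hc := codRep_contDiffAt hU hΦ hp
  exact contDiffAt_compContinuousLinearMap
    (ContDiffAt.comp p (hα.contDiffAt (mem_extChartAt_target (Φ p))) hc)
    (hc.fderiv_right (m := ∞) (by simp))

/-- The exterior derivative commutes with the pullback to an open subset of a vector space. -/
lemma extDeriv_pullback_form {k : ℕ} {α : RawForm E' N k} (hα : IsSmoothForm α)
    (hU : IsOpen U) (hΦ : ContMDiffOn 𝓘(ℝ, V) 𝓘(ℝ, E') ∞ Φ U) (hp : p ∈ U) :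
    extDeriv (pullback (E := V) Φ k α) p = pullback (E := V) Φ (k + 1) (extD α) p := by
  have hc := codRep_contDiffAt hU hΦ hp
  have ht : codRep (E' := E') Φ p p ∈ (extChartAt 𝓘(ℝ, E') (Φ p)).target :=
    mem_extChartAt_target (Φ p)
  rw [(pullback_eventuallyEq hU hΦ hp α).extDeriv_eq,
    _root_.extDeriv_pullback (r := ∞) ((hα.contDiffAt ht).differentiableAt (by simp)) hc
      two_le_infty, (pullback_eventuallyEq hU hΦ hp (extD α)).self_of_nhds]
  exact congrArg (fun γ : E' [⋀^Fin (k + 1)]→L[ℝ] ℝ => γ.compContinuousLinearMap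
    (fderiv ℝ (codRep (E' := E') Φ p) p)) (localRep_extD hα ht).symm

variable {E : Type*} [NormedAddCommGroup E] [NormedSpace ℝ E]
  {M : Type*} [TopologicalSpace M] [ChartedSpace E M] [IsManifold 𝓘(ℝ, E) ∞ M]

lemma contMDiffOn_comp_chart_symm {f : M → N} (hf : ContMDiff 𝓘(ℝ, E) 𝓘(ℝ, E') ∞ f) (x₀ : M) :
    ContMDiffOn 𝓘(ℝ, E) 𝓘(ℝ, E') ∞ (f ∘ (extChartAt 𝓘(ℝ, E) x₀).symm)
      (extChartAt 𝓘(ℝ, E) x₀).target :=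
  hf.comp_contMDiffOn (contMDiffOn_extChartAt_symm x₀)

lemma localRep_pullback {f : M → N} (hf : ContMDiff 𝓘(ℝ, E) 𝓘(ℝ, E') ∞ f) {k : ℕ}
    (α : RawForm E' N k) {x₀ : M} {y : E} (hy : y ∈ (extChartAt 𝓘(ℝ, E) x₀).target) :
    localRep (pullback f k α) x₀ y =
      pullback (E := E) (f ∘ (extChartAt 𝓘(ℝ, E) x₀).symm) k α y := by
  have h := mfderiv_comp y ((hf _).mdifferentiableAt (by simp)) (mdiffAt_symm hy)
  exact congrArg ((α (f ((extChartAt 𝓘(ℝ, E) x₀).symm y))).compContinuousLinearMap) h.symm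

lemma isSmoothForm_pullback {f : M → N} (hf : ContMDiff 𝓘(ℝ, E) 𝓘(ℝ, E') ∞ f) {k : ℕ}
    {α : RawForm E' N k} (hα : IsSmoothForm α) :
    IsSmoothForm (pullback (E := E) f k α) := fun x₀ => by
  refine ContDiffOn.congr (fun y hy => ?_) fun y hy => localRep_pullback hf α hy
  exact (contDiffAt_pullback hα (isOpen_extChartAt_target x₀) (contMDiffOn_comp_chart_symm hf x₀)
    hy).contDiffWithinAt

/-- The derivatives of the chart and of its inverse are mutually inverse, so a form is recovered at
`x` from its expression at the centre of the chart at `x`. Identities of forms can therefore be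
checked there. -/
lemma form_ext_of_localRep {k : ℕ} {α β : RawForm E M k}
    (h : ∀ x, localRep α x (extChartAt 𝓘(ℝ, E) x x) = localRep β x (extChartAt 𝓘(ℝ, E) x x)) :
    α = β := by
  have key (γ : RawForm E M k) (x : M) : γ x =
      (localRep γ x (extChartAt 𝓘(ℝ, E) x x)).compContinuousLinearMap (chartDeriv E x x) := by
    have h1 := chartSymmDeriv_comp (E := E) x
    have h2 : (extChartAt 𝓘(ℝ, E) x).symm (extChartAt 𝓘(ℝ, E) x x) = x := extChartAt_to_inv x
    have h3 : (localRep γ x (extChartAt 𝓘(ℝ, E) x x)).compContinuousLinearMap (chartDeriv E x x) =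
        (γ ((extChartAt 𝓘(ℝ, E) x).symm (extChartAt 𝓘(ℝ, E) x x))).compContinuousLinearMap
          ((chartSymmDeriv E x (extChartAt 𝓘(ℝ, E) x x)).comp (chartDeriv E x x)) := rfl
    rw [h3, h1, h2]
    rfl
  funext x
  rw [key α, key β, h]

lemma extD_pullback {f : M → N} (hf : ContMDiff 𝓘(ℝ, E) 𝓘(ℝ, E') ∞ f) {k : ℕ}
    {α : RawForm E' N k} (hα : IsSmoothForm α) :
    extD (pullback (E := E) f k α) = pullback f (k + 1) (extD α) := by
  refine form_ext_of_localRep fun x => ?_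
  have hx := mem_extChartAt_target (I := 𝓘(ℝ, E)) x
  have e : localRep (pullback (E := E) f k α) x =ᶠ[𝓝 (extChartAt 𝓘(ℝ, E) x x)]
      pullback (E := E) (f ∘ (extChartAt 𝓘(ℝ, E) x).symm) k α :=
    Filter.eventually_of_mem (target_mem hx) fun y hy => localRep_pullback hf α hy
  rw [localRep_extD (isSmoothForm_pullback hf hα) hx, localRep_pullback hf _ hx, e.extDeriv_eq,
    extDeriv_pullback_form hα (isOpen_extChartAt_target x) (contMDiffOn_comp_chart_symm hf x) hx]

end Pullback

/-! ### Integration over the unit interval -/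

section ParametricIntegral

universe u

variable {V W : Type u} [NormedAddCommGroup V] [NormedSpace ℝ V] [NormedAddCommGroup W]
  [NormedSpace ℝ W]

/-- The tube lemma around `{y} × [0, 1]` gives a bound uniform in the parameter. It is the
dominating constant for differentiation under the integral. -/
lemma exists_nhds_bound {η : V × ℝ → W} {U : Set V} (hU : IsOpen U)
    (hη : ContinuousOn η (U ×ˢ Set.univ)) {y : V} (hy : y ∈ U) :
    ∃ s ∈ 𝓝 y, ∃ K : ℝ, s ⊆ U ∧ ∀ x ∈ s, ∀ t ∈ Set.Icc (0 : ℝ) 1, ‖η (x, t)‖ ≤ K := by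
  have hc : ContinuousOn (fun t : ℝ => ‖η (y, t)‖) (Set.Icc 0 1) :=
    (hη.comp (f := fun t : ℝ => (y, t)) (by fun_prop) fun t _ => ⟨hy, trivial⟩).norm
  obtain ⟨K, hK⟩ := (isCompact_Icc.image_of_continuousOn hc).bddAbove
  have ho : IsOpen ((U ×ˢ Set.univ) ∩ (fun p => ‖η p‖) ⁻¹' Set.Iio (K + 1)) :=
    hη.norm.isOpen_inter_preimage (hU.prod isOpen_univ) isOpen_Iio
  obtain ⟨u, v, hu, -, hyu, hv, huv⟩ := generalized_tube_lemma (isCompact_singleton (x := y))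
    (isCompact_Icc (a := (0 : ℝ)) (b := 1)) ho (by
      rintro ⟨x, t⟩ ⟨rfl : x = y, ht⟩
      refine ⟨⟨hy, trivial⟩, ?_⟩
      have : ‖η (x, t)‖ ≤ K := hK ⟨t, ht, rfl⟩
      simp only [Set.mem_preimage, Set.mem_Iio]
      linarith)
  refine ⟨u ∩ U, (hu.inter hU).mem_nhds ⟨hyu rfl, hy⟩, K + 1, Set.inter_subset_right, ?_⟩
  intro x hx t ht
  have := (huv (show (x, t) ∈ u ×ˢ v from ⟨hx.1, hv ht⟩)).2
  simp only [Set.mem_preimage, Set.mem_Iio] at this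
  exact this.le

/-- The partial derivative in the direction of `V`. -/
def partialDeriv (η : V × ℝ → W) (p : V × ℝ) : V →L[ℝ] W :=
  (fderiv ℝ η p).comp (ContinuousLinearMap.inl ℝ V ℝ)

lemma contDiffOn_partialDeriv {η : V × ℝ → W} {U : Set V} (hU : IsOpen U)
    (hη : ContDiffOn ℝ ∞ η (U ×ˢ Set.univ)) :
    ContDiffOn ℝ ∞ (partialDeriv η) (U ×ˢ Set.univ) :=
  (hη.fderiv_of_isOpen (hU.prod isOpen_univ) (by simp)).clm_comp contDiffOn_const

lemma continuous_slice {η : V × ℝ → W} {U : Set V} (hη : ContinuousOn η (U ×ˢ Set.univ)) {y : V}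
    (hy : y ∈ U) : Continuous fun t => η (y, t) :=
  hη.comp_continuous (by fun_prop) fun _ => ⟨hy, trivial⟩

lemma hasFDerivAt_integral_slice {η : V × ℝ → W} {U : Set V} (hU : IsOpen U)
    (hη : ContDiffOn ℝ ∞ η (U ×ˢ Set.univ)) {y : V} (hy : y ∈ U) :
    HasFDerivAt (fun x => ∫ t in (0 : ℝ)..1, η (x, t))
      (∫ t in (0 : ℝ)..1, partialDeriv η (y, t)) y := by
  have hη' := (contDiffOn_partialDeriv hU hη).continuousOn
  obtain ⟨s, hs, K, hsU, hK⟩ := exists_nhds_bound hU hη' hy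
  refine intervalIntegral.hasFDerivAt_integral_of_dominated_of_fderiv_le
    (F := fun x t => η (x, t)) (F' := fun x t => partialDeriv η (x, t))
    (bound := fun _ => K) hs ?_ ?_ ?_ ?_ ?_ ?_
  · filter_upwards [hU.mem_nhds hy] with x hx
    exact (continuous_slice hη.continuousOn hx).aestronglyMeasurable
  · exact (continuous_slice hη.continuousOn hy).intervalIntegrable _ _
  · exact (continuous_slice hη' hy).aestronglyMeasurable
  · refine Filter.Eventually.of_forall fun t ht x hx => hK x hx t ?_
    rw [Set.uIoc_of_le zero_le_one] at ht
    exact ⟨ht.1.le, ht.2⟩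
  · exact continuous_const.intervalIntegrable _ _
  · refine Filter.Eventually.of_forall fun t _ x hx => ?_
    have hd : DifferentiableAt ℝ η (x, t) :=
      (hη.contDiffAt ((hU.prod isOpen_univ).mem_nhds ⟨hsU hx, trivial⟩)).differentiableAt (by simp)
    exact hd.hasFDerivAt.comp x (hasFDerivAt_prodMk_left x t)

/-- The derivative of the integral is the integral of the partial derivative, to which the induction
hypothesis applies. As that integrand takes values in `V →L[ℝ] W`, the induction is over all `W`; a
common universe for `V` and `W` keeps these spaces in range. -/
lemma contDiffOn_integral_slice_nat {U : Set V} (hU : IsOpen U) (n : ℕ) :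
    ∀ {W : Type u} [NormedAddCommGroup W] [NormedSpace ℝ W] {η : V × ℝ → W},
      ContDiffOn ℝ ∞ η (U ×ˢ Set.univ) →
      ContDiffOn ℝ n (fun x => ∫ t in (0 : ℝ)..1, η (x, t)) U := by
  induction n with
  | zero =>
    intro W _ _ η hη
    exact contDiffOn_zero.2 fun y hy =>
      (hasFDerivAt_integral_slice hU hη hy).continuousAt.continuousWithinAt
  | succ n ih =>
    intro W _ _ η hη
    push_cast
    rw [contDiffOn_succ_iff_fderiv_of_isOpen hU]
    refine ⟨fun y hy => (hasFDerivAt_integral_slice hU hη hy).differentiableAt.differentiableWithinAt,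
      by simp, ?_⟩
    exact (ih (contDiffOn_partialDeriv hU hη)).congr fun y hy =>
      (hasFDerivAt_integral_slice hU hη hy).fderiv

lemma contDiffOn_integral_slice {η : V × ℝ → W} {U : Set V} (hU : IsOpen U)
    (hη : ContDiffOn ℝ ∞ η (U ×ˢ Set.univ)) :
    ContDiffOn ℝ ∞ (fun x => ∫ t in (0 : ℝ)..1, η (x, t)) U :=
  contDiffOn_infty.2 fun n => contDiffOn_integral_slice_nat hU n hη

end ParametricIntegral

/-! ### Forms on a product with the real line -/

section Cylinder

variable {V : Type*} [NormedAddCommGroup V] [NormedSpace ℝ V]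

variable (V) in
/-- The restriction of forms to the slices `V × {t}`. -/
def sliceCLM (k : ℕ) : (V × ℝ) [⋀^Fin k]→L[ℝ] ℝ →L[ℝ] V [⋀^Fin k]→L[ℝ] ℝ :=
  ContinuousAlternatingMap.compContinuousLinearMapCLM (ContinuousLinearMap.inl ℝ V ℝ)

variable (V) in
/-- The contraction of a form with the vertical unit vector, restricted to the slices. -/
def verticalCLM (k : ℕ) : (V × ℝ) [⋀^Fin (k + 1)]→L[ℝ] ℝ →L[ℝ] V [⋀^Fin k]→L[ℝ] ℝ :=
  (sliceCLM V k).comp (contractCLM k ((0, 1) : V × ℝ))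

/-- Only horizontal vectors are inserted after restriction to a slice, so only the horizontal
derivatives survive in the alternating sum. -/
lemma sliceCLM_alternatize {k : ℕ} (g : (V × ℝ) →L[ℝ] (V × ℝ) [⋀^Fin k]→L[ℝ] ℝ) :
    sliceCLM V (k + 1) (ContinuousAlternatingMap.alternatizeUncurryFin g) =
      ContinuousAlternatingMap.alternatizeUncurryFin
        (((sliceCLM V k).comp g).comp (ContinuousLinearMap.inl ℝ V ℝ)) := by
  ext v
  simp only [sliceCLM, ContinuousAlternatingMap.compContinuousLinearMapCLM_apply,
    ContinuousAlternatingMap.compContinuousLinearMap_apply,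
    ContinuousAlternatingMap.alternatizeUncurryFin_apply]
  rfl

/-- Cartan's formula for the vertical vector field, restricted to the slices. -/
lemma fderiv_slice_vertical {k : ℕ} {β : V × ℝ → (V × ℝ) [⋀^Fin (k + 1)]→L[ℝ] ℝ} {p : V × ℝ}
    (hβ : DifferentiableAt ℝ β p) :
    sliceCLM V (k + 1) (fderiv ℝ β p (0, 1)) =
      ContinuousAlternatingMap.alternatizeUncurryFin
        ((fderiv ℝ (fun q => verticalCLM V k (β q)) p).comp (ContinuousLinearMap.inl ℝ V ℝ)) +
      verticalCLM V (k + 1) (extDeriv β p) := by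
  -- The vertical field is constant, so Cartan's formula is the algebraic identity `ι dβ = ∂β - d(ι
  -- β)`.
  have h1 := curryLeft_alternatize (fderiv ℝ β p)
    ((contractCLM k ((0, 1) : V × ℝ)).comp (fderiv ℝ β p)) ((0, 1) : V × ℝ) fun u => rfl
  have h2 : fderiv ℝ (fun q => verticalCLM V k (β q)) p =
      (verticalCLM V k).comp (fderiv ℝ β p) :=
    ((verticalCLM V k).hasFDerivAt.comp p hβ.hasFDerivAt).fderiv
  have h3 : verticalCLM V (k + 1) (extDeriv β p) = sliceCLM V (k + 1) (fderiv ℝ β p (0, 1)) -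
      sliceCLM V (k + 1) (ContinuousAlternatingMap.alternatizeUncurryFin
        ((contractCLM k ((0, 1) : V × ℝ)).comp (fderiv ℝ β p))) := by
    rw [← map_sub, ← h1]
    rfl
  rw [h3, h2, sliceCLM_alternatize]
  exact (add_sub_cancel _ _).symm

lemma fderiv_slice_vertical_zero {β : V × ℝ → (V × ℝ) [⋀^Fin 0]→L[ℝ] ℝ} {p : V × ℝ} :
    sliceCLM V 0 (fderiv ℝ β p (0, 1)) = verticalCLM V 0 (extDeriv β p) := by
  rw [← curryLeft_alternatize_zero (fderiv ℝ β p)]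
  rfl

lemma hasDerivAt_slice {k : ℕ} {β : V × ℝ → (V × ℝ) [⋀^Fin k]→L[ℝ] ℝ} {y : V} {t : ℝ}
    (hβ : DifferentiableAt ℝ β (y, t)) :
    HasDerivAt (fun s => sliceCLM V k (β (y, s))) (sliceCLM V k (fderiv ℝ β (y, t) (0, 1))) t := by
  have h1 : HasFDerivAt (fun s : ℝ => (y, s)) (ContinuousLinearMap.inr ℝ V ℝ) t :=
    hasFDerivAt_prodMk_right y t
  have h2 := ((sliceCLM V k).hasFDerivAt.comp t (hβ.hasFDerivAt.comp t h1)).hasDerivAt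
  exact h2.congr_deriv (by simp)

variable {U : Set V} {y : V}

lemma continuous_fderiv_slice {W : Type*} [NormedAddCommGroup W] [NormedSpace ℝ W]
    (hU : IsOpen U) (hy : y ∈ U) {β : V × ℝ → W}
    (hβ : ContDiffOn ℝ ∞ β (U ×ˢ Set.univ)) : Continuous fun t : ℝ => fderiv ℝ β (y, t) :=
  (hβ.continuousOn_fderiv_of_isOpen (hU.prod isOpen_univ) (by simp)).comp_continuous
    (by fun_prop) fun _ => ⟨hy, trivial⟩

/-- After `d` is moved under the integral, Cartan's formula turns the integrand into the derivative
in `t` of the restriction to the slices, and the fundamental theorem of calculus evaluates it. -/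
lemma extDeriv_integral_vertical (hU : IsOpen U) (hy : y ∈ U) {k : ℕ}
    {β : V × ℝ → (V × ℝ) [⋀^Fin (k + 1)]→L[ℝ] ℝ} (hβ : ContDiffOn ℝ ∞ β (U ×ˢ Set.univ)) :
    extDeriv (fun x => ∫ t in (0 : ℝ)..1, verticalCLM V k (β (x, t))) y +
      ∫ t in (0 : ℝ)..1, verticalCLM V (k + 1) (extDeriv β (y, t)) =
        sliceCLM V (k + 1) (β (y, 1)) - sliceCLM V (k + 1) (β (y, 0)) := by
  have hη : ContDiffOn ℝ ∞ (fun q => verticalCLM V k (β q)) (U ×ˢ Set.univ) :=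
    (verticalCLM V k).contDiff.comp_contDiffOn hβ
  have hd (t : ℝ) : DifferentiableAt ℝ β (y, t) :=
    (hβ.contDiffAt ((hU.prod isOpen_univ).mem_nhds ⟨hy, trivial⟩)).differentiableAt (by simp)
  have hc := continuous_fderiv_slice hU hy hβ
  have hc' : Continuous fun t => partialDeriv (fun q => verticalCLM V k (β q)) (y, t) :=
    continuous_slice (contDiffOn_partialDeriv hU hη).continuousOn hy
  rw [extDeriv, (hasFDerivAt_integral_slice hU hη hy).fderiv,
    ← ContinuousAlternatingMap.alternatizeUncurryFinCLM_apply,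
    ← ContinuousLinearMap.intervalIntegral_comp_comm _ (hc'.intervalIntegrable _ _),
    ← intervalIntegral.integral_add]
  · rw [← intervalIntegral.integral_eq_sub_of_hasDerivAt (fun t _ => hasDerivAt_slice (hd t))]
    · exact intervalIntegral.integral_congr fun t _ => (fderiv_slice_vertical (hd t)).symm
    · exact (Continuous.intervalIntegrable (by fun_prop) _ _)
  · exact (((ContinuousAlternatingMap.alternatizeUncurryFinCLM ℝ V ℝ).continuous.comp
      hc').intervalIntegrable _ _)
  · exact (((verticalCLM V (k + 1)).continuous.comp
      ((ContinuousAlternatingMap.alternatizeUncurryFinCLM ℝ (V × ℝ) ℝ).continuous.comp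
        hc)).intervalIntegrable _ _)

/-- In degree `0` Cartan's formula has no term `d ι`, and the fundamental theorem applies directly.
-/
lemma integral_vertical_zero (hU : IsOpen U) (hy : y ∈ U)
    {β : V × ℝ → (V × ℝ) [⋀^Fin 0]→L[ℝ] ℝ} (hβ : ContDiffOn ℝ ∞ β (U ×ˢ Set.univ)) :
    ∫ t in (0 : ℝ)..1, verticalCLM V 0 (extDeriv β (y, t)) =
      sliceCLM V 0 (β (y, 1)) - sliceCLM V 0 (β (y, 0)) := by
  have hd (t : ℝ) : DifferentiableAt ℝ β (y, t) :=
    (hβ.contDiffAt ((hU.prod isOpen_univ).mem_nhds ⟨hy, trivial⟩)).differentiableAt (by simp)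
  have hc := continuous_fderiv_slice hU hy hβ
  rw [← intervalIntegral.integral_eq_sub_of_hasDerivAt (fun t _ => hasDerivAt_slice (hd t))]
  · exact intervalIntegral.integral_congr fun t _ => fderiv_slice_vertical_zero.symm
  · exact (Continuous.intervalIntegrable (by fun_prop) _ _)

end Cylinder

/-! ### The homotopy operator -/

section Homotopy

variable {E : Type*} [NormedAddCommGroup E] [NormedSpace ℝ E]
  {M : Type*} [TopologicalSpace M] [ChartedSpace E M]
  {E' : Type*} [NormedAddCommGroup E'] [NormedSpace ℝ E']
  {N : Type*} [TopologicalSpace N] [ChartedSpace E' N]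

variable (E') in
/-- The velocity of a homotopy in the direction of the parameter. -/
def velocity (f : M × ℝ → N) (x : M) (t : ℝ) : E' :=
  mfderiv 𝓘(ℝ, ℝ) 𝓘(ℝ, E') (fun s => f (x, s)) t (1 : ℝ)

variable (E E') in
/-- The derivative of the map `f_t` of a homotopy. -/
def sliceDeriv (f : M × ℝ → N) (x : M) (t : ℝ) : E →L[ℝ] E' :=
  mfderiv 𝓘(ℝ, E) 𝓘(ℝ, E') (fun z => f (z, t)) x

/-- The integrand of the homotopy operator. -/
def homotopyIntegrand (f : M × ℝ → N) {k : ℕ} (α : RawForm E' N (k + 1)) (x : M) (t : ℝ) :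
    E [⋀^Fin k]→L[ℝ] ℝ :=
  ((α (f (x, t))).curryLeft (velocity E' f x t)).compContinuousLinearMap (sliceDeriv E E' f x t)

/-- The homotopy operator in positive degrees, `(h α)_x = ∫₀¹ f_t^* (ι_{∂f/∂t} α) dt`. -/
def homotopyOpSucc (f : M × ℝ → N) {k : ℕ} (α : RawForm E' N (k + 1)) : RawForm E M k :=
  fun x => ∫ t in (0 : ℝ)..1, homotopyIntegrand f α x t

/-- The homotopy operator; it is zero on functions. -/
def homotopyOp (f : M × ℝ → N) : (k : ℕ) → RawForm E' N k → RawForm E M (k - 1)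
  | 0, _ => 0
  | _ + 1, α => homotopyOpSucc f α

variable (E) in
/-- A homotopy in the preferred chart at `x₀` of the source. -/
def locMap (f : M × ℝ → N) (x₀ : M) : E × ℝ → N :=
  fun p => f ((extChartAt 𝓘(ℝ, E) x₀).symm p.1, p.2)

variable [IsManifold 𝓘(ℝ, E) ∞ M] [IsManifold 𝓘(ℝ, E') ∞ N]
  {f : M × ℝ → N} {x₀ : M} {y : E}

lemma contMDiffOn_locMap (hf : ContMDiff (𝓘(ℝ, E).prod 𝓘(ℝ, ℝ)) 𝓘(ℝ, E') ∞ f) (x₀ : M) :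
    ContMDiffOn 𝓘(ℝ, E × ℝ) 𝓘(ℝ, E') ∞ (locMap E f x₀)
      ((extChartAt 𝓘(ℝ, E) x₀).target ×ˢ Set.univ) := by
  refine hf.comp_contMDiffOn (ContMDiffOn.prodMk ?_ ?_)
  · exact (contMDiffOn_extChartAt_symm x₀).comp
      (contDiff_fst.contMDiff (𝕜 := ℝ) (E := E × ℝ) (E' := E)).contMDiffOn fun p hp => hp.1
  · exact (contDiff_snd.contMDiff (𝕜 := ℝ) (E := E × ℝ) (E' := ℝ)).contMDiffOn

lemma contMDiff_slice (hf : ContMDiff (𝓘(ℝ, E).prod 𝓘(ℝ, ℝ)) 𝓘(ℝ, E') ∞ f) (t : ℝ) :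
    ContMDiff 𝓘(ℝ, E) 𝓘(ℝ, E') ∞ fun x => f (x, t) :=
  hf.comp (contMDiff_id.prodMk contMDiff_const)

lemma mdifferentiableAt_locMap (hf : ContMDiff (𝓘(ℝ, E).prod 𝓘(ℝ, ℝ)) 𝓘(ℝ, E') ∞ f)
    (hy : y ∈ (extChartAt 𝓘(ℝ, E) x₀).target) (t : ℝ) :
    MDifferentiableAt 𝓘(ℝ, E × ℝ) 𝓘(ℝ, E') (locMap E f x₀) (y, t) :=
  ((contMDiffOn_locMap hf x₀).contMDiffAt (((isOpen_extChartAt_target x₀).prod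
    isOpen_univ).mem_nhds ⟨hy, trivial⟩)).mdifferentiableAt (by simp)

lemma mfderiv_locMap_vertical (hf : ContMDiff (𝓘(ℝ, E).prod 𝓘(ℝ, ℝ)) 𝓘(ℝ, E') ∞ f)
    (hy : y ∈ (extChartAt 𝓘(ℝ, E) x₀).target) (t : ℝ) :
    (mfderiv 𝓘(ℝ, E × ℝ) 𝓘(ℝ, E') (locMap E f x₀) (y, t) : E × ℝ →L[ℝ] E') (0, 1) =
      velocity E' f ((extChartAt 𝓘(ℝ, E) x₀).symm y) t := by
  have h1 : HasFDerivAt (fun s : ℝ => (y, s)) (ContinuousLinearMap.inr ℝ E ℝ) t :=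
    hasFDerivAt_prodMk_right y t
  have h := mfderiv_comp t (mdifferentiableAt_locMap hf hy t) h1.differentiableAt.mdifferentiableAt
  rw [mfderiv_eq_fderiv, h1.fderiv] at h
  exact (congrArg (fun A : ℝ →L[ℝ] E' => A 1) h).symm

lemma mfderiv_locMap_horizontal (hf : ContMDiff (𝓘(ℝ, E).prod 𝓘(ℝ, ℝ)) 𝓘(ℝ, E') ∞ f)
    (hy : y ∈ (extChartAt 𝓘(ℝ, E) x₀).target) (t : ℝ) :
    (mfderiv 𝓘(ℝ, E × ℝ) 𝓘(ℝ, E') (locMap E f x₀) (y, t) : E × ℝ →L[ℝ] E').comp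
      (ContinuousLinearMap.inl ℝ E ℝ) =
      (sliceDeriv E E' f ((extChartAt 𝓘(ℝ, E) x₀).symm y) t).comp (chartSymmDeriv E x₀ y) := by
  have h1 : HasFDerivAt (fun y' : E => (y', t)) (ContinuousLinearMap.inl ℝ E ℝ) y :=
    hasFDerivAt_prodMk_left y t
  have h := mfderiv_comp y (mdifferentiableAt_locMap hf hy t) h1.differentiableAt.mdifferentiableAt
  rw [mfderiv_eq_fderiv, h1.fderiv] at h
  have h2 := mfderiv_comp y ((contMDiff_slice hf t _).mdifferentiableAt (by simp)) (mdiffAt_symm hy)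
  exact h.symm.trans h2

lemma localRep_pullback_slice (hf : ContMDiff (𝓘(ℝ, E).prod 𝓘(ℝ, ℝ)) 𝓘(ℝ, E') ∞ f)
    (hy : y ∈ (extChartAt 𝓘(ℝ, E) x₀).target) {k : ℕ} (α : RawForm E' N k) (t : ℝ) :
    localRep (pullback (E := E) (fun x => f (x, t)) k α) x₀ y =
      sliceCLM E k (pullback (E := E × ℝ) (locMap E f x₀) k α (y, t)) :=
  congrArg (α (f ((extChartAt 𝓘(ℝ, E) x₀).symm y, t))).compContinuousLinearMap
    (mfderiv_locMap_horizontal hf hy t).symm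

/-- In a chart of the source, the integrand is the vertical contraction of the pullback to the
cylinder. This carries the computations on `V × ℝ` over to the manifold. -/
lemma homotopyIntegrand_comp (hf : ContMDiff (𝓘(ℝ, E).prod 𝓘(ℝ, ℝ)) 𝓘(ℝ, E') ∞ f)
    (hy : y ∈ (extChartAt 𝓘(ℝ, E) x₀).target) {k : ℕ} (α : RawForm E' N (k + 1)) (t : ℝ) :
    (homotopyIntegrand (E := E) f α ((extChartAt 𝓘(ℝ, E) x₀).symm y) t).compContinuousLinearMap
      (chartSymmDeriv E x₀ y) =
      verticalCLM E k (pullback (E := E × ℝ) (locMap E f x₀) (k + 1) α (y, t)) := by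
  set D : E × ℝ →L[ℝ] E' := mfderiv 𝓘(ℝ, E × ℝ) 𝓘(ℝ, E') (locMap E f x₀) (y, t) with hD
  set a : E' [⋀^Fin (k + 1)]→L[ℝ] ℝ := α (f ((extChartAt 𝓘(ℝ, E) x₀).symm y, t)) with ha
  have h1 : verticalCLM E k (pullback (E := E × ℝ) (locMap E f x₀) (k + 1) α (y, t)) =
      ((a.compContinuousLinearMap D).curryLeft (0, 1)).compContinuousLinearMap
        (ContinuousLinearMap.inl ℝ E ℝ) := rfl
  have hv : D (0, 1) = velocity E' f ((extChartAt 𝓘(ℝ, E) x₀).symm y) t :=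
    mfderiv_locMap_vertical hf hy t
  rw [h1, ContinuousAlternatingMap.curryLeft_compContinuousLinearMap, hv]
  exact congrArg (a.curryLeft (velocity E' f ((extChartAt 𝓘(ℝ, E) x₀).symm y)
    t)).compContinuousLinearMap (mfderiv_locMap_horizontal hf hy t).symm

lemma contDiffOn_pullback_locMap (hf : ContMDiff (𝓘(ℝ, E).prod 𝓘(ℝ, ℝ)) 𝓘(ℝ, E') ∞ f)
    {k : ℕ} {α : RawForm E' N k} (hα : IsSmoothForm α) (x₀ : M) :
    ContDiffOn ℝ ∞ (pullback (E := E × ℝ) (locMap E f x₀) k α)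
      ((extChartAt 𝓘(ℝ, E) x₀).target ×ˢ Set.univ) := fun _ hp =>
  (contDiffAt_pullback hα ((isOpen_extChartAt_target x₀).prod isOpen_univ)
    (contMDiffOn_locMap hf x₀) hp).contDiffWithinAt

lemma continuous_homotopyIntegrand (hf : ContMDiff (𝓘(ℝ, E).prod 𝓘(ℝ, ℝ)) 𝓘(ℝ, E') ∞ f)
    {k : ℕ} {α : RawForm E' N (k + 1)} (hα : IsSmoothForm α) (x : M) :
    Continuous (homotopyIntegrand (E := E) f α x) := by
  have hx := mem_extChartAt_target (I := 𝓘(ℝ, E)) x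
  have e (t : ℝ) : homotopyIntegrand (E := E) f α x t =
      ContinuousAlternatingMap.compContinuousLinearMapCLM (chartDeriv E x x)
        (verticalCLM E k (pullback (E := E × ℝ) (locMap E f x) (k + 1) α
          (extChartAt 𝓘(ℝ, E) x x, t))) := by
    rw [← homotopyIntegrand_comp hf hx, extChartAt_to_inv]
    have h : (homotopyIntegrand (E := E) f α x t).compContinuousLinearMap
        ((chartSymmDeriv E x (extChartAt 𝓘(ℝ, E) x x)).comp (chartDeriv E x x)) =
        homotopyIntegrand (E := E) f α x t := by
      rw [chartSymmDeriv_comp]; rfl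
    exact h.symm
  have e' := funext e
  rw [e']
  exact (ContinuousAlternatingMap.compContinuousLinearMapCLM _).continuous.comp
    ((verticalCLM E k).continuous.comp
      (continuous_slice (contDiffOn_pullback_locMap hf hα x).continuousOn hx))

lemma localRep_homotopyOpSucc (hf : ContMDiff (𝓘(ℝ, E).prod 𝓘(ℝ, ℝ)) 𝓘(ℝ, E') ∞ f)
    (hy : y ∈ (extChartAt 𝓘(ℝ, E) x₀).target) {k : ℕ} {α : RawForm E' N (k + 1)}
    (hα : IsSmoothForm α) :
    localRep (E := E) (homotopyOpSucc f α) x₀ y =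
      ∫ t in (0 : ℝ)..1,
        verticalCLM E k (pullback (E := E × ℝ) (locMap E f x₀) (k + 1) α (y, t)) := by
  have h := ContinuousLinearMap.intervalIntegral_comp_comm (a := 0) (b := 1)
    (ContinuousAlternatingMap.compContinuousLinearMapCLM (chartSymmDeriv E x₀ y))
    ((continuous_homotopyIntegrand (E := E) hf hα
      ((extChartAt 𝓘(ℝ, E) x₀).symm y)).intervalIntegrable (μ := MeasureTheory.volume) _ _)
  refine h.symm.trans (intervalIntegral.integral_congr fun t _ => ?_)
  exact homotopyIntegrand_comp hf hy α t

lemma isSmoothForm_homotopyOpSucc (hf : ContMDiff (𝓘(ℝ, E).prod 𝓘(ℝ, ℝ)) 𝓘(ℝ, E') ∞ f)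
    {k : ℕ} {α : RawForm E' N (k + 1)} (hα : IsSmoothForm α) :
    IsSmoothForm (E := E) (homotopyOpSucc f α) := fun x₀ =>
  (contDiffOn_integral_slice (isOpen_extChartAt_target x₀)
    ((verticalCLM E k).contDiff.comp_contDiffOn (contDiffOn_pullback_locMap hf hα x₀))).congr
    fun _ hy => localRep_homotopyOpSucc hf hy hα

lemma isSmoothForm_homotopyOp (hf : ContMDiff (𝓘(ℝ, E).prod 𝓘(ℝ, ℝ)) 𝓘(ℝ, E') ∞ f)
    {k : ℕ} {α : RawForm E' N k} (hα : IsSmoothForm α) :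
    IsSmoothForm (E := E) (homotopyOp f k α) := by
  cases k with
  | zero => exact isSmoothForm_zero
  | succ k => exact isSmoothForm_homotopyOpSucc hf hα

/-- The homotopy formula `d h α + h d α = f₁^* α - f₀^* α` in positive degrees. -/
lemma extD_homotopyOpSucc (hf : ContMDiff (𝓘(ℝ, E).prod 𝓘(ℝ, ℝ)) 𝓘(ℝ, E') ∞ f)
    {k : ℕ} {α : RawForm E' N (k + 1)} (hα : IsSmoothForm α) :
    extD (homotopyOpSucc f α : RawForm E M k) + homotopyOpSucc f (extD α) =
      pullback (fun x => f (x, 1)) (k + 1) α - pullback (fun x => f (x, 0)) (k + 1) α := by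
  refine form_ext_of_localRep fun x => ?_
  have hx := mem_extChartAt_target (I := 𝓘(ℝ, E)) x
  set y := extChartAt 𝓘(ℝ, E) x x
  have ho := isOpen_extChartAt_target (I := 𝓘(ℝ, E)) x
  have hs : IsSmoothForm (E := E) (homotopyOpSucc f α) := isSmoothForm_homotopyOpSucc hf hα
  have e : localRep (E := E) (homotopyOpSucc f α) x =ᶠ[𝓝 y] fun y => ∫ t in (0 : ℝ)..1,
        verticalCLM E k (pullback (E := E × ℝ) (locMap E f x) (k + 1) α (y, t)) :=
    Filter.eventually_of_mem (target_mem hx) fun y hy => localRep_homotopyOpSucc hf hy hα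
  have h1 : localRep (extD (homotopyOpSucc f α : RawForm E M k)) x y = extDeriv _ y :=
    (localRep_extD hs hx).trans e.extDeriv_eq
  have h2 : localRep (E := E) (homotopyOpSucc f (extD α)) x y = ∫ t in (0 : ℝ)..1,
      verticalCLM E (k + 1) (extDeriv (pullback (E := E × ℝ) (locMap E f x) (k + 1) α) (y, t)) := by
    refine (localRep_homotopyOpSucc hf hx hα.extD).trans (intervalIntegral.integral_congr fun t _ => ?_)
    exact congrArg (verticalCLM E (k + 1)) (extDeriv_pullback_form hα (ho.prod isOpen_univ)
      (contMDiffOn_locMap hf x) ⟨hx, trivial⟩).symm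
  have h3 := extDeriv_integral_vertical ho hx (contDiffOn_pullback_locMap hf hα x)
  rw [← h1, ← h2, ← localRep_pullback_slice hf hx, ← localRep_pullback_slice hf hx] at h3
  exact h3

/-- The homotopy formula on functions. -/
lemma homotopyOpSucc_extD_zero (hf : ContMDiff (𝓘(ℝ, E).prod 𝓘(ℝ, ℝ)) 𝓘(ℝ, E') ∞ f)
    {α : RawForm E' N 0} (hα : IsSmoothForm α) :
    (homotopyOpSucc f (extD α) : RawForm E M 0) =
      pullback (fun x => f (x, 1)) 0 α - pullback (fun x => f (x, 0)) 0 α := by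
  refine form_ext_of_localRep fun x => ?_
  have hx := mem_extChartAt_target (I := 𝓘(ℝ, E)) x
  set y := extChartAt 𝓘(ℝ, E) x x
  have ho := isOpen_extChartAt_target (I := 𝓘(ℝ, E)) x
  have h2 : localRep (E := E) (homotopyOpSucc f (extD α)) x y = ∫ t in (0 : ℝ)..1,
      verticalCLM E 0 (extDeriv (pullback (E := E × ℝ) (locMap E f x) 0 α) (y, t)) := by
    refine (localRep_homotopyOpSucc hf hx hα.extD).trans (intervalIntegral.integral_congr fun t _ => ?_)
    exact congrArg (verticalCLM E 0) (extDeriv_pullback_form hα (ho.prod isOpen_univ)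
      (contMDiffOn_locMap hf x) ⟨hx, trivial⟩).symm
  have h3 := integral_vertical_zero ho hx (contDiffOn_pullback_locMap hf hα x)
  rw [← h2, ← localRep_pullback_slice hf hx, ← localRep_pullback_slice hf hx] at h3
  exact h3

/-- Contractions with fields `X` and `Y` that are related by all the maps `f_t`, up to vectors that
annihilate `α`, anticommute with the homotopy operator. -/
lemma contract_homotopyOpSucc (hf : ContMDiff (𝓘(ℝ, E).prod 𝓘(ℝ, ℝ)) 𝓘(ℝ, E') ∞ f)
    (X : ∀ x : M, TangentSpace 𝓘(ℝ, E) x) (Y : ∀ x : N, TangentSpace 𝓘(ℝ, E') x)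
    {k : ℕ} {α : RawForm E' N (k + 2)} (hα : IsSmoothForm α)
    (h : ∀ (x : M) (t : ℝ), (α (f (x, t))).curryLeft (sliceDeriv E E' f x t (X x)) =
      (α (f (x, t))).curryLeft (Y (f (x, t)))) :
    contract X (k + 1) (homotopyOpSucc f α) =
      -homotopyOpSucc f (k := k) (contract Y (k + 2) α) := by
  funext x
  let v : E := X x
  have h1 := ContinuousLinearMap.intervalIntegral_comp_comm (a := 0) (b := 1)
    (contractCLM k v)
    ((continuous_homotopyIntegrand (E := E) hf hα x).intervalIntegrable
      (μ := MeasureTheory.volume) _ _)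
  refine h1.symm.trans ?_
  have h2 : homotopyOpSucc f (k := k) (contract Y (k + 2) α) x =
    ∫ t in (0 : ℝ)..1, homotopyIntegrand (E := E) f (k := k) (contract Y (k + 2) α) x t := rfl
  refine Eq.trans ?_ (congrArg Neg.neg h2).symm
  rw [← intervalIntegral.integral_neg]
  refine intervalIntegral.integral_congr fun t _ => ?_
  let a : E' [⋀^Fin (k + 2)]→L[ℝ] ℝ := α (f (x, t))
  let Z : E' := Y (f (x, t))
  -- The minus sign comes from exchanging the two contractions, by the velocity and by the image of
  -- `X`.
  change ((a.curryLeft (velocity E' f x t)).compContinuousLinearMap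
    (sliceDeriv E E' f x t)).curryLeft v =
    -(((a.curryLeft Z).curryLeft (velocity E' f x t)).compContinuousLinearMap
      (sliceDeriv E E' f x t))
  have h3 : a.curryLeft (sliceDeriv E E' f x t v) = a.curryLeft Z := h x t
  rw [ContinuousAlternatingMap.curryLeft_compContinuousLinearMap, curryLeft_curryLeft_comm, h3]
  rfl

end Homotopy

/-! ### Pullbacks and homotopies on basic forms -/

section Basic

variable {E : Type*} [NormedAddCommGroup E] [NormedSpace ℝ E] [FiniteDimensional ℝ E]
  {M : Type*} [TopologicalSpace M] [ChartedSpace E M] [IsManifold 𝓘(ℝ, E) ∞ M]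
  {E' : Type*} [NormedAddCommGroup E'] [NormedSpace ℝ E'] [FiniteDimensional ℝ E']
  {N : Type*} [TopologicalSpace N] [ChartedSpace E' N] [IsManifold 𝓘(ℝ, E') ∞ N]
  {F : SingularFoliation E M} {G : SingularFoliation E' N}

/-- Since every tangent vector extends to a tangent field, a basic form annihilates individual
tangent vectors. The pointwise version is what the maps require: the image of a field under a
derivative is in general only a field along the map. -/
lemma SingularFoliation.curryLeft_eq_zero {k : ℕ} {α : RawForm E M (k + 1)}
    (hα : α ∈ F.basicForms (k + 1)) {x : M} {v : E}
    (hv : v ∈ (F.tangent x : Submodule ℝ E)) : (α x).curryLeft v = 0 := by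
  obtain ⟨X, hX, rfl⟩ := F.transitive x v hv
  exact congrFun (hα.2 X hX).1 x

lemma contract_sub_right (X : ∀ x : M, TangentSpace 𝓘(ℝ, E) x) {k : ℕ}
    (α β : RawForm E M (k + 1)) :
    contract X (k + 1) (α - β) = contract X (k + 1) α - contract X (k + 1) β := rfl

lemma SingularFoliation.extD_mem_basicForms {k : ℕ} {α : RawForm E M k}
    (hα : α ∈ F.basicForms k) : extD α ∈ F.basicForms (k + 1) :=
  (F.basicD k ⟨α, hα⟩).2

section

variable [T2Space N] {f : M → N}

lemma IsFoliate.contract_pullback (hf : IsFoliate F G f) {k : ℕ} {α : RawForm E' N k}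
    (hα : α ∈ G.basicForms k) {X : VField E M} (hX : X ∈ F.tangentFields) :
    contract X k (pullback f k α) = 0 := by
  cases k with
  | zero => rfl
  | succ k =>
    funext x
    let D : E →L[ℝ] E' := mfderiv 𝓘(ℝ, E) 𝓘(ℝ, E') f x
    let v : E := X x
    change ((α (f x)).compContinuousLinearMap D).curryLeft v = 0
    have hz : (α (f x)).curryLeft (D v) = 0 :=
      G.curryLeft_eq_zero hα (hf.mfderiv_mem_tangent (hX x))
    rw [ContinuousAlternatingMap.curryLeft_compContinuousLinearMap, hz]
    rfl

lemma IsFoliate.pullback_mem (hf : IsFoliate F G f) {k : ℕ} {α : RawForm E' N k}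
    (hα : α ∈ G.basicForms k) : pullback f k α ∈ F.basicForms k := by
  refine ⟨isSmoothForm_pullback hf.1 hα.1, fun X hX => ⟨hf.contract_pullback hα hX, ?_⟩⟩
  rw [extD_pullback hf.1 hα.1]
  exact hf.contract_pullback (G.extD_mem_basicForms hα) hX

/-- The pullback of basic `k`-forms by a foliate map. -/
def basicPullback (hf : IsFoliate F G f) (k : ℕ) : G.BasicForm k →ₗ[ℝ] F.BasicForm k where
  toFun α := ⟨pullback f k α.1, hf.pullback_mem α.2⟩
  map_add' α β := Subtype.ext (map_add (pullback f k) α.1 β.1)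
  map_smul' c α := Subtype.ext (map_smul (pullback f k) c α.1)

/-- The pullback of basic forms by a foliate map. -/
def formsPullback (hf : IsFoliate F G f) : G.BasicForms →ₗ[ℝ] F.BasicForms :=
  DirectSum.lmap (basicPullback hf)

lemma formsPullback_lof (hf : IsFoliate F G f) (k : ℕ) (α : G.BasicForm k) :
    formsPullback hf (DirectSum.lof ℝ ℕ G.BasicForm k α) =
      DirectSum.lof ℝ ℕ F.BasicForm k (basicPullback hf k α) :=
  DirectSum.lmap_lof _ _ _

lemma SingularFoliation.d_lof (k : ℕ) (α : F.BasicForm k) :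
    F.d (DirectSum.lof ℝ ℕ F.BasicForm k α) =
      DirectSum.lof ℝ ℕ F.BasicForm (k + 1) (F.basicD k α) := by
  simp [SingularFoliation.d]

lemma SingularFoliation.ι_lof (X : F.foliateFields) (k : ℕ) (α : F.BasicForm k) :
    F.ι (F.toTransverse X) (DirectSum.lof ℝ ℕ F.BasicForm k α) =
      DirectSum.lof ℝ ℕ F.BasicForm (k - 1) (F.basicContract k X α) := by
  change F.contractFoliate X _ = _
  simp [SingularFoliation.contractFoliate]

lemma formsPullback_d (hf : IsFoliate F G f) (a : G.BasicForms) :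
    formsPullback hf (G.d a) = F.d (formsPullback hf a) := by
  suffices h : formsPullback hf ∘ₗ G.d = F.d ∘ₗ formsPullback hf from LinearMap.congr_fun h a
  ext k α : 2
  simp only [LinearMap.comp_apply, SingularFoliation.d_lof, formsPullback_lof]
  congr 1
  exact Subtype.ext (extD_pullback hf.1 α.2.1).symm

/-- The contraction does not depend on the foliate representative, so it may be computed with the
two that are `f`-related, for which the identity holds pointwise. -/
lemma formsPullback_ι (hf : IsFoliate F G f) {ξ : F.TransverseField} {η : G.TransverseField}
    (h : TransverseRelated f ξ η) (a : G.BasicForms) :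
    formsPullback hf (G.ι η a) = F.ι ξ (formsPullback hf a) := by
  obtain ⟨X, Y, rfl, rfl, hXY⟩ := h
  suffices h : formsPullback hf ∘ₗ G.ι (G.toTransverse Y) =
    F.ι (F.toTransverse X) ∘ₗ formsPullback hf from LinearMap.congr_fun h a
  ext k α : 2
  simp only [LinearMap.comp_apply, SingularFoliation.ι_lof, formsPullback_lof]
  congr 1
  refine Subtype.ext ?_
  change pullback f (k - 1) (contract Y.1 k α.1) = contract X.1 k (pullback f k α.1)
  match k, α with
  | 0, α => exact map_zero (pullback f 0)
  | k + 1, α =>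
    funext x
    let D : E →L[ℝ] E' := mfderiv 𝓘(ℝ, E) 𝓘(ℝ, E') f x
    let v : E := X.1 x
    let w : E' := Y.1 (f x)
    have hvw : D v = w := hXY x
    change ((α.1 (f x)).curryLeft w).compContinuousLinearMap D =
      ((α.1 (f x)).compContinuousLinearMap D).curryLeft v
    rw [ContinuousAlternatingMap.curryLeft_compContinuousLinearMap, hvw]

end

lemma formsPullback_comp {E'' : Type*} [NormedAddCommGroup E''] [NormedSpace ℝ E'']
    [FiniteDimensional ℝ E''] {P : Type*} [TopologicalSpace P] [ChartedSpace E'' P]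
    [IsManifold 𝓘(ℝ, E'') ∞ P] {K : SingularFoliation E'' P} [T2Space N] [T2Space P]
    {f : M → N} {g : N → P} (hf : IsFoliate F G f) (hg : IsFoliate G K g)
    (hgf : IsFoliate F K (g ∘ f)) :
    formsPullback hf ∘ₗ formsPullback hg = formsPullback hgf := by
  ext k α : 2
  simp only [LinearMap.comp_apply, formsPullback_lof]
  congr 1
  refine Subtype.ext (funext fun x => ?_)
  have h := mfderiv_comp x ((hg.1 (f x)).mdifferentiableAt (by simp))
    ((hf.1 x).mdifferentiableAt (by simp))
  exact congrArg (α.1 (g (f x))).compContinuousLinearMap h.symm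

lemma formsPullback_id [T2Space M] (h : IsFoliate F F id) :
    formsPullback h = LinearMap.id := by
  ext k α : 2
  simp only [LinearMap.comp_apply, formsPullback_lof, LinearMap.id_apply]
  congr 1
  refine Subtype.ext (funext fun x => ?_)
  have e : (mfderiv 𝓘(ℝ, E) 𝓘(ℝ, E) (id : M → M) x : E →L[ℝ] E) = ContinuousLinearMap.id ℝ E :=
    mfderiv_id
  have h1 : ((basicPullback h k α).1 : RawForm E M k) x = (α.1 x).compContinuousLinearMap
    (mfderiv 𝓘(ℝ, E) 𝓘(ℝ, E) (id : M → M) x : E →L[ℝ] E) := rfl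
  refine h1.trans ?_
  rw [e]
  rfl

lemma toTransverse_eq_iff {X X' : F.foliateFields} :
    F.toTransverse X = F.toTransverse X' ↔ X.1 - X'.1 ∈ F.tangentFields :=
  Submodule.Quotient.eq _

/-! ### The homotopy operator on basic forms. -/

section Homotopy

variable {f : M × ℝ → N}

lemma homotopyOpSucc_zero {k : ℕ} : (homotopyOpSucc f (0 : RawForm E' N (k + 1)) : RawForm E M k) = 0 := by
  funext x
  have h (t : ℝ) : homotopyIntegrand (E := E) f (0 : RawForm E' N (k + 1)) x t = 0 := by
    change ((0 : E' [⋀^Fin (k + 1)]→L[ℝ] ℝ).curryLeft _).compContinuousLinearMap _ = 0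
    rw [ContinuousAlternatingMap.curryLeft_zero]
    rfl
  simp [homotopyOpSucc, h]

/-- Additivity of the integral needs integrability in `t`, which smoothness supplies; so the
operator becomes a linear map only on basic forms, not on raw ones. -/
lemma homotopyOp_add (hf : ContMDiff (𝓘(ℝ, E).prod 𝓘(ℝ, ℝ)) 𝓘(ℝ, E') ∞ f) {k : ℕ}
    {α β : RawForm E' N k} (hα : IsSmoothForm α) (hβ : IsSmoothForm β) :
    (homotopyOp f k (α + β) : RawForm E M (k - 1)) = homotopyOp f k α + homotopyOp f k β := by
  cases k with
  | zero => exact (add_zero _).symm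
  | succ k =>
    funext x
    exact intervalIntegral.integral_add
      ((continuous_homotopyIntegrand hf hα x).intervalIntegrable _ _)
      ((continuous_homotopyIntegrand hf hβ x).intervalIntegrable _ _)

lemma homotopyOp_smul (c : ℝ) {k : ℕ} (α : RawForm E' N k) :
    (homotopyOp f k (c • α) : RawForm E M (k - 1)) = c • homotopyOp f k α := by
  cases k with
  | zero => exact (smul_zero _).symm
  | succ k => funext x; exact intervalIntegral.integral_smul c (homotopyIntegrand (E := E) f α x)

variable [T2Space N]

/-- The derivative of each `f_t` maps `X` to vectors tangent to `G`, which `α` annihilates. Hence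
`X` counts as related to the zero field on `N`. -/
lemma contract_homotopyOp_eq_zero (hf : ContMDiff (𝓘(ℝ, E).prod 𝓘(ℝ, ℝ)) 𝓘(ℝ, E') ∞ f)
    (hfol : ∀ t, IsFoliate F G fun x => f (x, t)) {k : ℕ} {α : RawForm E' N k}
    (hα : α ∈ G.basicForms k) {X : VField E M} (hX : X ∈ F.tangentFields) :
    contract X (k - 1) (homotopyOp f k α : RawForm E M (k - 1)) = 0 := by
  match k, α with
  | 0, α => rfl
  | 1, α => rfl
  | k + 2, α =>
    have h := contract_homotopyOpSucc hf X (0 : VField E' N) hα.1 fun x t => by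
      refine (G.curryLeft_eq_zero hα ((hfol t).mfderiv_mem_tangent (hX x))).trans ?_
      exact (map_zero (α (f (x, t))).curryLeft).symm
    have h0 : contract (0 : VField E' N) (k + 2) α = (0 : RawForm E' N (k + 1)) :=
      funext fun y => map_zero (α y).curryLeft
    rw [h0, homotopyOpSucc_zero, neg_zero] at h
    exact h

/-- For the condition on `d h α`, the homotopy formula writes it as `f₁^* α - f₀^* α - h d α`, and
tangent fields annihilate each term. -/
lemma homotopyOp_mem (hf : ContMDiff (𝓘(ℝ, E).prod 𝓘(ℝ, ℝ)) 𝓘(ℝ, E') ∞ f)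
    (hfol : ∀ t, IsFoliate F G fun x => f (x, t)) {k : ℕ} {α : RawForm E' N k}
    (hα : α ∈ G.basicForms k) : (homotopyOp f k α : RawForm E M (k - 1)) ∈ F.basicForms (k - 1) := by
  refine ⟨isSmoothForm_homotopyOp hf hα.1, fun X hX =>
    ⟨contract_homotopyOp_eq_zero hf hfol hα hX, ?_⟩⟩
  cases k with
  | zero =>
    have h : extD (0 : RawForm E M 0) = 0 := extD_zero
    exact (congrArg (contract X 1) h).trans (contract_zero_right _)
  | succ k =>
    have h := eq_sub_of_add_eq (extD_homotopyOpSucc (E := E) hf hα.1)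
    refine (congrArg (contract X (k + 1)) h).trans ?_
    rw [contract_sub_right, contract_sub_right, (hfol 1).contract_pullback hα hX,
      (hfol 0).contract_pullback hα hX, sub_zero, zero_sub, neg_eq_zero]
    exact contract_homotopyOp_eq_zero hf hfol (G.extD_mem_basicForms hα) hX

/-- The homotopy operator on basic `k`-forms. -/
def basicHomotopy (hf : ContMDiff (𝓘(ℝ, E).prod 𝓘(ℝ, ℝ)) 𝓘(ℝ, E') ∞ f)
    (hfol : ∀ t, IsFoliate F G fun x => f (x, t)) (k : ℕ) :
    G.BasicForm k →ₗ[ℝ] F.BasicForm (k - 1) where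
  toFun α := ⟨homotopyOp f k α.1, homotopyOp_mem hf hfol α.2⟩
  map_add' α β := Subtype.ext (homotopyOp_add hf α.2.1 β.2.1)
  map_smul' c α := Subtype.ext (homotopyOp_smul c α.1)

/-- The homotopy operator on basic forms. -/
def formsHomotopy (hf : ContMDiff (𝓘(ℝ, E).prod 𝓘(ℝ, ℝ)) 𝓘(ℝ, E') ∞ f)
    (hfol : ∀ t, IsFoliate F G fun x => f (x, t)) : G.BasicForms →ₗ[ℝ] F.BasicForms :=
  DirectSum.toModule ℝ ℕ _ fun k => DirectSum.lof ℝ ℕ F.BasicForm (k - 1) ∘ₗ basicHomotopy hf hfol k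

variable (hf : ContMDiff (𝓘(ℝ, E).prod 𝓘(ℝ, ℝ)) 𝓘(ℝ, E') ∞ f)
    (hfol : ∀ t, IsFoliate F G fun x => f (x, t))

lemma formsHomotopy_lof (k : ℕ) (α : G.BasicForm k) :
    formsHomotopy hf hfol (DirectSum.lof ℝ ℕ G.BasicForm k α) =
      DirectSum.lof ℝ ℕ F.BasicForm (k - 1) (basicHomotopy hf hfol k α) := by
  simp [formsHomotopy]

lemma d_formsHomotopy : F.d ∘ₗ formsHomotopy hf hfol + formsHomotopy hf hfol ∘ₗ G.d =
    formsPullback (hfol 1) - formsPullback (hfol 0) := by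
  ext k α : 2
  simp only [LinearMap.comp_apply, LinearMap.add_apply, LinearMap.sub_apply,
    SingularFoliation.d_lof, formsPullback_lof, formsHomotopy_lof]
  match k, α with
  -- Degree `0` is separate because `0 - 1 = 0` for natural numbers: there `h α` is zero by
  -- convention and only `h d α` remains.
  | 0, α =>
    have h0 : basicHomotopy hf hfol 0 α = 0 := rfl
    rw [h0, map_zero, map_zero, zero_add, ← map_sub]
    exact congrArg (DirectSum.lof ℝ ℕ F.BasicForm 0)
      (Subtype.ext (homotopyOpSucc_extD_zero hf α.2.1))
  | k + 1, α =>
    -- The type of `b` states the degree `k + 2 - 1` as `k + 1`, so that the sum below makes sense.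
    let b : F.BasicForm (k + 1) := basicHomotopy hf hfol (k + 2) (G.basicD (k + 1) α)
    have h : F.basicD k (basicHomotopy hf hfol (k + 1) α) + b =
        basicPullback (hfol 1) (k + 1) α - basicPullback (hfol 0) (k + 1) α :=
      Subtype.ext (extD_homotopyOpSucc hf α.2.1)
    rw [← map_sub, ← h, map_add]
    rfl

/-- One pair of representatives `X`, `Y` is fixed for all `t`. It need not be `f_t`-related, but it
differs from an `f_t`-related pair by tangent fields; `α` annihilates both the image of the first
difference and the second difference. This is the weakened relation that `contract_homotopyOpSucc`
asks for. -/
lemma ι_formsHomotopy {ξ : F.TransverseField} {η : G.TransverseField}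
    (h : ∀ t, TransverseRelated (fun x => f (x, t)) ξ η) :
    F.ι ξ ∘ₗ formsHomotopy hf hfol + formsHomotopy hf hfol ∘ₗ G.ι η = 0 := by
  obtain ⟨X, rfl⟩ := F.tangentIdeal.toSubmodule.mkQ_surjective ξ
  obtain ⟨Y, rfl⟩ := G.tangentIdeal.toSubmodule.mkQ_surjective η
  change F.ι (F.toTransverse X) ∘ₗ _ + _ ∘ₗ G.ι (G.toTransverse Y) = 0
  ext k α : 2
  simp only [LinearMap.comp_apply, LinearMap.add_apply, LinearMap.zero_apply,
    SingularFoliation.ι_lof, formsHomotopy_lof]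
  suffices hs : F.basicContract (k - 1) X (basicHomotopy hf hfol k α) =
      -basicHomotopy hf hfol (k - 1) (G.basicContract k Y α) by
    rw [hs, map_neg, neg_add_cancel]
  refine Subtype.ext ?_
  match k, α with
  -- In degrees `0` and `1` both compositions vanish, since contraction and `h` are zero on
  -- functions.
  | 0, α => exact neg_zero.symm
  | 1, α => exact neg_zero.symm
  | k + 2, α =>
    refine contract_homotopyOpSucc hf X.1 Y.1 α.2.1 fun x t => ?_
    obtain ⟨X', Y', hX, hY, hXY⟩ := h t
    have hX' := toTransverse_eq_iff.1 hX
    have hY' := toTransverse_eq_iff.1 hY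
    let v : E := X.1 x
    let v' : E := X'.1 x
    let w : E' := Y.1 (f (x, t))
    let w' : E' := Y'.1 (f (x, t))
    let D : E →L[ℝ] E' := sliceDeriv E E' f x t
    let a : E' [⋀^Fin (k + 2)]→L[ℝ] ℝ := α.1 (f (x, t))
    have h1 : D v' = w' := hXY x
    have h2 : a.curryLeft (D (v' - v)) = 0 :=
      G.curryLeft_eq_zero α.2 ((hfol t).mfderiv_mem_tangent (hX' x))
    have h3 : a.curryLeft (w' - w) = 0 := G.curryLeft_eq_zero α.2 (hY' _)
    change a.curryLeft (D v) = a.curryLeft w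
    rw [map_sub, map_sub, sub_eq_zero, h1] at h2
    rw [map_sub, sub_eq_zero] at h3
    exact h2.symm.trans h3

end Homotopy

end Basic

/-! ### Maps of Cartan complexes -/

section CartanMaps

variable {E : Type*} [NormedAddCommGroup E] [NormedSpace ℝ E] [FiniteDimensional ℝ E]
  {M : Type*} [TopologicalSpace M] [ChartedSpace E M] [IsManifold 𝓘(ℝ, E) ∞ M]
  {E' : Type*} [NormedAddCommGroup E'] [NormedSpace ℝ E'] [FiniteDimensional ℝ E']
  {N : Type*} [TopologicalSpace N] [ChartedSpace E' N] [IsManifold 𝓘(ℝ, E') ∞ N]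
  {F : SingularFoliation E M} {G : SingularFoliation E' N}
  {𝔤 : Type*} [LieRing 𝔤] [LieAlgebra ℝ 𝔤]
  {μ : 𝔤 →ₗ⁅ℝ⁆ F.TransverseField} {ν : 𝔤 →ₗ⁅ℝ⁆ G.TransverseField}

lemma cartanAction_tmul (μ : 𝔤 →ₗ⁅ℝ⁆ F.TransverseField) (X : 𝔤) (s : SymDual 𝔤)
    (w : F.BasicForms) : cartanAction μ X (s ⊗ₜ[ℝ] w) =
      symDeriv (coad X) s ⊗ₜ[ℝ] w + s ⊗ₜ[ℝ] F.lieDeriv (μ X) w := by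
  simp [cartanAction]

/-- Maps of basic forms that commute with Lie derivatives commute with the action of `𝔤`. -/
lemma cartanAction_baseChange {A : G.BasicForms →ₗ[ℝ] F.BasicForms} {X : 𝔤}
    (hA : A ∘ₗ G.lieDeriv (ν X) = F.lieDeriv (μ X) ∘ₗ A) (a : SymDual 𝔤 ⊗[ℝ] G.BasicForms) :
    cartanAction μ X (A.baseChange (SymDual 𝔤) a) =
      A.baseChange (SymDual 𝔤) (cartanAction ν X a) := by
  induction a with
  | zero => simp
  | add a b ha hb => simp only [map_add, ha, hb]
  | tmul s w =>
    have h : A (G.lieDeriv (ν X) w) = F.lieDeriv (μ X) (A w) := LinearMap.congr_fun hA w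
    simp only [LinearMap.baseChange_tmul, cartanAction_tmul, map_add, h]

lemma mem_cartanComplex_baseChange {A : G.BasicForms →ₗ[ℝ] F.BasicForms}
    (hA : ∀ X : 𝔤, A ∘ₗ G.lieDeriv (ν X) = F.lieDeriv (μ X) ∘ₗ A)
    {a : SymDual 𝔤 ⊗[ℝ] G.BasicForms} (ha : a ∈ cartanComplex ν) :
    A.baseChange (SymDual 𝔤) a ∈ cartanComplex μ := fun X => by
  rw [cartanAction_baseChange (hA X), ha X, map_zero]

variable [FiniteDimensional ℝ 𝔤]

lemma cartanD_tmul (μ : 𝔤 →ₗ⁅ℝ⁆ F.TransverseField) (s : SymDual 𝔤) (w : F.BasicForms) :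
    cartanD μ (s ⊗ₜ[ℝ] w) = s ⊗ₜ[ℝ] F.d w -
      ∑ i, (SymmetricAlgebra.ι ℝ (Module.Dual ℝ 𝔤) ((Module.finBasis ℝ 𝔤).coord i) * s) ⊗ₜ[ℝ]
        F.ι (μ (Module.finBasis ℝ 𝔤 i)) w := by
  simp [cartanD, TensorProduct.smul_tmul']

/-- The conditions on a map of basic forms that make it a map of `𝔤`-differential spaces. -/
structure IsChainMap (μ : 𝔤 →ₗ⁅ℝ⁆ F.TransverseField) (ν : 𝔤 →ₗ⁅ℝ⁆ G.TransverseField)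
    (A : G.BasicForms →ₗ[ℝ] F.BasicForms) : Prop where
  d_comp (w : G.BasicForms) : A (G.d w) = F.d (A w)
  ι_comp (X : 𝔤) (w : G.BasicForms) : A (G.ι (ν X) w) = F.ι (μ X) (A w)

lemma IsChainMap.lieDeriv_comp {A : G.BasicForms →ₗ[ℝ] F.BasicForms} (hA : IsChainMap μ ν A)
    (X : 𝔤) : A ∘ₗ G.lieDeriv (ν X) = F.lieDeriv (μ X) ∘ₗ A := by
  refine LinearMap.ext fun w => ?_
  simp [SingularFoliation.lieDeriv, hA.d_comp, hA.ι_comp]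

lemma IsChainMap.cartanD_baseChange {A : G.BasicForms →ₗ[ℝ] F.BasicForms}
    (hA : IsChainMap μ ν A) (a : SymDual 𝔤 ⊗[ℝ] G.BasicForms) :
    cartanD μ (A.baseChange (SymDual 𝔤) a) = A.baseChange (SymDual 𝔤) (cartanD ν a) := by
  induction a with
  | zero => simp
  | add a b ha hb => simp only [map_add, ha, hb]
  | tmul s w =>
    simp only [LinearMap.baseChange_tmul, cartanD_tmul, map_sub, map_sum, hA.d_comp, hA.ι_comp]

/-- The map of cocycles induced by a map of `𝔤`-differential spaces. -/
def IsChainMap.cocycleMap {A : G.BasicForms →ₗ[ℝ] F.BasicForms} (hA : IsChainMap μ ν A) :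
    Cocycle ν →ₗ[symInvariants 𝔤] Cocycle μ :=
  LinearMap.codRestrict (cocycles μ)
    ((A.baseChange (SymDual 𝔤)).restrictScalars (symInvariants 𝔤) ∘ₗ Cocycle.val ν) fun a =>
    ⟨mem_cartanComplex_baseChange hA.lieDeriv_comp a.2.1, by
      have h : cartanD ν a.1 = 0 := a.2.2
      have h1 : cartanD μ (A.baseChange (SymDual 𝔤) a.1) = 0 := by
        rw [hA.cartanD_baseChange, h, map_zero]
      exact h1⟩

lemma IsChainMap.val_cocycleMap {A : G.BasicForms →ₗ[ℝ] F.BasicForms} (hA : IsChainMap μ ν A)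
    (a : Cocycle ν) :
    Cocycle.val μ (hA.cocycleMap a) = A.baseChange (SymDual 𝔤) (Cocycle.val ν a) := rfl

lemma Cocycle.ext {a b : Cocycle μ} (h : Cocycle.val μ a = Cocycle.val μ b) : a = b :=
  Subtype.ext h

/-- The map of equivariant cohomology induced by a map of `𝔤`-differential spaces. -/
def IsChainMap.cohomologyMap {A : G.BasicForms →ₗ[ℝ] F.BasicForms} (hA : IsChainMap μ ν A) :
    EquivariantCohomology ν →ₗ[symInvariants 𝔤] EquivariantCohomology μ :=
  Submodule.mapQ _ _ hA.cocycleMap (by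
    rintro a ⟨b, hb, hab⟩
    refine ⟨A.baseChange (SymDual 𝔤) b, mem_cartanComplex_baseChange hA.lieDeriv_comp hb, ?_⟩
    refine (hA.cartanD_baseChange b).trans ?_
    rw [hA.val_cocycleMap]
    exact congrArg _ hab)

lemma IsChainMap.cohomologyMap_toClass {A : G.BasicForms →ₗ[ℝ] F.BasicForms}
    (hA : IsChainMap μ ν A) (a : Cocycle ν) :
    hA.cohomologyMap (toClass ν a) = toClass μ (hA.cocycleMap a) := rfl

lemma toClass_surjective (μ : 𝔤 →ₗ⁅ℝ⁆ F.TransverseField) : Function.Surjective (toClass μ) :=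
  Submodule.mkQ_surjective _

/-- Homotopic maps of `𝔤`-differential spaces induce the same map in equivariant cohomology. -/
lemma IsChainMap.cohomologyMap_eq {A B H : G.BasicForms →ₗ[ℝ] F.BasicForms}
    (hA : IsChainMap μ ν A) (hB : IsChainMap μ ν B) (hd : F.d ∘ₗ H + H ∘ₗ G.d = A - B)
    (hι : ∀ X : 𝔤, F.ι (μ X) ∘ₗ H + H ∘ₗ G.ι (ν X) = 0) :
    hA.cohomologyMap = hB.cohomologyMap := by
  have hd' (w : G.BasicForms) : F.d (H w) = A w - B w - H (G.d w) :=
    eq_sub_of_add_eq (LinearMap.congr_fun hd w)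
  have hι' (X : 𝔤) (w : G.BasicForms) : F.ι (μ X) (H w) = -H (G.ι (ν X) w) :=
    eq_neg_of_add_eq_zero_left (LinearMap.congr_fun (hι X) w)
  -- Expanding `d ι H + ι d H` with the two homotopy identities gives `H (d ι + ι d)` and terms in
  -- `A` and `B`. The latter cancel because `A` and `B` commute with `ι`.
  have hL (X : 𝔤) : H ∘ₗ G.lieDeriv (ν X) = F.lieDeriv (μ X) ∘ₗ H := by
    refine LinearMap.ext fun w => ?_
    simp only [SingularFoliation.lieDeriv, LinearMap.comp_apply, LinearMap.add_apply, hι', hd',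
      map_add, map_neg, map_sub, hA.ι_comp, hB.ι_comp]
    abel
  -- The contraction parts of the two equivariant derivatives cancel by `hι`, so only `d H + H d = A
  -- - B` contributes.
  have hD (a : SymDual 𝔤 ⊗[ℝ] G.BasicForms) : cartanD μ (H.baseChange (SymDual 𝔤) a) +
      H.baseChange (SymDual 𝔤) (cartanD ν a) =
      A.baseChange (SymDual 𝔤) a - B.baseChange (SymDual 𝔤) a := by
    induction a with
    | zero => simp
    | add a b ha hb =>
      simp only [map_add]
      rw [add_add_add_comm, ha, hb]
      abel
    | tmul s w =>
      simp only [LinearMap.baseChange_tmul, cartanD_tmul, map_sub, map_sum, hd', hι',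
        TensorProduct.tmul_sub, TensorProduct.tmul_neg, Finset.sum_neg_distrib]
      abel
  refine LinearMap.ext fun c => ?_
  obtain ⟨a, rfl⟩ := toClass_surjective ν c
  rw [hA.cohomologyMap_toClass, hB.cohomologyMap_toClass, ← sub_eq_zero, ← map_sub]
  -- On a cocycle `a` the term with `d_𝔤 a` vanishes, so `H a` is an invariant primitive of `A a - B
  -- a`.
  refine (Submodule.Quotient.mk_eq_zero _).2
    ⟨H.baseChange (SymDual 𝔤) (Cocycle.val ν a), mem_cartanComplex_baseChange hL a.2.1, ?_⟩
  have h0 : cartanD ν (Cocycle.val ν a) = 0 := a.2.2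
  have h := hD (Cocycle.val ν a)
  rw [h0, map_zero, add_zero] at h
  rw [map_sub, hA.val_cocycleMap, hB.val_cocycleMap]
  exact h

variable [T2Space N]

lemma IsEquivariantMap.isChainMap {f : M → N} (hf : IsEquivariantMap μ ν f) :
    IsChainMap μ ν (formsPullback hf.1) :=
  ⟨formsPullback_d hf.1, fun X => formsPullback_ι hf.1 (hf.2 X)⟩

/-- The map `f^*` in equivariant basic cohomology. -/
def cohomologyPullback {f : M → N} (hf : IsEquivariantMap μ ν f) :
    EquivariantCohomology ν →ₗ[symInvariants 𝔤] EquivariantCohomology μ :=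
  hf.isChainMap.cohomologyMap

/-- The inclusion of the basic forms into all forms. -/
def SingularFoliation.inclForms (F : SingularFoliation E M) : F.BasicForms →ₗ[ℝ] RawForms E M :=
  DirectSum.lmap fun k => (show F.BasicForm k →ₗ[ℝ] RawForm E M k from (F.basicForms k).subtype)

lemma SingularFoliation.inclForms_lof (F : SingularFoliation E M) (k : ℕ) (α : F.BasicForm k) :
    F.inclForms (DirectSum.lof ℝ ℕ F.BasicForm k α) =
      DirectSum.lof ℝ ℕ (RawForm E M) k α.1 :=
  DirectSum.lmap_lof _ _ _

lemma toRaw_baseChange {f : M → N} (hf : IsFoliate F G f) (a : SymDual 𝔤 ⊗[ℝ] G.BasicForms) :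
    toRaw F 𝔤 ((formsPullback hf).baseChange (SymDual 𝔤) a) =
      pullbackTotal (SymDual 𝔤) f (toRaw G 𝔤 a) := by
  have h : F.inclForms ∘ₗ formsPullback hf = DirectSum.lmap (pullback f) ∘ₗ G.inclForms := by
    ext k α : 2
    simp only [LinearMap.comp_apply, formsPullback_lof, SingularFoliation.inclForms_lof]
    exact (DirectSum.lmap_lof (pullback f) k α.1).symm
  induction a with
  | zero => simp
  | add a b ha hb => simp only [map_add, ha, hb]
  | tmul s w => exact congrArg (s ⊗ₜ[ℝ] ·) (LinearMap.congr_fun h w)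

lemma isPullback_cohomologyPullback {f : M → N} (hf : IsEquivariantMap μ ν f) :
    IsPullback μ ν f (cohomologyPullback hf) := fun a =>
  ⟨hf.isChainMap.cocycleMap a, toRaw_baseChange hf.1 _, rfl⟩

lemma cohomologyPullback_congr {f g : M → N} (hf : IsEquivariantMap μ ν f)
    (hg : IsEquivariantMap μ ν g) (h : f = g) : cohomologyPullback hf = cohomologyPullback hg := by
  subst h
  rfl

/-- Equivariance of `g ∘ f` is a separate hypothesis: the representatives on `N` related by `f` and
those related by `g` may differ by tangent fields, so the two relations do not simply compose. -/
lemma cohomologyPullback_comp {E'' : Type*} [NormedAddCommGroup E''] [NormedSpace ℝ E'']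
    [FiniteDimensional ℝ E''] {P : Type*} [TopologicalSpace P] [ChartedSpace E'' P]
    [IsManifold 𝓘(ℝ, E'') ∞ P] {K : SingularFoliation E'' P} [T2Space P]
    {ρ : 𝔤 →ₗ⁅ℝ⁆ K.TransverseField} {f : M → N} {g : N → P} (hf : IsEquivariantMap μ ν f)
    (hg : IsEquivariantMap ν ρ g) (hgf : IsEquivariantMap μ ρ (g ∘ f))
    (c : EquivariantCohomology ρ) :
    cohomologyPullback hf (cohomologyPullback hg c) = cohomologyPullback hgf c := by
  obtain ⟨a, rfl⟩ := toClass_surjective ρ c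
  refine congrArg (toClass μ) (Cocycle.ext ?_)
  have h := formsPullback_comp hf.1 hg.1 hgf.1
  rw [IsChainMap.val_cocycleMap, IsChainMap.val_cocycleMap, IsChainMap.val_cocycleMap, ← h,
    LinearMap.baseChange_comp]
  rfl

lemma cohomologyPullback_id [T2Space M] (h : IsEquivariantMap μ μ id)
    (c : EquivariantCohomology μ) : cohomologyPullback h c = c := by
  obtain ⟨a, rfl⟩ := toClass_surjective μ c
  refine congrArg (toClass μ) (Cocycle.ext ?_)
  rw [IsChainMap.val_cocycleMap, formsPullback_id, LinearMap.baseChange_id]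
  rfl

/-- Homotopy invariance, for homotopies parametrized by the real line. -/
lemma cohomologyPullback_eq_of_homotopy {f : M × ℝ → N}
    (hf : ContMDiff (𝓘(ℝ, E).prod 𝓘(ℝ, ℝ)) 𝓘(ℝ, E') ∞ f)
    (heq : ∀ t, IsEquivariantMap μ ν fun x => f (x, t)) :
    cohomologyPullback (heq 1) = cohomologyPullback (heq 0) :=
  IsChainMap.cohomologyMap_eq _ _ (d_formsHomotopy hf fun t => (heq t).1) fun X =>
    ι_formsHomotopy hf (fun t => (heq t).1) fun t => (heq t).2 X

/-- Homotopy invariance of the equivariant basic cohomology. -/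
lemma IsEquivariantHomotopy.cohomologyPullback_eq {f : M × Set.Icc (0 : ℝ) 1 → N}
    (hf : IsEquivariantHomotopy μ ν f) :
    cohomologyPullback (hf.2 1) = cohomologyPullback (hf.2 0) := by
  -- The boundary is removed by reparametrization. `Real.smoothTransition` has values in `[0, 1]`,
  -- where `Set.projIcc` is smooth, and `r` fixes `0` and `1`. Each map of the new homotopy is one
  -- of the old `f_t`, hence still equivariant.
  let r : ℝ → Set.Icc (0 : ℝ) 1 := Set.projIcc 0 1 zero_le_one ∘ Real.smoothTransition
  have hr : ContMDiff 𝓘(ℝ, ℝ) (𝓡∂ 1) ∞ r :=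
    contMDiffOn_projIcc.comp_contMDiff Real.smoothTransition.contDiff.contMDiff fun t =>
      ⟨Real.smoothTransition.nonneg t, Real.smoothTransition.le_one t⟩
  have hg : ContMDiff (𝓘(ℝ, E).prod 𝓘(ℝ, ℝ)) 𝓘(ℝ, E') ∞ fun p : M × ℝ => f (p.1, r p.2) :=
    hf.1.comp (contMDiff_fst.prodMk (hr.comp contMDiff_snd))
  have h := cohomologyPullback_eq_of_homotopy hg fun t => hf.2 (r t)
  have h0 : r 0 = 0 := by simp [r]
  have h1 : r 1 = 1 := by simp [r]
  rw [cohomologyPullback_congr (hf.2 1) (hf.2 (r 1)) (by rw [h1]),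
    cohomologyPullback_congr (hf.2 0) (hf.2 (r 0)) (by rw [h0])]
  exact h

end CartanMaps

/-! ### Multiplicativity -/

section Multiplicativity

variable {E : Type*} [NormedAddCommGroup E] [NormedSpace ℝ E]
  {M : Type*} [TopologicalSpace M] [ChartedSpace E M]
  {E' : Type*} [NormedAddCommGroup E'] [NormedSpace ℝ E']
  {N : Type*} [TopologicalSpace N] [ChartedSpace E' N]

/-- Both sides are sums over the same shuffles and agree term by term. -/
lemma wedgeAlt_comp {k l : ℕ} (α : E' [⋀^Fin k]→L[ℝ] ℝ) (β : E' [⋀^Fin l]→L[ℝ] ℝ)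
    (A : E →L[ℝ] E') : (wedgeAlt α β).compContinuousLinearMap A =
      wedgeAlt (α.compContinuousLinearMap A) (β.compContinuousLinearMap A) := by
  ext v
  simp only [ContinuousAlternatingMap.compContinuousLinearMap_apply, wedgeAlt_apply,
    AlternatingMap.domCoprod'_apply, AlternatingMap.domCoprod_apply, _root_.sum_apply, map_sum]
  refine Finset.sum_congr rfl fun σ _ => ?_
  induction σ using Quotient.inductionOn' with
  | h σ => rfl

lemma pullback_wedge (f : M → N) {k l : ℕ} (α : RawForm E' N k) (β : RawForm E' N l) :
    pullback (E := E) f (k + l) (wedge k l α β) = wedge k l (pullback f k α) (pullback f l β) :=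
  funext fun _ => wedgeAlt_comp _ _ _

lemma wedgeTotal_lof {k l : ℕ} (α : RawForm E M k) (β : RawForm E M l) :
    wedgeTotal (DirectSum.lof ℝ ℕ (RawForm E M) k α) (DirectSum.lof ℝ ℕ (RawForm E M) l β) =
      DirectSum.lof ℝ ℕ (RawForm E M) (k + l) (wedge k l α β) := by
  simp [wedgeTotal]

lemma lmap_pullback_wedgeTotal (f : M → N) (a b : RawForms E' N) :
    DirectSum.lmap (pullback (E := E) f) (wedgeTotal a b) =
      wedgeTotal (DirectSum.lmap (pullback f) a) (DirectSum.lmap (pullback f) b) := by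
  induction a using DirectSum.induction_on with
  | zero => simp
  | add a a' ha ha' => simp only [map_add, LinearMap.add_apply, ha, ha']
  | of k α =>
    induction b using DirectSum.induction_on with
    | zero => simp
    | add b b' hb hb' => simp only [map_add, hb, hb']
    | of l β =>
      change DirectSum.lmap (pullback (E := E) f) (wedgeTotal
        (DirectSum.lof ℝ ℕ (RawForm E' N) k α) (DirectSum.lof ℝ ℕ (RawForm E' N) l β)) =
        wedgeTotal (DirectSum.lmap (pullback f) (DirectSum.lof ℝ ℕ (RawForm E' N) k α))
          (DirectSum.lmap (pullback f) (DirectSum.lof ℝ ℕ (RawForm E' N) l β))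
      rw [wedgeTotal_lof, DirectSum.lmap_lof, DirectSum.lmap_lof, DirectSum.lmap_lof,
        wedgeTotal_lof, pullback_wedge]

lemma pullbackTotal_mulTotal (S : Type*) [CommRing S] [Algebra ℝ S] (f : M → N)
    (a b : S ⊗[ℝ] RawForms E' N) :
    pullbackTotal (E := E) S f (mulTotal S a b) =
      mulTotal S (pullbackTotal S f a) (pullbackTotal S f b) := by
  induction a with
  | zero => simp
  | add a a' ha ha' => simp only [map_add, LinearMap.add_apply, ha, ha']
  | tmul s α =>
    induction b with
    | zero => simp
    | add b b' hb hb' => simp only [map_add, hb, hb']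
    | tmul t β => exact congrArg ((s * t) ⊗ₜ[ℝ] ·) (lmap_pullback_wedgeTotal f α β)

end Multiplicativity

/-! ### Products of cohomology classes, and maps homotopic to the identity. -/

section Products

variable {E : Type*} [NormedAddCommGroup E] [NormedSpace ℝ E] [FiniteDimensional ℝ E]
  {M : Type*} [TopologicalSpace M] [ChartedSpace E M] [IsManifold 𝓘(ℝ, E) ∞ M]
  {E' : Type*} [NormedAddCommGroup E'] [NormedSpace ℝ E'] [FiniteDimensional ℝ E']
  {N : Type*} [TopologicalSpace N] [ChartedSpace E' N] [IsManifold 𝓘(ℝ, E') ∞ N]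
  {F : SingularFoliation E M} {G : SingularFoliation E' N}
  {𝔤 : Type*} [LieRing 𝔤] [LieAlgebra ℝ 𝔤] [FiniteDimensional ℝ 𝔤]
  {μ : 𝔤 →ₗ⁅ℝ⁆ F.TransverseField} {ν : 𝔤 →ₗ⁅ℝ⁆ G.TransverseField}

/-- Cocycle representatives are multiplied inside the space of all forms, where pullback is
multiplicative; pulling back the three representatives gives the required witnesses. -/
lemma IsProduct.pullback [T2Space N] {f : M → N} (hf : IsEquivariantMap μ ν f)
    {a b c : EquivariantCohomology ν} (h : IsProduct ν a b c) :
    IsProduct μ (cohomologyPullback hf a) (cohomologyPullback hf b) (cohomologyPullback hf c) := by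
  obtain ⟨α, β, γ, rfl, rfl, rfl, hp⟩ := h
  refine ⟨hf.isChainMap.cocycleMap α, hf.isChainMap.cocycleMap β, hf.isChainMap.cocycleMap γ,
    rfl, rfl, rfl, ?_⟩
  simp only [IsChainMap.val_cocycleMap, toRaw_baseChange, hp, pullbackTotal_mulTotal]

/-- A map that is equivariantly homotopic to the identity acts trivially on the cohomology. -/
lemma EquivariantlyHomotopic.cohomologyPullback_eq_self [T2Space M] {f : M → M}
    (hf : IsEquivariantMap μ μ f) (h : EquivariantlyHomotopic μ μ f id)
    (c : EquivariantCohomology μ) : cohomologyPullback hf c = c := by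
  obtain ⟨k, hk, hk0, hk1⟩ := h
  -- Equivariance of the identity is read off the end of the homotopy.
  have hid : IsEquivariantMap μ μ id := by
    have h1 := hk.2 1
    rwa [funext hk1] at h1
  rw [cohomologyPullback_congr hf (hk.2 0) (funext hk0).symm, ← hk.cohomologyPullback_eq,
    cohomologyPullback_congr (hk.2 1) hid (funext hk1), cohomologyPullback_id]

end Products

end EquivariantBasic
end

theorem proposition2p4
    {E : Type*} [NormedAddCommGroup E] [NormedSpace ℝ E] [FiniteDimensional ℝ E]
    {M : Type*} [TopologicalSpace M] [T2Space M] [SecondCountableTopology M]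
    [ChartedSpace E M] [IsManifold 𝓘(ℝ, E) ∞ M]
    {E' : Type*} [NormedAddCommGroup E'] [NormedSpace ℝ E'] [FiniteDimensional ℝ E']
    {N : Type*} [TopologicalSpace N] [T2Space N] [SecondCountableTopology N]
    [ChartedSpace E' N] [IsManifold 𝓘(ℝ, E') ∞ N]
    {𝔤 : Type*} [LieRing 𝔤] [LieAlgebra ℝ 𝔤] [FiniteDimensional ℝ 𝔤]
    (F : EquivariantBasic.SingularFoliation E M) (G : EquivariantBasic.SingularFoliation E' N)
    (μ : 𝔤 →ₗ⁅ℝ⁆ F.TransverseField) (ν : 𝔤 →ₗ⁅ℝ⁆ G.TransverseField) :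
    (∀ f : M × Set.Icc (0 : ℝ) 1 → N, EquivariantBasic.IsEquivariantHomotopy μ ν f →
      ∃ Φ : EquivariantBasic.EquivariantCohomology ν →ₗ[EquivariantBasic.symInvariants 𝔤]
          EquivariantBasic.EquivariantCohomology μ,
        EquivariantBasic.IsPullback μ ν (fun x => f (x, 0)) Φ ∧
        EquivariantBasic.IsPullback μ ν (fun x => f (x, 1)) Φ) ∧
    (∀ (f : M → N) (g : N → M),
      EquivariantBasic.IsEquivariantMap μ ν f → EquivariantBasic.IsEquivariantMap ν μ g →
      EquivariantBasic.EquivariantlyHomotopic μ μ (g ∘ f) id →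
      EquivariantBasic.EquivariantlyHomotopic ν ν (f ∘ g) id →
      ∃ Φ : EquivariantBasic.EquivariantCohomology ν ≃ₗ[EquivariantBasic.symInvariants 𝔤]
          EquivariantBasic.EquivariantCohomology μ,
        EquivariantBasic.IsPullback μ ν f Φ ∧
        ∀ a b c, EquivariantBasic.IsProduct ν a b c ↔
          EquivariantBasic.IsProduct μ (Φ a) (Φ b) (Φ c)) := by
  refine ⟨fun f hf => ⟨EquivariantBasic.cohomologyPullback (hf.2 0),
    EquivariantBasic.isPullback_cohomologyPullback (hf.2 0), ?_⟩, fun f g hf hg hgf hfg => ?_⟩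
  · rw [← hf.cohomologyPullback_eq]
    exact EquivariantBasic.isPullback_cohomologyPullback (hf.2 1)
  -- Equivariance of the composites comes from the homotopies at time `0`, not from that of `f` and
  -- `g`.
  · have hgf' : EquivariantBasic.IsEquivariantMap μ μ (g ∘ f) := by
      obtain ⟨k, hk, hk0, -⟩ := hgf
      have h := hk.2 0
      rwa [funext hk0] at h
    have hfg' : EquivariantBasic.IsEquivariantMap ν ν (f ∘ g) := by
      obtain ⟨k, hk, hk0, -⟩ := hfg
      have h := hk.2 0
      rwa [funext hk0] at h
    have h1 (c : EquivariantBasic.EquivariantCohomology μ) :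
        EquivariantBasic.cohomologyPullback hf (EquivariantBasic.cohomologyPullback hg c) = c :=
      (EquivariantBasic.cohomologyPullback_comp hf hg hgf' c).trans
        (hgf.cohomologyPullback_eq_self hgf' c)
    have h2 (c : EquivariantBasic.EquivariantCohomology ν) :
        EquivariantBasic.cohomologyPullback hg (EquivariantBasic.cohomologyPullback hf c) = c :=
      (EquivariantBasic.cohomologyPullback_comp hg hf hfg' c).trans
        (hfg.cohomologyPullback_eq_self hfg' c)
    refine ⟨LinearEquiv.ofLinearMap (EquivariantBasic.cohomologyPullback hf)
      (EquivariantBasic.cohomologyPullback hg) (LinearMap.ext h1) (LinearMap.ext h2),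
      EquivariantBasic.isPullback_cohomologyPullback hf, fun a b c => ⟨fun h => h.pullback hf,
        fun h => ?_⟩⟩
    have h' : EquivariantBasic.IsProduct μ (EquivariantBasic.cohomologyPullback hf a)
      -- A product relation between the images is pulled back by `g`, and `g^* f^* = id` returns it
      -- to the original classes.
      (EquivariantBasic.cohomologyPullback hf b) (EquivariantBasic.cohomologyPullback hf c) := h
    have h3 := h'.pullback hg
    rwa [h2, h2, h2] at h3
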